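/- Let $\Sigma$ be a finite alphabet, whose size is regarded as a constant. For a string $w\in\Sigma^n$, $n\ge 1$, let $C_{\rm rle}(w)$ be the cost of its run-length encoding: the sum, over the maximal runs of identical consecutive characters of $w$, of $\lceil\log_2(\ell+1)\rceil+\lceil\log_2|\Sigma|\rceil$, where $\ell$ is the length of the run. A number $\widehat C$ is a $(\lambda,\epsilon)$-estimate of $C$ if $C/\lambda-\epsilon n\le\widehat C\le\lambda C+\epsilon n$. A randomized algorithm $(\lambda,\epsilon)$-estimates $C_{\rm rle}$ if on every input $w$ it outputs, with probability at least $2/3$, a $(\lambda,\epsilon)$-estimate of $C_{\rm rle}(w)$; it $\lambda$-estimates $C_{\rm rle}$ if it $(\lambda,0)$-estimates it. Algorithms are randomized word RAM programs. A program gets $n$ and (in 1, 2 and 4) its accuracy parameter, given as the integer $\lceil 1/\epsilon\rceil$ or $\lceil 1/\gamma\rceil$. Words have $O(\log(n+1))$ bits in 3, and $O(\log(n+1)+\log(\lceil 1/\epsilon\rceil+1))$, respectively $O(\log(n+1)+\log(\lceil 1/\gamma\rceil+1))$, bits otherwise. An arithmetic operation on words, a memory access, a test, a query for one position of $w$, and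 the choice of a uniformly random element of $\{0,\dots,r-1\}$ for a word $r$ each take $O(1)$ time. The output is a rational number given by numerator and denominator. One program serves all $n$, all $w\in\Sigma^n$ and all values of the accuracy parameter. The time bounds also bound the number of queries. $\tilde O(g)$ means at most $K\,g\,\log^c(2+g)$; the constants $K$ and $c$, the exponent $d$ below and the program may depend only on $\Sigma$. Theorem. 1. There is an algorithm that, for every $n\ge 1$, $w\in\Sigma^n$ and $\epsilon\in(0,1)$, computes with probability at least $2/3$ an $\epsilon n$-additive estimate (that is, a $(1,\epsilon)$-estimate) of $C_{\rm rle}(w)$, and always runs in time $\tilde O(1/\epsilon^3)$. 2. There is an algorithm that, for every $n\ge 1$, $w\in\Sigma^n$ and $\epsilon\in(0,1)$, $(3,\epsilon)$-estimates $C_{\rm rle}(w)$, and always runs in time $\tilde O(1/\epsilon)$. 3. There is an algorithm that, for every $n\ge 1$ and $w\in\Sigma^n$, $4$-estimates $C_{\rm rle}(w)$ in expected time $\tilde O\left(\frac{n}{C_{\rm rle}(w)}\right)$. 4. There are a constant $d$ and an algorithm that, for every $n\ge 1$, $w\in\Sigma^n$ and $\gamma>0$, $(1+\gamma)$-estimates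 $C_{\rm rle}(w)$ in expected time $\tilde O\left(\frac{n}{C_{\rm rle}(w)}\cdot\left(1+\frac1\gamma\right)^d\right)$. The algorithms have no prior knowledge of $C_{\rm rle}(w)$: they get only $n$, the accuracy parameter where there is one, and query access to $w$. -/

import Mathlib

open scoped ENNReal

noncomputable section

namespace RunLength

/-! ### The cost of run-length encoding and the notion of an estimate -/

/-- The cost of the run-length encoding of `w`, in bits: the sum over the maximal runs of `w`
of `⌈log₂ (ℓ + 1)⌉ + ⌈log₂ |A|⌉`, where `ℓ` is the length of the run.
`List.splitBy (· == ·)` cuts a list into its maximal runs of equal consecutive entries and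
`Nat.clog 2 m` is `⌈log₂ m⌉`. -/
def rleCost {A : Type*} [Fintype A] [DecidableEq A] {n : ℕ} (w : Fin n → A) : ℕ :=
  (((List.ofFn w).splitBy (fun a b => a == b)).map
    (fun run => Nat.clog 2 (run.length + 1) + Nat.clog 2 (Fintype.card A))).sum

/-- `v` is a `(lam, ε)`-estimate for the quantity `C` on inputs of length `n`. -/
def IsEstimate (n : ℕ) (lam ε C v : ℝ) : Prop :=
  C / lam - ε * n ≤ v ∧ v ≤ lam * C + ε * n

/-- The bound `K · g · log^c g`, with `2 + g` inside the logarithm so that it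
does not vanish when `g` is close to `1`. -/
def softBound (K : ℝ) (c : ℕ) (g : ℝ) : ℝ :=
  K * g * Real.log (2 + g) ^ c

/-! ### Randomized word RAM programs with query access to a string -/

/-- The arithmetic and comparison operations on words. -/
inductive BinOp where
  | add | sub | mul | div | mod | lt | eq

/-- Subtraction is truncated at `0`; comparisons return `1` for true and `0` for false. -/
def BinOp.eval : BinOp → ℕ → ℕ → ℕ
  | .add, a, b => a + b
  | .sub, a, b => a - b
  | .mul, a, b => a * b
  | .div, a, b => a / b
  | .mod, a, b => a % b
  | .lt, a, b => if a < b then 1 else 0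
  | .eq, a, b => if a = b then 1 else 0

/-- The elementary instructions. The arguments `d`, `a`, `b`, `s` are names of registers. -/
inductive Instr where
  /-- `d := v` for a constant `v` -/
  | const (d v : ℕ)
  /-- `d := a op b` -/
  | op (o : BinOp) (d a b : ℕ)
  /-- `d := memory[a]` -/
  | load (d a : ℕ)
  /-- `memory[a] := s` -/
  | store (a s : ℕ)
  /-- `d :=` the symbol at position `a` of the input string -/
  | query (d a : ℕ)
  /-- `d :=` a fresh uniformly random element of `{0, …, a - 1}` -/
  | rand (d a : ℕ)

/-- Structured programs over the elementary instructions. -/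
inductive Prog where
  | instr (i : Instr)
  | seq (p q : Prog)
  /-- run `p` if register `r` is nonzero, and `q` otherwise -/
  | ifnz (r : ℕ) (p q : Prog)
  /-- while register `r` is nonzero, run `p` -/
  | whilenz (r : ℕ) (p : Prog)

/-- The contents of the registers and of the memory. -/
structure Store where
  reg : ℕ → ℕ
  mem : ℕ → ℕ

/-- Write `v` to register `d`, in words of `b` bits (that is, modulo `2 ^ b`). -/
def Store.set (b : ℕ) (σ : Store) (d v : ℕ) : Store :=
  { σ with reg := Function.update σ.reg d (v % 2 ^ b) }

/-- The effect of an instruction, in words of `b` bits, with query access to the string `x`, whose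
symbols are given by numbers. Positions are `0, …, n - 1`; a query outside this range is
answered by `0`, and so is a request for a random element of the empty set. -/
def Instr.exec (b : ℕ) {n : ℕ} (x : Fin n → ℕ) (σ : Store) : Instr → PMF Store
  | .const d v => PMF.pure (σ.set b d v)
  | .op o d a a' => PMF.pure (σ.set b d (o.eval (σ.reg a) (σ.reg a')))
  | .load d a => PMF.pure (σ.set b d (σ.mem (σ.reg a)))
  | .store a s => PMF.pure { σ with mem := Function.update σ.mem (σ.reg a) (σ.reg s) }
  | .query d a => PMF.pure (σ.set b d (if h : σ.reg a < n then x ⟨σ.reg a, h⟩ else 0))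
  | .rand d a =>
    match σ.reg a with
    | 0 => PMF.pure (σ.set b d 0)
    | m + 1 => (PMF.uniformOfFintype (Fin (m + 1))).map (fun i => σ.set b d i)

/-- A configuration: the stack of program pieces that remain to be run, and the store.
The computation has halted when nothing remains. -/
abbrev Config : Type := List Prog × Store

/-- One step, of unit cost. -/
def step (b : ℕ) {n : ℕ} (x : Fin n → ℕ) : Config → PMF Config
  | ([], σ) => PMF.pure ([], σ)
  | (.instr i :: k, σ) => (i.exec b x σ).map (fun σ' => (k, σ'))
  | (.seq p q :: k, σ) => PMF.pure (p :: q :: k, σ)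
  | (.ifnz r p q :: k, σ) => PMF.pure (if σ.reg r = 0 then (q :: k, σ) else (p :: k, σ))
  | (.whilenz r p :: k, σ) =>
    PMF.pure (if σ.reg r = 0 then (k, σ) else (p :: .whilenz r p :: k, σ))

/-- At the start register `0` holds the length `n` of the string, register `1` holds the numerical
parameter `m`, and everything else is `0`. -/
def start (P : Prog) (n m : ℕ) : Config :=
  ([P], ⟨fun r => if r = 0 then n else if r = 1 then m else 0, fun _ => 0⟩)

/-- The word length: `κ` times the number of bits of the numerical input `(n, m)`. -/
def wordLength (κ n m : ℕ) : ℕ :=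
  κ * (Nat.size n + Nat.size m)

/-- The distribution of the configuration after `t` steps. -/
def runFor (P : Prog) (κ : ℕ) {n : ℕ} (x : Fin n → ℕ) (m : ℕ) : ℕ → PMF Config
  | 0 => PMF.pure (start P n m)
  | t + 1 => (runFor P κ x m t).bind (step (wordLength κ n m) x)

/-- The output is a rational number, with numerator in register `0` and denominator in
register `1`. -/
def Store.output (σ : Store) : ℝ :=
  (σ.reg 0 : ℝ) / (σ.reg 1 : ℝ)

/-- The running time is at most `T`, whatever the random choices. -/
def HaltsWithin (P : Prog) (κ : ℕ) {n : ℕ} (x : Fin n → ℕ) (m : ℕ) (T : ℝ) : Prop :=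
  ∀ c ∈ (runFor P κ x m ⌊T⌋₊).support, c.1 = []

/-- The expected running time, as the sum over `t` of the probability that the running time exceeds
`t`; it is `∞` if the program fails to halt with positive probability. -/
def expectedTime (P : Prog) (κ : ℕ) {n : ℕ} (x : Fin n → ℕ) (m : ℕ) : ℝ≥0∞ :=
  ∑' t : ℕ, (runFor P κ x m t).toOuterMeasure {c | c.1 ≠ []}

/-- The probability that the program halts with an output in `S`. As halted configurations do not
change, the probability of having done so within `t` steps increases with `t`. -/
def outputProb (P : Prog) (κ : ℕ) {n : ℕ} (x : Fin n → ℕ) (m : ℕ) (S : Set ℝ) : ℝ≥0∞ :=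
  ⨆ t : ℕ, (runFor P κ x m t).toOuterMeasure {c | c.1 = [] ∧ c.2.output ∈ S}

/-- The program `(lam, ε)`-estimates the cost of `w` (with success probability at least `2 / 3`),
given query access to `w` with its symbols numbered by `enc`. -/
def Estimates {A : Type*} [Fintype A] [DecidableEq A] (P : Prog) (κ : ℕ)
    (enc : A ≃ Fin (Fintype.card A)) {n : ℕ} (w : Fin n → A) (m : ℕ) (lam ε : ℝ) : Prop :=
  2 / 3 ≤ outputProb P κ (fun i => (enc (w i) : ℕ)) m {v | IsEstimate n lam ε (rleCost w) v}

end RunLength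

end

/-! Charge each run to its first position. For a uniformly random position let `r` be the length of
the run that begins there, or `0` if none does. Then `r` has mean `1`, and the cost `X` of that run
has mean `c = C / n`. The sum of `k` sampled costs, rescaled by `n / k`, estimates `C`.

Two facts make few samples enough. First, costs are logarithmic in lengths, so `X ^ 2 ≤ L X + r / 2
^ j` with `L` linear in `j` (`runCost_sq_le`). The second moment is therefore at most `L c + θ` for
`θ = 2 ^ (-j)`, and Chebyshev's inequality gives error at most `δ max(C, θ n)` up to probability `(L
+ 1) / (k δ ^ 2 θ)`, linear rather than quadratic in `1 / θ` (`samples_bad_le`). Second, the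
expected total length scanned is at most `k`, so by Markov's inequality a budget of `B` scanning
steps runs out with probability at most `k / B`, while the budget bounds the time on every path
(`sampleLoop_spec`, `sampleLoop_accurate`).

The additive estimate takes `θ = 1` and `δ` of order `ε`. The combined estimate takes `θ` of order
`ε` and `δ = 1 / 2`. The multiplicative estimate runs rounds `j = 1, 2, …` with `θ = 2 ^ (-j)` and
fixed `δ = 1 / (m + 1)`, until the estimate is at least `2 θ n` or `θ n ≤ 1`. In an accurate round
either event implies `C ≥ θ n`, so the error is relative. Conversely an accurate round with `C ≥ 4 θ
n` stops. Round `j` is inaccurate with probability at most `1 / (64 j (j + 1))`. These probabilities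
sum to at most `1 / 64`, and they are small enough that the rounds after the first sufficient one
add only a constant factor to the expected time. The fourfold estimate is the case `m = 1`.

On the machine side only the draws are random, so the final store is a function of the list of drawn
positions. All numbers that matter are polynomial in the input, so they fit into words. -/

namespace RunLength

/-! ### Running configurations -/

section Semantics

variable (b : ℕ) {n : ℕ} (x : Fin n → ℕ)

/-- The distribution of the configuration `t` steps after `c`. -/
noncomputable def after (c : Config) : ℕ → PMF Config
  | 0 => PMF.pure c
  | t + 1 => (after c t).bind (step b x)

theorem after_succ (c : Config) (t : ℕ) :
    after b x c (t + 1) = (step b x c).bind fun c' => after b x c' t := by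
  induction t with
  | zero => simp [after]
  | succ t ih =>
    rw [after, ih, PMF.bind_bind]
    rfl

theorem runFor_eq_after (P : Prog) (κ m t : ℕ) :
    runFor P κ x m t = after (wordLength κ n m) x (start P n m) t := by
  induction t with
  | zero => rfl
  | succ t ih => rw [runFor, after, ih]

theorem bind_congr_support {α β : Type*} (p : PMF α) {f g : α → PMF β}
    (h : ∀ a ∈ p.support, f a = g a) : p.bind f = p.bind g := by
  ext y
  simp only [PMF.bind_apply]
  refine tsum_congr fun a => ?_
  by_cases ha : p a = 0
  · simp [ha]
  · rw [h a ((PMF.mem_support_iff _ _).2 ha)]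

theorem step_halted {c : Config} (hc : c.1 = []) : step b x c = PMF.pure c := by
  obtain ⟨k, σ⟩ := c
  simp only at hc
  subst hc
  rfl

theorem after_halted {c : Config} (hc : c.1 = []) (t : ℕ) : after b x c t = PMF.pure c := by
  induction t with
  | zero => rfl
  | succ t ih => rw [after, ih, PMF.pure_bind, step_halted b x hc]

/-- From `c`, every computation path passes within `T` steps through a configuration at which it is
cut, and the distribution of these configurations is `μ`. -/
inductive Exec : Config → ℕ → PMF Config → Prop
  | done (c : Config) (T : ℕ) : Exec c T (PMF.pure c)
  | next (c : Config) (T : ℕ) (f : Config → PMF Config)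
      (h : ∀ c' ∈ (step b x c).support, Exec c' T (f c')) :
      Exec c (T + 1) ((step b x c).bind f)

variable {b x}

theorem Exec.mono {c : Config} {T T' : ℕ} {μ : PMF Config} (h : Exec b x c T μ) (hT : T ≤ T') :
    Exec b x c T' μ := by
  induction h generalizing T' with
  | done c T => exact .done c T'
  | next c T f _ ih =>
    obtain ⟨T', rfl⟩ : ∃ u, T' = u + 1 := ⟨T' - 1, by omega⟩
    exact .next c T' f fun c' hc' => ih c' hc' (by omega)

theorem Exec.bind {c : Config} {T T' : ℕ} {μ : PMF Config} {ν : Config → PMF Config}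
    (h : Exec b x c T μ) (h' : ∀ c' ∈ μ.support, Exec b x c' T' (ν c')) :
    Exec b x c (T + T') (μ.bind ν) := by
  induction h with
  | done c T =>
    rw [PMF.pure_bind]
    exact (h' c (by simp)).mono (by omega)
  | next c T f _ ih =>
    rw [PMF.bind_bind, Nat.add_right_comm]
    exact .next c (T + T') _ fun c' hc' => ih c' hc' fun c'' hc'' =>
      h' c'' ((PMF.mem_support_bind_iff _ _ _).2 ⟨c', hc', hc''⟩)

/-- Halted configurations are fixed by `step`, so once every cut has halted the law no longer
changes. This turns a tree of executions into a worst-case time bound. -/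
theorem Exec.after_eq {c : Config} {T t : ℕ} {μ : PMF Config} (h : Exec b x c T μ)
    (hμ : ∀ c' ∈ μ.support, c'.1 = []) (ht : T ≤ t) : after b x c t = μ := by
  induction h generalizing t with
  | done c T => exact after_halted b x (hμ c (by simp)) t
  | next c T f _ ih =>
    obtain ⟨t, rfl⟩ : ∃ u, t = u + 1 := ⟨t - 1, by omega⟩
    rw [after_succ]
    exact bind_congr_support _ fun c' hc' => ih c' hc'
      (fun c'' hc'' => hμ c'' ((PMF.mem_support_bind_iff _ _ _).2 ⟨c', hc', hc''⟩)) (by omega)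

variable (b x)

/-- The expected number of steps from `c` to a halt. -/
noncomputable def timeFrom (c : Config) : ℝ≥0∞ :=
  ∑' t : ℕ, (after b x c t).toOuterMeasure {c | c.1 ≠ []}

theorem timeFrom_halted {c : Config} (hc : c.1 = []) : timeFrom b x c = 0 := by
  simp [timeFrom, after_halted b x hc, PMF.toOuterMeasure_pure_apply, hc]

/-- Condition on the first step: the term `t = 0` is at most `1`, and the remaining terms are the
expected times from the successors. -/
theorem timeFrom_le_step (c : Config) :
    timeFrom b x c ≤ 1 + ∑' c', step b x c c' * timeFrom b x c' := by
  rw [timeFrom, tsum_eq_zero_add' ENNReal.summable]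
  refine add_le_add ?_ ?_
  · rw [after, PMF.toOuterMeasure_pure_apply]
    split_ifs <;> simp
  · simp only [after_succ, PMF.toOuterMeasure_bind_apply, timeFrom, ← ENNReal.tsum_mul_left]
    rw [ENNReal.tsum_comm]

variable {b x}

theorem tsum_bind_mul {α β : Type*} (p : PMF α) (f : α → PMF β) (g : β → ℝ≥0∞) :
    ∑' y, p.bind f y * g y = ∑' a, p a * ∑' y, f a y * g y := by
  simp only [PMF.bind_apply, ← ENNReal.tsum_mul_left, ← ENNReal.tsum_mul_right]
  rw [ENNReal.tsum_comm]
  simp only [mul_assoc]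

theorem tsum_pure_mul {α : Type*} (a : α) (g : α → ℝ≥0∞) :
    ∑' y, PMF.pure a y * g y = g a := by
  rw [tsum_eq_single a fun y hy => by simp [hy]]
  simp

/-- At most `T` steps precede the cut, and the remaining time is averaged over the cuts. The cuts
need not be halted, so this applies to a single round of a loop. -/
theorem Exec.timeFrom_le {c : Config} {T : ℕ} {μ : PMF Config} (h : Exec b x c T μ) :
    timeFrom b x c ≤ T + ∑' c', μ c' * timeFrom b x c' := by
  induction h with
  | done c T =>
    rw [tsum_pure_mul]
    exact le_add_self
  | next c T f _ ih =>
    refine (timeFrom_le_step b x c).trans ?_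
    rw [tsum_bind_mul]
    have key : ∑' c', step b x c c' * timeFrom b x c' ≤
        ∑' c', (step b x c c' * T + step b x c c' * ∑' c'', f c' c'' * timeFrom b x c'') := by
      refine ENNReal.tsum_le_tsum fun c' => ?_
      rw [← mul_add]
      by_cases hc : step b x c c' = 0
      · simp [hc]
      · exact mul_le_mul_right (ih c' ((PMF.mem_support_iff _ _).2 hc)) _
    rw [ENNReal.tsum_add, ENNReal.tsum_mul_right, PMF.tsum_coe, one_mul] at key
    calc _ ≤ 1 + ((T : ℝ≥0∞) + ∑' c', step b x c c' * ∑' c'', f c' c'' * timeFrom b x c'') := by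
          gcongr
      _ = _ := by push_cast; ring

/-! ### Running programs -/

variable (b x)

/-- From the store `σ`, the program `p` halts within `T` steps, and the distribution of the final
store is `μ`. -/
def Runs (p : Prog) (σ : Store) (T : ℕ) (μ : PMF Store) : Prop :=
  ∀ k : List Prog, Exec b x (p :: k, σ) T (μ.map fun σ' => (k, σ'))

variable {b x}

theorem Runs.mono {p : Prog} {σ : Store} {T T' : ℕ} {μ : PMF Store} (h : Runs b x p σ T μ)
    (hT : T ≤ T') : Runs b x p σ T' μ := fun k => (h k).mono hT

theorem Exec.of_step {c : Config} {c' : Config} {T : ℕ} {μ : PMF Config}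
    (hc : step b x c = PMF.pure c') (h : Exec b x c' T μ) : Exec b x c (T + 1) μ := by
  have := Exec.next (b := b) (x := x) c T (fun _ => μ) fun c'' hc'' => by
    rw [hc, PMF.mem_support_pure_iff] at hc''
    rwa [hc'']
  rwa [PMF.bind_const] at this

theorem Runs.then {p : Prog} {σ : Store} {T T' : ℕ} {μ : PMF Store} {ν : Store → PMF Store}
    (h : Runs b x p σ T μ) (k k' : List Prog)
    (h' : ∀ σ' ∈ μ.support, Exec b x (k, σ') T' ((ν σ').map fun σ'' => (k', σ''))) :
    Exec b x (p :: k, σ) (T + T') ((μ.bind ν).map fun σ'' => (k', σ'')) := by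
  have := (h k).bind (T' := T') (ν := fun c => (ν c.2).map fun σ'' => (k', σ'')) fun c hc => by
    obtain ⟨σ', hσ', rfl⟩ := (PMF.mem_support_map_iff _ _ _).1 hc
    exact h' σ' hσ'
  rwa [PMF.bind_map, Function.comp_def, ← PMF.map_bind] at this

theorem runs_instr (i : Instr) (σ : Store) : Runs b x (.instr i) σ 1 (i.exec b x σ) := fun k => by
  have := Exec.next (b := b) (x := x) (.instr i :: k, σ) 0 PMF.pure fun c _ => .done c 0
  rwa [PMF.bind_pure] at this

theorem Runs.seq {p q : Prog} {σ : Store} {T T' : ℕ} {μ : PMF Store} {ν : Store → PMF Store}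
    (h : Runs b x p σ T μ) (h' : ∀ σ' ∈ μ.support, Runs b x q σ' T' (ν σ')) :
    Runs b x (.seq p q) σ (T + T' + 1) (μ.bind ν) := fun k =>
  .of_step rfl (h.then (q :: k) k fun σ' hσ' => h' σ' hσ' k)

theorem runs_ifnz_zero {r : ℕ} {p q : Prog} {σ : Store} {T : ℕ} {μ : PMF Store}
    (hr : σ.reg r = 0) (h : Runs b x q σ T μ) : Runs b x (.ifnz r p q) σ (T + 1) μ := fun k =>
  .of_step (by rw [step, if_pos hr]) (h k)

theorem runs_ifnz_ne {r : ℕ} {p q : Prog} {σ : Store} {T : ℕ} {μ : PMF Store}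
    (hr : σ.reg r ≠ 0) (h : Runs b x p σ T μ) : Runs b x (.ifnz r p q) σ (T + 1) μ := fun k =>
  .of_step (by rw [step, if_neg hr]) (h k)

theorem runs_whilenz_zero {r : ℕ} {p : Prog} {σ : Store} (hr : σ.reg r = 0) :
    Runs b x (.whilenz r p) σ 1 (PMF.pure σ) := fun k => by
  rw [PMF.pure_map]
  exact .of_step (by rw [step, if_pos hr]) (.done _ 0)

theorem runs_whilenz_ne {r : ℕ} {p : Prog} {σ : Store} {T T' : ℕ} {μ : PMF Store}
    {ν : Store → PMF Store} (hr : σ.reg r ≠ 0) (h : Runs b x p σ T μ)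
    (h' : ∀ σ' ∈ μ.support, Runs b x (.whilenz r p) σ' T' (ν σ')) :
    Runs b x (.whilenz r p) σ (T + T' + 1) (μ.bind ν) := fun k =>
  .of_step (by rw [step, if_neg hr]) (h.then (.whilenz r p :: k) k fun σ' hσ' => h' σ' hσ' k)

theorem Runs.seq_pure {p q : Prog} {σ σ' : Store} {T T' : ℕ} {ν : PMF Store}
    (h : Runs b x p σ T (PMF.pure σ')) (h' : Runs b x q σ' T' ν) :
    Runs b x (.seq p q) σ (T + T' + 1) ν := by
  have := h.seq (ν := fun _ => ν) fun σ'' hσ'' => by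
    rw [PMF.mem_support_pure_iff] at hσ''
    rwa [hσ'']
  rwa [PMF.bind_const] at this

theorem runs_whilenz_pure {r : ℕ} {p : Prog} {σ σ' : Store} {T T' : ℕ}
    {ν : PMF Store} (hr : σ.reg r ≠ 0) (h : Runs b x p σ T (PMF.pure σ'))
    (h' : Runs b x (.whilenz r p) σ' T' ν) :
    Runs b x (.whilenz r p) σ (T + T' + 1) ν := by
  have := runs_whilenz_ne (ν := fun _ => ν) hr h fun σ'' hσ'' => by
    rw [PMF.mem_support_pure_iff] at hσ''
    rwa [hσ'']
  rwa [PMF.bind_const] at this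

/-! ### Straight-line code -/

variable (b x)

/-- The effect of an instruction that makes no random choice. -/
def Instr.eff (σ : Store) : Instr → Store
  | .const d v => σ.set b d v
  | .op o d a a' => σ.set b d (o.eval (σ.reg a) (σ.reg a'))
  | .load d a => σ.set b d (σ.mem (σ.reg a))
  | .store a s => { σ with mem := Function.update σ.mem (σ.reg a) (σ.reg s) }
  | .query d a => σ.set b d (if h : σ.reg a < n then x ⟨σ.reg a, h⟩ else 0)
  | .rand _ _ => σ

/-- Instructions that make no random choice. -/
def Instr.IsDet : Instr → Prop
  | .rand _ _ => False
  | _ => True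

/-- A program that executes a nonempty list of instructions one after the other. -/
def block : List Instr → Prog
  | [] => .instr (.const 0 0)
  | [i] => .instr i
  | i :: j :: l => .seq (.instr i) (block (j :: l))

variable {b x}

theorem runs_block (l : List Instr) (hl : l ≠ []) (h : ∀ i ∈ l, i.IsDet) (σ : Store) :
    Runs b x (block l) σ (2 * l.length) (PMF.pure (l.foldl (Instr.eff b x) σ)) := by
  have one : ∀ (i : Instr) (σ : Store), i.IsDet →
      Runs b x (.instr i) σ 1 (PMF.pure (i.eff b x σ)) := fun i σ hi => by
    have := runs_instr (b := b) (x := x) i σ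
    cases i <;> first | exact this | exact hi.elim
  induction l generalizing σ with
  | nil => exact absurd rfl hl
  | cons i l ih =>
    cases l with
    | nil => exact (one i σ (h i (by simp))).mono (by simp)
    | cons j l =>
      exact ((one i σ (h i (by simp))).seq_pure
        (ih (by simp) (fun i' hi' => h i' (by simp_all)) _)).mono (by simp; omega)

theorem set_reg (σ : Store) (d v r : ℕ) :
    (σ.set b d v).reg r = if r = d then v % 2 ^ b else σ.reg r := by
  simp [Store.set, Function.update_apply]

/-! ### Consequences for whole programs -/

theorem Runs.exec_nil {P : Prog} {σ : Store} {T : ℕ} {μ : PMF Store} (h : Runs b x P σ T μ) :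
    Exec b x ([P], σ) T (μ.map fun σ' => ([], σ')) := h []

theorem halted_of_mem_support_map {μ : PMF Store} :
    ∀ c ∈ (μ.map fun σ' => (([], σ') : Config)).support, c.1 = [] := fun c hc => by
  obtain ⟨σ', _, rfl⟩ := (PMF.mem_support_map_iff _ _ _).1 hc
  rfl

/-- The store at the start. -/
def startStore (n m : ℕ) : Store :=
  ⟨fun r => if r = 0 then n else if r = 1 then m else 0, fun _ => 0⟩

theorem start_eq (P : Prog) (m : ℕ) : start P n m = ([P], startStore n m) := rfl

theorem haltsWithin_of_runs {P : Prog} {κ m T : ℕ} {μ : PMF Store} {B : ℝ}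
    (h : Runs (wordLength κ n m) x P (startStore n m) T μ) (hB : (T : ℝ) ≤ B) :
    HaltsWithin P κ x m B := fun c hc => by
  rw [runFor_eq_after, start_eq, h.exec_nil.after_eq halted_of_mem_support_map (Nat.le_floor hB)] at hc
  exact halted_of_mem_support_map c hc

theorem toOuterMeasure_add_compl {α : Type*} (p : PMF α) (s : Set α) :
    p.toOuterMeasure s + p.toOuterMeasure sᶜ = 1 := by
  rw [PMF.toOuterMeasure_apply, PMF.toOuterMeasure_apply, ← ENNReal.tsum_add, ← p.tsum_coe]
  refine tsum_congr fun a => ?_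
  by_cases ha : a ∈ s <;> simp [ha]

theorem two_thirds_le_outputProb_of_runs {P : Prog} {κ m T : ℕ} {μ : PMF Store} {S : Set ℝ}
    (h : Runs (wordLength κ n m) x P (startStore n m) T μ)
    (hμ : μ.toOuterMeasure {σ | σ.output ∉ S} ≤ ENNReal.ofReal (1 / 3)) :
    2 / 3 ≤ outputProb P κ x m S := by
  refine le_trans ?_ (le_iSup _ T)
  rw [runFor_eq_after, start_eq, h.exec_nil.after_eq halted_of_mem_support_map le_rfl]
  rw [PMF.toOuterMeasure_map_apply]
  have h1 := toOuterMeasure_add_compl μ {σ | σ.output ∉ S}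
  have h2 : {σ : Store | σ.output ∉ S}ᶜ =
      (fun σ' => (([], σ') : Config)) ⁻¹' {c | c.1 = [] ∧ c.2.output ∈ S} := by
    ext σ
    simp
  rw [h2] at h1
  have h3 : (2 / 3 : ℝ≥0∞) + ENNReal.ofReal (1 / 3) = 1 := by
    rw [show (2 / 3 : ℝ≥0∞) = ENNReal.ofReal (2 / 3) by
      rw [ENNReal.ofReal_div_of_pos (by norm_num)]; simp, ← ENNReal.ofReal_add (by norm_num)
      (by norm_num)]
    norm_num
  rw [← h1] at h3
  have h4 : (2 / 3 : ℝ≥0∞) + ENNReal.ofReal (1 / 3) ≤ _ + ENNReal.ofReal (1 / 3) :=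
    h3.le.trans ((add_comm _ _).le.trans (add_le_add_right hμ _))
  exact (ENNReal.add_le_add_iff_right ENNReal.ofReal_ne_top).1 h4

theorem expectedTime_eq_timeFrom (P : Prog) (κ m : ℕ) :
    expectedTime P κ x m = timeFrom (wordLength κ n m) x ([P], startStore n m) := by
  simp only [expectedTime, runFor_eq_after, timeFrom]
  rfl

end Semantics

/-! ### Runs and their first positions -/

section Runs

variable {α : Type*} [DecidableEq α]

/-- The number of entries equal to `a` that follow each other from position `p` on. -/
def scanLen (l : List α) (a : α) (p : ℕ) : ℕ :=
  ((l.drop p).takeWhile fun b => decide (b = a)).length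

/-- The length of the run that begins at position `t`, and `0` if no run begins there. The list
is thought of as preceded by `prev`. -/
def startLen (prev : Option α) (l : List α) (t : ℕ) : ℕ :=
  if (if t = 0 then prev else l[t - 1]?) = l[t]? then 0
  else ((l.drop t).takeWhile fun b => decide (some b = l[t]?)).length

theorem startLen_cons_succ (prev : Option α) (a : α) (l : List α) (t : ℕ) :
    startLen prev (a :: l) (t + 1) = startLen (some a) l t := by
  cases t <;> simp [startLen]

/-- The entries equal to `a` at the front form a chain, and the first entry after them differs from
`a`, so the first cut falls exactly there. -/
theorem splitBy_cons (a : α) (l : List α) :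
    (a :: l).splitBy (fun a b => a == b) = (a :: l.takeWhile fun b => decide (b = a)) ::
      (l.dropWhile fun b => decide (b = a)).splitBy (fun a b => a == b) := by
  have all : ∀ c ∈ a :: l.takeWhile (fun b => decide (b = a)), c = a := by
    intro c hc
    rcases List.mem_cons.1 hc with rfl | hc
    · rfl
    · simpa using List.mem_takeWhile_imp hc
  have hchain : (a :: l.takeWhile fun b => decide (b = a)).IsChain
      (fun c d => (c == d) = true) := by
    refine List.Pairwise.isChain (List.pairwise_of_forall_mem_list fun c hc d hd => ?_)
    rw [all c hc, all d hd, beq_self_eq_true]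
  conv_lhs => rw [← List.takeWhile_append_dropWhile (p := fun b => decide (b = a)) (l := l),
    ← List.cons_append]
  rw [List.splitBy_append, List.splitBy_of_isChain (by simp) hchain]
  · rfl
  · intro c hc d hd
    rw [all c (List.mem_of_getLast? hc)]
    have := List.head?_dropWhile_not (fun b => decide (b = a)) l
    rw [Option.mem_def.1 hd] at this
    simp only [decide_eq_false_iff_not] at this
    simpa using fun h => this h.symm

/-- The sum of `g` over the lengths of the maximal runs. -/
def runSum (g : ℕ → ℕ) (l : List α) : ℕ :=
  ((l.splitBy (fun a b => a == b)).map fun run => g run.length).sum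

theorem runSum_cons (g : ℕ → ℕ) (a : α) (l : List α) :
    runSum g (a :: l) = g ((l.takeWhile fun b => decide (b = a)).length + 1) +
      runSum g (l.dropWhile fun b => decide (b = a)) := by
  rw [runSum, splitBy_cons]
  simp [runSum]

/-- The copies of `a` at the front continue the run of the preceding `a`. No run begins at them, so
they contribute `g 0 = 0`. -/
theorem sum_startLen_some {g : ℕ → ℕ} (hg : g 0 = 0) (a : α) (l : List α) :
    ∑ t ∈ Finset.range l.length, g (startLen (some a) l t) =
      runSum g (l.dropWhile fun b => decide (b = a)) := by
  induction l generalizing a with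
  | nil => simp [runSum]
  | cons c l ih =>
    rw [List.length_cons, Finset.sum_range_succ']
    simp only [startLen_cons_succ]
    rw [ih]
    by_cases h : c = a
    · subst h
      simp [startLen, hg]
    · rw [List.dropWhile_cons, if_neg (by simpa using h), runSum_cons]
      simp [startLen, Ne.symm h, add_comm]

theorem sum_startLen {g : ℕ → ℕ} (hg : g 0 = 0) (l : List α) :
    ∑ t ∈ Finset.range l.length, g (startLen none l t) = runSum g l := by
  cases l with
  | nil => simp [runSum]
  | cons c l =>
    rw [List.length_cons, Finset.sum_range_succ']
    simp only [startLen_cons_succ]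
    rw [sum_startLen_some hg, runSum_cons]
    simp [startLen, add_comm]

theorem runSum_id (l : List α) : runSum (fun r => r) l = l.length := by
  rw [runSum, ← List.length_flatten, List.flatten_splitBy]

theorem startLen_map {β : Type*} [DecidableEq β] {e : α → β} (he : Function.Injective e)
    (prev : Option α) (l : List α) (t : ℕ) :
    startLen (prev.map e) (l.map e) t = startLen prev l t := by
  have h1 : (if t = 0 then prev.map e else (l.map e)[t - 1]?) =
      (if t = 0 then prev else l[t - 1]?).map e := by
    split_ifs <;> simp
  have inj := Option.map_injective he
  have h2 : (fun b => decide (some b = (l.map e)[t]?)) ∘ e = fun b => decide (some b = l[t]?) := by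
    funext c
    simp only [Function.comp_apply]
    rw [List.getElem?_map, ← Option.map_some, decide_eq_decide]
    exact inj.eq_iff
  simp only [startLen]
  refine ite_congr ?_ (fun _ => rfl) fun _ => ?_
  · rw [h1, List.getElem?_map, inj.eq_iff]
  · rw [← List.map_drop, List.takeWhile_map, List.length_map, h2]

/-- The cost of a run of length `r`, if `s` bits are spent on a symbol. -/
def runCost (s r : ℕ) : ℕ :=
  if r = 0 then 0 else Nat.clog 2 (r + 1) + s

theorem runCost_pos (s : ℕ) {r : ℕ} (hr : r ≠ 0) : 1 ≤ runCost s r := by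
  rw [runCost, if_neg hr]
  have := Nat.clog_pos (b := 2) (n := r + 1) (by norm_num) (by omega)
  omega

theorem runCost_le (s r : ℕ) : runCost s r ≤ (1 + s) * r := by
  rw [runCost]
  split_ifs with h
  · simp
  · have h1 : Nat.clog 2 (r + 1) ≤ r := Nat.clog_le_of_le_pow Nat.lt_two_pow_self
    have : s ≤ s * r := Nat.le_mul_of_pos_right _ (by omega)
    linarith [add_mul 1 s r]

theorem runCost_le_add (s r : ℕ) : runCost s r ≤ r + s := by
  rw [runCost]
  split_ifs with h
  · simp
  · have h1 : Nat.clog 2 (r + 1) ≤ r := Nat.clog_le_of_le_pow Nat.lt_two_pow_self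
    omega

theorem four_mul_sq_le_two_pow {h : ℕ} (hh : 8 ≤ h) : 4 * h ^ 2 ≤ 2 ^ h := by
  induction h, hh using Nat.le_induction with
  | base => norm_num
  | succ h hh ih => rw [pow_succ 2]; nlinarith

/-- A cost above the threshold forces a run so long that the squared logarithm, even multiplied by
`2 ^ j`, is below its length. Summed over all positions, where the lengths add up to `n`, this is
the second moment bound. -/
theorem runCost_sq_le (s j r : ℕ) :
    (runCost s r) ^ 2 * 2 ^ j ≤ (2 * s + 2 * j + 18) * runCost s r * 2 ^ j + r := by
  by_cases hL : runCost s r ≤ 2 * s + 2 * j + 18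
  · rw [sq]
    exact (Nat.mul_le_mul_right _ (Nat.mul_le_mul_right _ hL)).trans (Nat.le_add_right _ _)
  · refine le_trans ?_ (Nat.le_add_left _ _)
    have hr : r ≠ 0 := by
      rintro rfl
      simp [runCost] at hL
    rw [runCost, if_neg hr] at hL ⊢
    have h1 := Nat.pow_pred_clog_lt_self (b := 2) (x := r + 1) (by norm_num) (by omega)
    generalize Nat.clog 2 (r + 1) = u at *
    rw [Nat.pred_eq_sub_one] at h1
    -- The negation of `hL` gives `h > s + j + 17`. Hence the cost `h + j + 1 + s` is at most `2 h`,
    -- and `h ≥ 8`.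
    obtain ⟨h, rfl⟩ : ∃ h, u = h + j + 1 := ⟨u - j - 1, by omega⟩
    have h2 := four_mul_sq_le_two_pow (h := h) (by omega)
    have h3 : (h + j + 1 + s) ^ 2 ≤ 4 * h ^ 2 := by
      rw [show 4 * h ^ 2 = (2 * h) ^ 2 by ring]
      exact Nat.pow_le_pow_left (by omega) 2
    calc _ ≤ 2 ^ h * 2 ^ j := Nat.mul_le_mul_right _ (h3.trans h2)
      _ = 2 ^ (h + j + 1 - 1) := by rw [← pow_add]; rfl
      _ ≤ r := by omega

/-- Only equality of symbols matters for runs, so the cost may be computed from the codes that the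
program sees. -/
theorem rleCost_eq_sum [Fintype α] {n : ℕ} (w : Fin n → α) {e : α → ℕ}
    (he : Function.Injective e) :
    rleCost w = ∑ t : Fin n, runCost (Nat.clog 2 (Fintype.card α))
      (startLen none (List.ofFn fun i => e (w i)) t) := by
  have h1 : rleCost w = runSum (runCost (Nat.clog 2 (Fintype.card α))) (List.ofFn w) := by
    rw [rleCost, runSum]
    congr 1
    refine List.map_congr_left fun run hrun => ?_
    -- The pieces of `splitBy` are nonempty, so the value of `runCost` at `0` is never used for an
    -- actual run.
    rw [runCost, if_neg]
    simpa using List.ne_nil_of_mem_splitBy hrun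
  rw [h1, ← sum_startLen (by simp [runCost]), List.length_ofFn, Finset.sum_range]
  refine Finset.sum_congr rfl fun t _ => ?_
  rw [← startLen_map he, List.map_ofFn]
  rfl

theorem sum_startLen_ofFn {n : ℕ} (x : Fin n → α) :
    ∑ t : Fin n, startLen none (List.ofFn x) t = n := by
  have := sum_startLen (g := fun r => r) rfl (List.ofFn x)
  rwa [runSum_id, List.length_ofFn, Finset.sum_range] at this

theorem scanLen_of_eq {n : ℕ} (x : Fin n → α) {a : α} {p : ℕ} (hp : p < n) (h : x ⟨p, hp⟩ = a) :
    scanLen (List.ofFn x) a p = scanLen (List.ofFn x) a (p + 1) + 1 := by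
  rw [scanLen, List.drop_eq_getElem_cons (by simpa using hp)]
  simp [h, scanLen]

theorem scanLen_of_ne {n : ℕ} (x : Fin n → α) {a : α} {p : ℕ}
    (h : ∀ hp : p < n, x ⟨p, hp⟩ ≠ a) : scanLen (List.ofFn x) a p = 0 := by
  by_cases hp : p < n
  · rw [scanLen, List.drop_eq_getElem_cons (by simpa using hp)]
    simp [h hp]
  · rw [scanLen, List.drop_eq_nil_of_le (by simpa using hp)]
    rfl

theorem scanLen_le {n : ℕ} (x : Fin n → α) (a : α) (p : ℕ) :
    scanLen (List.ofFn x) a p ≤ n - p := by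
  refine (List.takeWhile_prefix _).length_le.trans ?_
  simp

theorem startLen_ofFn {n : ℕ} (x : Fin n → α) (t : Fin n) :
    startLen none (List.ofFn x) t =
      if 0 < (t : ℕ) ∧ x ⟨t - 1, by omega⟩ = x t then 0
      else scanLen (List.ofFn x) (x t) t := by
  have h1 : (List.ofFn x)[(t : ℕ)]? = some (x t) := by simp
  simp only [startLen, h1, scanLen, Option.some.injEq]
  by_cases h0 : (t : ℕ) = 0
  · simp [h0]
  · have h2 : (List.ofFn x)[(t : ℕ) - 1]? = some (x ⟨t - 1, by omega⟩) := by
      rw [List.getElem?_ofFn, dif_pos]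
    simp [h0, h2, Nat.pos_of_ne_zero h0]

end Runs

/-! ### Independent uniform samples -/

section Sampling

variable {n : ℕ}

/-- `k` independent uniformly random positions. -/
noncomputable def samples (n : ℕ) [Nonempty (Fin n)] : ℕ → PMF (List (Fin n))
  | 0 => PMF.pure []
  | k + 1 => (PMF.uniformOfFintype (Fin n)).bind fun i => (samples n k).map (i :: ·)

/-- The expectation of `f` over `k` independent uniformly random positions. -/
noncomputable def expect : ℕ → (List (Fin n) → ℝ) → ℝ
  | 0, f => f []
  | k + 1, f => (∑ i : Fin n, expect k fun l => f (i :: l)) / n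

theorem expect_mono (k : ℕ) {f g : List (Fin n) → ℝ} 
    (h : ∀ l, l.length = k → f l ≤ g l) : expect k f ≤ expect k g := by
  induction k generalizing f g with
  | zero => exact h [] rfl
  | succ k ih =>
    exact div_le_div_of_nonneg_right (Finset.sum_le_sum fun i _ => ih fun l hl => h _ (by simp [hl]))
      (Nat.cast_nonneg n)

theorem expect_add (k : ℕ) (f g : List (Fin n) → ℝ) :
    expect k (fun l => f l + g l) = expect k f + expect k g := by
  induction k generalizing f g with
  | zero => rfl
  | succ k ih => simp only [expect, ih, Finset.sum_add_distrib, add_div]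

theorem expect_mul (k : ℕ) (a : ℝ) (f : List (Fin n) → ℝ) :
    expect k (fun l => a * f l) = a * expect k f := by
  induction k generalizing f with
  | zero => rfl
  | succ k ih => simp only [expect, ih, ← Finset.mul_sum, mul_div_assoc]

theorem expect_const [NeZero n] (k : ℕ) (a : ℝ) : expect (n := n) k (fun _ => a) = a := by
  induction k with
  | zero => rfl
  | succ k ih =>
    have : (n : ℝ) ≠ 0 := NeZero.ne _
    simp only [expect, ih]
    simp
    field_simp

theorem expect_nonneg (k : ℕ) {f : List (Fin n) → ℝ} (h : ∀ l, 0 ≤ f l) : 0 ≤ expect k f := by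
  have := expect_mono k (f := fun l => 0 * f l) (g := f) fun l _ => by simpa using h l
  rw [expect_mul] at this
  simpa using this

theorem expect_sum [NeZero n] (k : ℕ) (Y : Fin n → ℝ) :
    expect k (fun l => (l.map Y).sum) = k * ((∑ i, Y i) / n) := by
  induction k with
  | zero => simp [expect]
  | succ k ih =>
    have : (n : ℝ) ≠ 0 := NeZero.ne _
    simp only [expect, List.map_cons, List.sum_cons, expect_add, ih, expect_const,
      Finset.sum_add_distrib]
    simp
    field_simp
    ring

/-- The samples are independent and `Y` has mean zero, so the cross terms vanish and the variances
add. -/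
theorem expect_sum_sq [NeZero n] (k : ℕ) (Y : Fin n → ℝ) (hY : ∑ i, Y i = 0) :
    expect k (fun l => (l.map Y).sum ^ 2) = k * ((∑ i, Y i ^ 2) / n) := by
  induction k with
  | zero => simp [expect]
  | succ k ih =>
    have : (n : ℝ) ≠ 0 := NeZero.ne _
    have h (i : Fin n) : (expect k fun l => (Y i + (l.map Y).sum) ^ 2) =
        Y i ^ 2 + k * ((∑ i, Y i ^ 2) / n) := by
      have h1 (l : List (Fin n)) : (Y i + (l.map Y).sum) ^ 2 =
          Y i ^ 2 + (2 * Y i * (l.map Y).sum + (l.map Y).sum ^ 2) := by ring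
      simp only [h1, expect_add, expect_const, expect_mul, expect_sum, hY, ih]
      simp
    simp only [expect, List.map_cons, List.sum_cons, h, Finset.sum_add_distrib]
    simp
    field_simp
    ring

open Classical in
-- Probabilities of samples become iterated finite averages of real numbers, where linearity is
-- available.
theorem samples_toOuterMeasure [Nonempty (Fin n)] (k : ℕ) (S : Set (List (Fin n))) :
    (samples n k).toOuterMeasure S =
      ENNReal.ofReal (expect k fun l => if l ∈ S then 1 else 0) := by
  induction k generalizing S with
  | zero =>
    simp only [samples, expect, PMF.toOuterMeasure_pure_apply]
    split_ifs <;> simp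
  | succ k ih =>
    have hn : 0 < (n : ℝ) := by
      have := Fin.pos_iff_nonempty.2 (inferInstance : Nonempty (Fin n))
      exact_mod_cast this
    simp only [samples, expect, PMF.toOuterMeasure_bind_apply, PMF.toOuterMeasure_map_apply, ih]
    rw [tsum_fintype, ENNReal.ofReal_div_of_pos hn, ENNReal.ofReal_sum_of_nonneg
      (fun i _ => expect_nonneg _ fun l => by split_ifs <;> simp), div_eq_mul_inv, mul_comm,
      Finset.mul_sum]
    refine Finset.sum_congr rfl fun i _ => ?_
    simp [PMF.uniformOfFintype_apply]

/-- The estimate from `k` samples of a quantity `X` with mean `c` and second moment at most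
`L c + θ`, together with a budget `B` for the sum of a quantity `Y` with mean at most `1`. -/
theorem samples_bad_le [NeZero n] {X Y : Fin n → ℕ} {c L θ δ : ℝ} {k B : ℕ}
    (hc : ∑ i, (X i : ℝ) = c * n) (hX : ∑ i, (X i : ℝ) ^ 2 ≤ (L * c + θ) * n)
    (hY : ∑ i, Y i ≤ n) (hL : 0 ≤ L) (hθ : 0 < θ) (hδ : 0 < δ) (hk : 0 < k) (hB : 0 < B) :
    (samples n k).toOuterMeasure {l | ¬((l.map Y).sum ≤ B ∧
      |((l.map X).sum : ℝ) - k * c| ≤ k * (δ * max c θ))} ≤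
    ENNReal.ofReal ((L + 1) / (k * δ ^ 2 * θ) + k / B) := by
  classical
  rw [samples_toOuterMeasure]
  refine ENNReal.ofReal_le_ofReal ?_
  have hn : (0 : ℝ) < n := Nat.cast_pos.2 (NeZero.pos n)
  have hk' : (0 : ℝ) < k := Nat.cast_pos.2 hk
  have hB' : (0 : ℝ) < B := Nat.cast_pos.2 hB
  set M := max c θ with hM
  have hM0 : 0 < M := lt_max_of_lt_right hθ
  set η := k * (δ * M) with hη
  have hη0 : 0 < η := by positivity
  set Z : Fin n → ℝ := fun i => X i - c with hZ
  have hZ0 : ∑ i, Z i = 0 := by simp [hZ, Finset.sum_sub_distrib, hc]; ring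
  have hZsum (l : List (Fin n)) (hl : l.length = k) :
      ((l.map X).sum : ℝ) - k * c = (l.map Z).sum := by
    rw [← hl]
    clear hl
    induction l with
    | nil => simp
    | cons i l ih =>
      rw [List.map_cons, List.sum_cons, List.map_cons, List.sum_cons, ← ih, List.length_cons,
        Nat.cast_add, Nat.cast_add, hZ]
      push_cast
      ring
  -- Markov and Chebyshev at once: on the bad event one of the two summands of `g` is at least `1`.
  refine le_trans (expect_mono (g := fun l => (1 / B : ℝ) * (l.map fun i => (Y i : ℝ)).sum +
    (1 / η ^ 2) * (l.map Z).sum ^ 2) k fun l hl => ?_) ?_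
  · have hY0 : ((l.map fun i => (Y i : ℝ)).sum) = ((l.map Y).sum : ℕ) := by
      rw [Nat.cast_list_sum, List.map_map]
      rfl
    rw [← hZsum l hl, hY0]
    split_ifs with h
    · rw [Set.mem_ofPred_eq, not_and_or, not_le, not_le] at h
      rcases h with h | h
      · have : (1 : ℝ) ≤ 1 / B * ((l.map Y).sum : ℕ) := by
          rw [one_div, inv_mul_eq_div, one_le_div hB']
          exact_mod_cast h.le
        nlinarith [show 0 ≤ 1 / η ^ 2 * (((l.map X).sum : ℝ) - k * c) ^ 2 by positivity]
      · have : (1 : ℝ) ≤ 1 / η ^ 2 * (((l.map X).sum : ℝ) - k * c) ^ 2 := by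
          rw [one_div, inv_mul_eq_div, one_le_div (by positivity), ← sq_abs (_ - _)]
          exact pow_le_pow_left₀ hη0.le h.le 2
        have : 0 ≤ (1 / B : ℝ) * ((l.map Y).sum : ℕ) := by positivity
        linarith
    · positivity
  rw [expect_add, expect_mul, expect_mul, expect_sum, expect_sum_sq k Z hZ0, add_comm]
  have hZ2 : ∑ i, Z i ^ 2 ≤ (L + 1) * M * n := by
    have h1 : ∑ i, Z i ^ 2 = ∑ i, (X i : ℝ) ^ 2 - c ^ 2 * n := by
      have (i : Fin n) : Z i ^ 2 = (X i : ℝ) ^ 2 - 2 * c * X i + c ^ 2 := by simp only [hZ]; ring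
      simp only [this, Finset.sum_add_distrib, Finset.sum_sub_distrib, ← Finset.mul_sum, hc]
      simp
      ring
    -- Both `c` and `θ` are at most `M`, so the second moment is linear in `M`.
    have h2 : L * c + θ ≤ (L + 1) * M := by
      nlinarith [mul_le_mul_of_nonneg_left (le_max_left c θ) hL, le_max_right c θ]
    nlinarith [mul_le_mul_of_nonneg_right h2 hn.le, mul_nonneg (sq_nonneg c) hn.le]
  have hY' : (∑ i, (Y i : ℝ)) / n ≤ 1 := by
    rw [div_le_one hn]
    exact_mod_cast hY
  have hMθ : θ ≤ M := le_max_right _ _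
  refine add_le_add ?_ ?_
  -- Of the factor `M ^ 2` in `η ^ 2` one `M` cancels against the second moment, and the other is at
  -- least `θ`.
  · calc 1 / η ^ 2 * (k * ((∑ i, Z i ^ 2) / n)) ≤ 1 / η ^ 2 * (k * ((L + 1) * M)) := by
          gcongr
          rwa [div_le_iff₀ hn]
      _ = (L + 1) / (k * δ ^ 2 * M) := by rw [hη]; field_simp
      _ ≤ _ := by gcongr
  · calc 1 / (B : ℝ) * (k * ((∑ i, (Y i : ℝ)) / n)) ≤ 1 / (B : ℝ) * (k * 1) := by gcongr
      _ = _ := by ring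

end Sampling

/-! ### The sampling program

Register `0` holds `n`, register `2` the number `1`, register `3` the number of bits spent on a
symbol, register `4` the number of samples still to be drawn, register `5` the remaining budget of
scanning steps, register `6` the sum of the costs found so far, and register `17` the number `0`.
Registers `7` to `12` are scratch space. -/

/-- Register `10` says whether scanning is to go on. -/
def scanFlag : List Instr :=
  -- A query past the end is answered by `0`, which may be the code of a symbol. The factor for
  -- `register 7 < n` rules this out, and the factor for `0 < register 5` enforces the budget.
  [.query 11 7, .op .eq 10 11 8, .op .lt 11 7 0, .op .mul 10 10 11, .op .lt 11 17 5,
    .op .mul 10 10 11]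

/-- Scan a run from position `register 7` on, counting in register `9`. -/
def scanLoop : Prog :=
  .whilenz 10 (block ([.op .add 7 7 2, .op .add 9 9 2, .op .sub 5 5 2] ++ scanFlag))

/-- Add the number of binary digits of register `9` to register `6`. -/
def sizeLoop : Prog :=
  .whilenz 9 (block [.op .add 6 6 2, .op .add 11 2 2, .op .div 9 9 11])

/-- Register `10` says whether the position in register `7` fails to be the first one of a run. -/
def inspect : List Instr :=
  -- At position `0` truncated subtraction compares the position with itself. The factor for `0 <
  -- register 7` corrects this.
  [.op .sub 4 4 2, .query 8 7, .op .sub 11 7 2, .query 11 11, .op .eq 10 11 8, .op .lt 11 17 7,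
    .op .mul 10 10 11]

/-- Find the length and the cost of the run that begins at the position in register `7`. -/
def measure : Prog :=
  .seq (block (.op .add 9 17 17 :: scanFlag))
    (.seq scanLoop (.seq sizeLoop (.instr (.op .add 6 6 3))))

/-- Draw a position and process it. -/
def sampleBody : Prog :=
  .seq (.instr (.rand 7 0)) (.seq (block inspect) (.ifnz 10 (.instr (.const 9 0)) measure))

/-- Draw and process as many positions as register `4` says. -/
def sampleLoop : Prog :=
  .whilenz 4 sampleBody

/-- Registers outside the working range of the sampling program are unchanged. -/
def Frame (σ σ' : Store) : Prop :=
  ∀ r, r < 4 ∨ 12 < r → σ'.reg r = σ.reg r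

theorem Frame.refl (σ : Store) : Frame σ σ := fun _ _ => rfl

theorem Frame.trans {σ σ' σ'' : Store} (h : Frame σ σ') (h' : Frame σ' σ'') : Frame σ σ'' :=
  fun r hr => (h' r hr).trans (h r hr)

/-- The constants are in place. -/
structure Ready (n s : ℕ) (σ : Store) : Prop where
  zero : σ.reg 0 = n
  two : σ.reg 2 = 1
  three : σ.reg 3 = s
  seventeen : σ.reg 17 = 0

theorem Ready.of_frame {n s : ℕ} {σ σ' : Store} (h : Ready n s σ) (hf : Frame σ σ') :
    Ready n s σ' where
  zero := (hf 0 (by norm_num)).trans h.zero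
  two := (hf 2 (by norm_num)).trans h.two
  three := (hf 3 (by norm_num)).trans h.three
  seventeen := (hf 17 (by norm_num)).trans h.seventeen

/-! ### Correctness of the scanning loop and of the digit count -/

section

variable {b n s : ℕ} {x : Fin n → ℕ}

theorem scanFlag_reg_of_ne (σ : Store) (r : ℕ) (h10 : r ≠ 10) (h11 : r ≠ 11) :
    (scanFlag.foldl (Instr.eff b x) σ).reg r = σ.reg r := by
  simp [scanFlag, Instr.eff, set_reg, h10, h11]

theorem scanFlag_reg_ten (hb : 1 < 2 ^ b) (hx : ∀ i, x i < 2 ^ b) {σ : Store}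
    (hσ : Ready n s σ) :
    (scanFlag.foldl (Instr.eff b x) σ).reg 10 ≠ 0 ↔
      (∃ h : σ.reg 7 < n, x ⟨σ.reg 7, h⟩ = σ.reg 8) ∧ 0 < σ.reg 5 := by
  have h1 : 1 % 2 ^ b = 1 := Nat.mod_eq_of_lt hb
  simp only [scanFlag, List.foldl_cons, List.foldl_nil, Instr.eff, set_reg, BinOp.eval]
  simp only [hσ.zero, hσ.seventeen]
  by_cases h7 : σ.reg 7 < n
  · simp only [h7, dite_true, Nat.mod_eq_of_lt (hx _)]
    by_cases h8 : x ⟨σ.reg 7, h7⟩ = σ.reg 8 <;> by_cases h5 : 0 < σ.reg 5 <;>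
      simp [h8, h5, h1, h7]
  · simp [h7]

/-- Induction on the remaining budget. The hypothesis that register `9` is at most register `7`
keeps the counter from overflowing, since the scanned position stays below `n`. -/
theorem scanLoop_spec (hb : 1 < 2 ^ b) (hn : n < 2 ^ b) (hx : ∀ i, x i < 2 ^ b) {σ : Store}
    (hσ : Ready n s σ) (h5 : σ.reg 5 < 2 ^ b) (h9 : σ.reg 9 ≤ σ.reg 7)
    (h10 : σ.reg 10 ≠ 0 ↔ (∃ h : σ.reg 7 < n, x ⟨σ.reg 7, h⟩ = σ.reg 8) ∧ 0 < σ.reg 5) :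
    ∃ σ' r, Runs b x scanLoop σ (20 * r + 1) (PMF.pure σ') ∧
      r = min (scanLen (List.ofFn x) (σ.reg 8) (σ.reg 7)) (σ.reg 5) ∧
      σ'.reg 9 = σ.reg 9 + r ∧ σ'.reg 5 = σ.reg 5 - r ∧ σ'.reg 4 = σ.reg 4 ∧
      σ'.reg 6 = σ.reg 6 ∧ Frame σ σ' := by
  induction hB : σ.reg 5 generalizing σ with
  | zero =>
    refine ⟨σ, 0, runs_whilenz_zero ?_, by simp, by simp, by simp [hB], rfl, rfl, .refl σ⟩
    by_contra h
    exact absurd (h10.1 h).2 (by omega)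
  | succ B ih =>
    by_cases h : σ.reg 10 = 0
    · refine ⟨σ, 0, runs_whilenz_zero h, ?_, by simp, by simp [hB], rfl, rfl, .refl σ⟩
      rw [scanLen_of_ne]
      · simp
      · intro hp hxp
        exact h10.2 ⟨⟨hp, hxp⟩, by omega⟩ h
    · obtain ⟨⟨hp, hxp⟩, -⟩ := h10.1 h
      set σ₀ := [Instr.op .add 7 7 2, .op .add 9 9 2, .op .sub 5 5 2].foldl (Instr.eff b x) σ
        with hσ₀
      set σ₁ := scanFlag.foldl (Instr.eff b x) σ₀ with hσ₁
      have e7 : σ₀.reg 7 = σ.reg 7 + 1 := by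
        simp [hσ₀, Instr.eff, set_reg, BinOp.eval, hσ.two]
        exact Nat.mod_eq_of_lt (by omega)
      have e9 : σ₀.reg 9 = σ.reg 9 + 1 := by
        simp [hσ₀, Instr.eff, set_reg, BinOp.eval, hσ.two]
        exact Nat.mod_eq_of_lt (by omega)
      have e5 : σ₀.reg 5 = B := by
        simp [hσ₀, Instr.eff, set_reg, BinOp.eval, hσ.two]
        rw [hB]
        exact Nat.mod_eq_of_lt (by omega)
      have er (r : ℕ) (h5 : r ≠ 5) (h7 : r ≠ 7) (h9 : r ≠ 9) : σ₀.reg r = σ.reg r := by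
        simp [hσ₀, Instr.eff, set_reg, h5, h7, h9]
      have f0 : Frame σ σ₀ := fun r hr => er r (by omega) (by omega) (by omega)
      have f1 : Frame σ₀ σ₁ := fun r hr => scanFlag_reg_of_ne σ₀ r (by omega) (by omega)
      have g (r : ℕ) (h10 : r ≠ 10) (h11 : r ≠ 11) : σ₁.reg r = σ₀.reg r :=
        scanFlag_reg_of_ne σ₀ r h10 h11
      have g5 := g 5 (by norm_num) (by norm_num)
      have g7 := g 7 (by norm_num) (by norm_num)
      have g8 := g 8 (by norm_num) (by norm_num)
      have g9 := g 9 (by norm_num) (by norm_num)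
      have e8 := er 8 (by norm_num) (by norm_num) (by norm_num)
      obtain ⟨σ', r, hrun, hr, k9, k5, k4, k6, kf⟩ := ih (σ := σ₁)
        ((hσ.of_frame f0).of_frame f1) (by omega) (by omega)
        (by rw [g7, g8, g5]; exact scanFlag_reg_ten hb hx (hσ.of_frame f0)) (by omega)
      refine ⟨σ', r + 1, ?_, ?_, by omega, by omega, ?_, ?_, (f0.trans f1).trans kf⟩
      · refine (runs_whilenz_pure (σ' := σ₁) h ?_ hrun).mono (T := 18 + (20 * r + 1) + 1) (by omega)
        have := runs_block (b := b) (x := x)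
          ([.op .add 7 7 2, .op .add 9 9 2, .op .sub 5 5 2] ++ scanFlag) (by simp)
          (by simp [scanFlag, Instr.IsDet]) σ
        rw [List.foldl_append] at this
        exact this
      · rw [hr, scanLen_of_eq x hp hxp, g7, g8, e7, e8]
        omega
      · rw [k4, g 4 (by norm_num) (by norm_num), er 4 (by norm_num) (by norm_num) (by norm_num)]
      · rw [k6, g 6 (by norm_num) (by norm_num), er 6 (by norm_num) (by norm_num) (by norm_num)]

theorem clog_two_succ {r : ℕ} (hr : r ≠ 0) :
    Nat.clog 2 (r + 1) = Nat.clog 2 (r / 2 + 1) + 1 := by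
  rw [Nat.clog_of_two_le (by norm_num) (by omega), show (r + 1 + 2 - 1) / 2 = r / 2 + 1 by omega]

/-- `⌈log₂ (r + 1)⌉` is the number of halvings that take `r` to `0`. The time bound is
unconditional, whereas the value of register `6` is claimed only when the sum fits into a word. -/
theorem sizeLoop_spec (hb : 2 < 2 ^ b) {σ : Store} (h2 : σ.reg 2 = 1) (h9 : σ.reg 9 < 2 ^ b) :
    ∃ σ', Runs b x sizeLoop σ (8 * Nat.clog 2 (σ.reg 9 + 1) + 1) (PMF.pure σ') ∧
      (σ.reg 6 + Nat.clog 2 (σ.reg 9 + 1) < 2 ^ b →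
        σ'.reg 6 = σ.reg 6 + Nat.clog 2 (σ.reg 9 + 1)) ∧
      σ'.reg 4 = σ.reg 4 ∧ σ'.reg 5 = σ.reg 5 ∧ Frame σ σ' := by
  induction hr : σ.reg 9 using Nat.strong_induction_on generalizing σ with
  | _ r ih =>
  by_cases h0 : r = 0
  · subst h0
    refine ⟨σ, runs_whilenz_zero hr, by simp, rfl, rfl, .refl σ⟩
  · set σ₁ := [Instr.op .add 6 6 2, .op .add 11 2 2, .op .div 9 9 11].foldl (Instr.eff b x) σ
      with hσ₁
    have e9 : σ₁.reg 9 = r / 2 := by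
      simp [hσ₁, Instr.eff, set_reg, BinOp.eval, h2, Nat.mod_eq_of_lt hb, hr]
      exact Nat.mod_eq_of_lt (by omega)
    have e6 : σ₁.reg 6 = (σ.reg 6 + 1) % 2 ^ b := by
      simp [hσ₁, Instr.eff, set_reg, BinOp.eval, h2]
    have er (r : ℕ) (h6 : r ≠ 6) (h9 : r ≠ 9) (h11 : r ≠ 11) : σ₁.reg r = σ.reg r := by
      simp [hσ₁, Instr.eff, set_reg, h6, h9, h11]
    obtain ⟨σ', hrun, k6, k4, k5, kf⟩ := ih (r / 2) (by omega) (σ := σ₁)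
      ((er 2 (by norm_num) (by norm_num) (by norm_num)).trans h2) (by omega) e9
    rw [clog_two_succ h0]
    refine ⟨σ', ?_, fun h => ?_, ?_, ?_,
      Frame.trans (fun r hr => er r (by omega) (by omega) (by omega)) kf⟩
    · exact (runs_whilenz_pure (σ' := σ₁) (by rw [hr]; exact h0)
        (runs_block _ (by simp) (by simp [Instr.IsDet]) σ) hrun).mono (by simp; omega)
    · rw [e6, Nat.mod_eq_of_lt (by omega)] at k6
      rw [k6 (by omega)]
      omega
    · rw [k4, er 4 (by norm_num) (by norm_num) (by norm_num)]
    · rw [k5, er 5 (by norm_num) (by norm_num) (by norm_num)]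

end

section

variable {b n s : ℕ} {x : Fin n → ℕ}

theorem measure_spec (hb : 2 < 2 ^ b) (hn : n < 2 ^ b) (hx : ∀ i, x i < 2 ^ b) {σ : Store}
    (hσ : Ready n s σ) (h5 : σ.reg 5 < 2 ^ b) (h7 : σ.reg 7 < n) :
    ∃ σ' r, Runs b x measure σ (28 * r + 24) (PMF.pure σ') ∧
      r = min (scanLen (List.ofFn x) (σ.reg 8) (σ.reg 7)) (σ.reg 5) ∧
      σ'.reg 5 = σ.reg 5 - r ∧ σ'.reg 4 = σ.reg 4 ∧
      (σ.reg 6 + (Nat.clog 2 (r + 1) + s) < 2 ^ b →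
        σ'.reg 6 = σ.reg 6 + (Nat.clog 2 (r + 1) + s)) ∧ Frame σ σ' := by
  set σ₀ := [Instr.op .add 9 17 17].foldl (Instr.eff b x) σ with hσ₀
  set σ₁ := scanFlag.foldl (Instr.eff b x) σ₀ with hσ₁
  have e9 : σ₀.reg 9 = 0 := by
    simp [hσ₀, Instr.eff, set_reg, BinOp.eval, hσ.seventeen]
  have er (r : ℕ) (h9 : r ≠ 9) : σ₀.reg r = σ.reg r := by
    simp [hσ₀, Instr.eff, set_reg, h9]
  have f0 : Frame σ σ₀ := fun r hr => er r (by omega)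
  have f1 : Frame σ₀ σ₁ := fun r hr => scanFlag_reg_of_ne σ₀ r (by omega) (by omega)
  have g (r : ℕ) (h10 : r ≠ 10) (h11 : r ≠ 11) : σ₁.reg r = σ₀.reg r :=
    scanFlag_reg_of_ne σ₀ r h10 h11
  have hσ1 := (hσ.of_frame f0).of_frame f1
  have g5 := (g 5 (by norm_num) (by norm_num)).trans (er 5 (by norm_num))
  have g4 := (g 4 (by norm_num) (by norm_num)).trans (er 4 (by norm_num))
  have g6 := (g 6 (by norm_num) (by norm_num)).trans (er 6 (by norm_num))
  have g7 := (g 7 (by norm_num) (by norm_num)).trans (er 7 (by norm_num))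
  have g8 := (g 8 (by norm_num) (by norm_num)).trans (er 8 (by norm_num))
  have g9 := (g 9 (by norm_num) (by norm_num)).trans e9
  obtain ⟨σ₂, r, run2, hr, k9, k5, k4, k6, kf⟩ := scanLoop_spec (σ := σ₁) (by omega) hn hx
    hσ1 (by omega) (by omega) (by
      have := scanFlag_reg_ten (by omega) hx (hσ.of_frame f0)
      rwa [er 7 (by norm_num), er 8 (by norm_num), er 5 (by norm_num), ← hσ₁, ← g7, ← g8, ← g5]
        at this)
  rw [g7, g8, g5] at hr
  have hrn : r ≤ n := by
    have := scanLen_le x (σ.reg 8) (σ.reg 7)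
    omega
  have hσ2 := hσ1.of_frame kf
  obtain ⟨σ₃, run3, l6, l4, l5, lf⟩ := sizeLoop_spec (x := x) (σ := σ₂) hb hσ2.two (by omega)
  rw [show σ₂.reg 9 = r by omega] at run3 l6
  have hσ3 := hσ2.of_frame lf
  refine ⟨(Instr.op .add 6 6 3).eff b x σ₃, r, ?_, hr, ?_, ?_, fun h => ?_, ?_⟩
  · have run1 := runs_block (b := b) (x := x) (.op .add 9 17 17 :: scanFlag) (by simp)
      (by simp [scanFlag, Instr.IsDet]) σ
    have run4 := runs_block (b := b) (x := x) [.op .add 6 6 3] (by simp) (by simp [Instr.IsDet]) σ₃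
    -- The digit count takes at most `8` steps per unit of `r`, which are added to the `20` per
    -- scanned position.
    have hclog : Nat.clog 2 (r + 1) ≤ r := Nat.clog_le_of_le_pow Nat.lt_two_pow_self
    exact (Runs.seq_pure (σ' := σ₁) run1 (run2.seq_pure (run3.seq_pure run4))).mono
      (by simp [scanFlag]; omega)
  · simp [Instr.eff, set_reg]
    omega
  · simp [Instr.eff, set_reg]
    omega
  · simp [Instr.eff, set_reg, BinOp.eval, hσ3.three]
    rw [k6, g6] at l6
    rw [l6 (by omega), Nat.mod_eq_of_lt (by omega), add_assoc]
  · refine ((f0.trans f1).trans kf).trans (lf.trans fun r hr => ?_)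
    simp [Instr.eff, set_reg, show r ≠ 6 by omega]

/-- What remains to be done once position `i` has been drawn. -/
theorem process_spec (hb : 2 < 2 ^ b) (hn : n < 2 ^ b) (hx : ∀ i, x i < 2 ^ b) {σ : Store}
    (hσ : Ready n s σ) (h5 : σ.reg 5 < 2 ^ b) (h4 : σ.reg 4 < 2 ^ b) (i : Fin n)
    (h7 : σ.reg 7 = i) :
    ∃ σ' r, Runs b x (.seq (block inspect) (.ifnz 10 (.instr (.const 9 0)) measure)) σ
        (28 * r + 40) (PMF.pure σ') ∧
      r = min (startLen none (List.ofFn x) i) (σ.reg 5) ∧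
      σ'.reg 5 = σ.reg 5 - r ∧ σ'.reg 4 = σ.reg 4 - 1 ∧
      (startLen none (List.ofFn x) i ≤ σ.reg 5 →
        σ.reg 6 + runCost s (startLen none (List.ofFn x) i) < 2 ^ b →
        σ'.reg 6 = σ.reg 6 + runCost s (startLen none (List.ofFn x) i)) ∧ Frame σ σ' := by
  set σ₀ := inspect.foldl (Instr.eff b x) σ with hσ₀
  have hi := i.isLt
  have h1 : 1 % 2 ^ b = 1 := Nat.mod_eq_of_lt (by omega)
  have er (r : ℕ) (h4 : r ≠ 4) (h8 : r ≠ 8) (h10 : r ≠ 10) (h11 : r ≠ 11) :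
      σ₀.reg r = σ.reg r := by
    simp [hσ₀, inspect, Instr.eff, set_reg, h4, h8, h10, h11]
  have f0 : Frame σ σ₀ := fun r hr => er r (by omega) (by omega) (by omega) (by omega)
  have e5 := er 5 (by norm_num) (by norm_num) (by norm_num) (by norm_num)
  have e6 := er 6 (by norm_num) (by norm_num) (by norm_num) (by norm_num)
  have e7 := er 7 (by norm_num) (by norm_num) (by norm_num) (by norm_num)
  have e4 : σ₀.reg 4 = σ.reg 4 - 1 := by
    simp [hσ₀, inspect, Instr.eff, set_reg, BinOp.eval, hσ.two]
    exact Nat.mod_eq_of_lt (by omega)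
  have e8 : σ₀.reg 8 = x i := by
    simp [hσ₀, inspect, Instr.eff, set_reg, h7, Nat.mod_eq_of_lt (hx i)]
  have e10 : σ₀.reg 10 = 0 ↔ ¬(0 < (i : ℕ) ∧ x ⟨i - 1, by omega⟩ = x i) := by
    have h2 : ((i : ℕ) - 1) % 2 ^ b = i - 1 := Nat.mod_eq_of_lt (by omega)
    have h3 : (i : ℕ) - 1 < n := by omega
    simp only [hσ₀, inspect, List.foldl_cons, List.foldl_nil, Instr.eff, set_reg, BinOp.eval]
    simp only [hσ.two, hσ.seventeen, h7]
    by_cases hpos : 0 < (i : ℕ) <;> by_cases heq : x ⟨i - 1, h3⟩ = x i <;>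
      simp [h2, h3, hpos, heq, h1, Nat.mod_eq_of_lt (hx _), hi]
  have run0 := runs_block (b := b) (x := x) inspect (by simp [inspect])
    (by simp [inspect, Instr.IsDet]) σ
  rw [← hσ₀] at run0
  rw [startLen_ofFn]
  by_cases h : σ₀.reg 10 = 0
  · rw [if_neg (e10.1 h)]
    obtain ⟨σ', r, run1, hr, k5, k4, k6, kf⟩ := measure_spec hb hn hx (hσ.of_frame f0) (by omega)
      (by omega)
    rw [e8, e7, h7, e5] at hr
    refine ⟨σ', r, (run0.seq_pure (runs_ifnz_zero h run1)).mono (by simp [inspect]; omega), hr,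
      by omega, by omega, fun h5 h6 => ?_, f0.trans kf⟩
    -- The budget covers the whole run, so the minimum is the true length.
    have hr' : r = scanLen (List.ofFn x) (x i) i := by omega
    have hpos : r ≠ 0 := by rw [hr', scanLen_of_eq x hi rfl]; omega
    rw [← hr', runCost, if_neg hpos] at h6 ⊢
    rw [k6 (by omega), e6]
  · rw [if_pos (by_contra fun h' => h (e10.2 h'))]
    refine ⟨(Instr.const 9 0).eff b x σ₀, 0, ?_, by simp, ?_, ?_, fun _ _ => ?_, ?_⟩
    · have run1 := runs_block (b := b) (x := x) [.const 9 0] (by simp) (by simp [Instr.IsDet]) σ₀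
      exact (run0.seq_pure (runs_ifnz_ne h run1)).mono (by simp [inspect])
    · simp [Instr.eff, set_reg, e5]
    · simp [Instr.eff, set_reg, e4]
    · simp [Instr.eff, set_reg, e6, runCost]
    · exact f0.trans fun r hr => by simp [Instr.eff, set_reg, show r ≠ 9 by omega]

theorem runs_rand [Nonempty (Fin n)] {σ : Store} {d a : ℕ} (ha : σ.reg a = n) :
    Runs b x (.instr (.rand d a)) σ 1
      ((PMF.uniformOfFintype (Fin n)).map fun i : Fin n => σ.set b d i) := by
  have := runs_instr (b := b) (x := x) (.rand d a) σ
  cases n with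
  | zero => exact absurd (Fin.pos_iff_nonempty.2 ‹_›) (by simp)
  | succ n =>
    simp only [Instr.exec, ha] at this
    have hmap := PMF.map_comp (p := PMF.uniformOfFintype (Fin (n + 1)))
      (fun i : Fin (n + 1) => (i : ℕ)) (fun i => σ.set b d i)
    rw [Function.comp_def] at hmap
    rw [← hmap]
    exact this

/-- An injective `φ` lets the outcome `i` be recovered from the configuration, so the continuation
may depend on `i` itself. -/
theorem Exec.bind_map {ι : Type*} [Nonempty ι] {c : Config} {T T' : ℕ} {p : PMF ι}
    {φ : ι → Config} {ν : ι → PMF Config} (h : Exec b x c T (p.map φ))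
    (hφ : Function.Injective φ) (h' : ∀ i, Exec b x (φ i) T' (ν i)) :
    Exec b x c (T + T') (p.bind ν) := by
  have := h.bind (T' := T') (ν := fun c => ν (Function.invFun φ c)) fun c hc => by
    obtain ⟨i, -, rfl⟩ := (PMF.mem_support_map_iff _ _ _).1 hc
    rw [Function.leftInverse_invFun hφ]
    exact h' i
  rw [PMF.bind_map] at this
  have hcomp : (fun c => ν (Function.invFun φ c)) ∘ φ = ν :=
    funext fun i => congrArg ν (Function.leftInverse_invFun hφ i)
  rwa [hcomp] at this

/-- Scanning is paid for from register `5`, which makes the time bound hold on every path. The sum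
is claimed to be exact only if the sampled runs together fit the budget and the result fits into a
word. -/
theorem sampleLoop_spec [Nonempty (Fin n)] (hb : 2 < 2 ^ b) (hn : n < 2 ^ b)
    (hx : ∀ i, x i < 2 ^ b) (k : ℕ) {σ : Store} (hσ : Ready n s σ) (h5 : σ.reg 5 < 2 ^ b)
    (hk : k < 2 ^ b) (h4 : σ.reg 4 = k) :
    ∃ F : List (Fin n) → Store,
      Runs b x sampleLoop σ (44 * k + 28 * σ.reg 5 + 1) ((samples n k).map F) ∧
      ∀ l ∈ (samples n k).support, Frame σ (F l) ∧
        ((l.map fun i : Fin n => startLen none (List.ofFn x) i).sum ≤ σ.reg 5 →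
          σ.reg 6 + (l.map fun i : Fin n => runCost s (startLen none (List.ofFn x) i)).sum < 2 ^ b →
          (F l).reg 6 =
            σ.reg 6 + (l.map fun i : Fin n => runCost s (startLen none (List.ofFn x) i)).sum) := by
  induction k generalizing σ with
  | zero =>
    refine ⟨fun _ => σ, ?_, fun l hl => ⟨.refl σ, ?_⟩⟩
    · rw [samples, PMF.pure_map]
      exact (runs_whilenz_zero h4).mono (by omega)
    · rw [samples, PMF.mem_support_pure_iff] at hl
      subst hl
      simp
  | succ k ih =>
    have step (i : Fin n) := process_spec (σ := σ.set b 7 i) hb hn hx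
      (hσ.of_frame fun r hr => by rw [set_reg, if_neg (by omega)]) (by simpa [set_reg] using h5)
      (by simpa [set_reg] using by omega) i
      (by rw [set_reg, if_pos rfl, Nat.mod_eq_of_lt (i.isLt.trans hn)])
    simp only [set_reg, Nat.reduceEqDiff, if_false] at step
    choose τ r hrun hr k5 k4 k6 kf using step
    have hf (i : Fin n) : Frame σ (τ i) :=
      Frame.trans (fun r hr => by rw [set_reg, if_neg (by omega)]) (kf i)
    have next (i : Fin n) := ih (σ := τ i) (hσ.of_frame (hf i)) (by rw [k5]; omega) (by omega)
      (by rw [k4]; omega)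
    choose G hG hG' using next
    refine ⟨fun l => match l with | [] => σ | i :: l => G i l, ?_, ?_⟩
    · intro K
      -- The drawn position can be read off register `7`, because it is below `n < 2 ^ b`.
      have inj : Function.Injective fun i : Fin n =>
          ((.seq (block inspect) (.ifnz 10 (.instr (.const 9 0)) measure) :: sampleLoop :: K,
            σ.set b 7 i) : Config) := fun i j hij => by
        have := congrArg (fun c : Config => c.2.reg 7) hij
        simp only [set_reg, if_true, Nat.mod_eq_of_lt (i.isLt.trans hn),
          Nat.mod_eq_of_lt (j.isLt.trans hn)] at this
        exact Fin.ext this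
      have draw := runs_rand (b := b) (x := x) (d := 7) hσ.zero
        (.seq (block inspect) (.ifnz 10 (.instr (.const 9 0)) measure) :: sampleLoop :: K)
      rw [PMF.map_comp] at draw
      have rest := draw.bind_map inj (T' := 44 * k + 28 * σ.reg 5 + 41) fun i => by
        -- Amortization: the `28 r` steps for this sample are offset by the `r` units removed from
        -- the budget.
        have h1 := ((hrun i).then (sampleLoop :: K) K (ν := fun _ => (samples n k).map (G i))
          fun σ' hσ' => by
            rw [PMF.mem_support_pure_iff] at hσ'
            subst hσ'
            exact hG i K).mono (T' := 44 * k + 28 * σ.reg 5 + 41) (by rw [k5, hr]; omega)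
        rw [PMF.pure_bind] at h1
        exact h1
      have all := Exec.of_step (c := (sampleLoop :: K, σ)) (b := b) (x := x)
        (c' := (sampleBody :: sampleLoop :: K, σ)) (by rw [sampleLoop, step, if_neg (by omega)])
        (Exec.of_step rfl rest)
      refine (Exec.mono ?_ (T := 1 + (44 * k + 28 * σ.reg 5 + 41) + 1 + 1) (by omega))
      convert all using 1
      rw [samples, PMF.map_bind, PMF.map_bind]
      simp only [PMF.map_comp]
      rfl
    · intro l hl
      rw [samples, PMF.mem_support_bind_iff] at hl
      obtain ⟨i, -, hl⟩ := hl
      obtain ⟨l, hl', rfl⟩ := (PMF.mem_support_map_iff _ _ _).1 hl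
      refine ⟨(hf i).trans (hG' i l hl').1, fun h1 h2 => ?_⟩
      simp only [List.map_cons, List.sum_cons] at h1 h2 ⊢
      have h3 := k6 i (by omega) (by omega)
      rw [(hG' i l hl').2 (by rw [k5, hr]; omega) (by rw [h3]; omega), h3]
      omega

end

/-! ### From sampled costs to an estimate of the total cost -/

section

variable {b n s : ℕ} {x : Fin n → ℕ}

theorem samples_length [Nonempty (Fin n)] {k : ℕ} {l : List (Fin n)}
    (hl : l ∈ (samples n k).support) : l.length = k := by
  induction k generalizing l with
  | zero =>
    rw [samples, PMF.mem_support_pure_iff] at hl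
    simp [hl]
  | succ k ih =>
    rw [samples, PMF.mem_support_bind_iff] at hl
    obtain ⟨i, -, hl⟩ := hl
    obtain ⟨l, hl', rfl⟩ := (PMF.mem_support_map_iff _ _ _).1 hl
    simp [ih hl']

/-- The cost of the run-length encoding if `s` bits are spent on a symbol. -/
def totalCost (s : ℕ) (x : Fin n → ℕ) : ℕ :=
  ∑ t : Fin n, runCost s (startLen none (List.ofFn x) t)

theorem startLen_le (x : Fin n → ℕ) (i : Fin n) : startLen none (List.ofFn x) i ≤ n :=
  (Finset.single_le_sum (f := fun t : Fin n => startLen none (List.ofFn x) t)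
    (fun _ _ => Nat.zero_le _) (Finset.mem_univ i)).trans (sum_startLen_ofFn x).le

theorem totalCost_le (s : ℕ) (x : Fin n → ℕ) : totalCost s x ≤ (1 + s) * n := by
  calc totalCost s x ≤ ∑ t : Fin n, (1 + s) * startLen none (List.ofFn x) t :=
        Finset.sum_le_sum fun t _ => runCost_le _ _
    _ = (1 + s) * n := by rw [← Finset.mul_sum, sum_startLen_ofFn]

theorem totalCost_pos (hn : 0 < n) (s : ℕ) (x : Fin n → ℕ) : 1 ≤ totalCost s x := by
  have h : (0 : ℕ) < ∑ t : Fin n, startLen none (List.ofFn x) t := by rwa [sum_startLen_ofFn]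
  obtain ⟨t, -, ht⟩ := Finset.exists_ne_zero_of_sum_ne_zero h.ne'
  exact (runCost_pos s ht).trans (Finset.single_le_sum
    (f := fun t : Fin n => runCost s (startLen none (List.ofFn x) t))
    (fun _ _ => Nat.zero_le _) (Finset.mem_univ t))

/-- The sum `S` of `k` samples is close to its mean: relative to the larger of the mean
and a threshold `θ`. -/
def IsAccurate (s : ℕ) (x : Fin n → ℕ) (k : ℕ) (δ θ : ℝ) (S : ℕ) : Prop :=
  |(S : ℝ) - k * (totalCost s x / n)| ≤ k * (δ * max (totalCost s x / n : ℝ) θ) ∧ S ≤ k * (n + s)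

/-- The first summand is Chebyshev's bound with `L = 2 s + 2 j + 18` and `θ = 1 / 2 ^ j`; the second
is Markov's bound for running out of budget. The bound `k (n + s)` on the sum excludes overflow. -/
theorem sampleLoop_accurate (hn0 : 0 < n) (hb : 2 < 2 ^ b) (hn : n < 2 ^ b)
    (hx : ∀ i, x i < 2 ^ b) {k B j : ℕ} {δ : ℝ} {σ : Store} (hσ : Ready n s σ)
    (h4 : σ.reg 4 = k) (h5 : σ.reg 5 = B) (h6 : σ.reg 6 = 0) (hk : 0 < k) (hB : 0 < B)
    (hδ : 0 < δ) (hB' : B < 2 ^ b) (hk' : k * (n + s) < 2 ^ b) :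
    ∃ μ, Runs b x sampleLoop σ (44 * k + 28 * B + 1) μ ∧ (∀ σ' ∈ μ.support, Frame σ σ') ∧
      μ.toOuterMeasure {σ' | ¬IsAccurate s x k δ (1 / 2 ^ j) (σ'.reg 6)} ≤
        ENNReal.ofReal ((2 * s + 2 * j + 19) * 2 ^ j / (k * δ ^ 2) + k / B) := by
  have : Nonempty (Fin n) := ⟨⟨0, hn0⟩⟩
  have : NeZero n := ⟨hn0.ne'⟩
  have hk2 : k < 2 ^ b := lt_of_le_of_lt (Nat.le_mul_of_pos_right _ (by omega)) hk'
  obtain ⟨F, hrun, hF⟩ := sampleLoop_spec hb hn hx k hσ (by omega) hk2 h4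
  rw [h5] at hrun
  refine ⟨_, hrun, fun σ' hσ' => ?_, ?_⟩
  · obtain ⟨l, hl, rfl⟩ := (PMF.mem_support_map_iff _ _ _).1 hσ'
    exact (hF l hl).1
  · rw [PMF.toOuterMeasure_map_apply]
    have hn' : (0 : ℝ) < n := Nat.cast_pos.2 hn0
    have key := samples_bad_le (n := n) (X := fun i => runCost s (startLen none (List.ofFn x) i))
      (Y := fun i => startLen none (List.ofFn x) i) (c := totalCost s x / n)
      (L := 2 * s + 2 * j + 18) (θ := 1 / 2 ^ j) (δ := δ) (k := k) (B := B)
      (by rw [totalCost, div_mul_cancel₀ _ hn'.ne']; push_cast; rfl)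
      (by
        rw [add_mul, mul_assoc, div_mul_cancel₀ _ hn'.ne']
        have h1 (t : Fin n) : (runCost s (startLen none (List.ofFn x) t) : ℝ) ^ 2 ≤
            (2 * s + 2 * j + 18) * runCost s (startLen none (List.ofFn x) t) +
              1 / 2 ^ j * startLen none (List.ofFn x) t := by
          have := runCost_sq_le s j (startLen none (List.ofFn x) t)
          have h2 : ((runCost s (startLen none (List.ofFn x) t) : ℝ) ^ 2 * 2 ^ j ≤
            (2 * s + 2 * j + 18) * runCost s (startLen none (List.ofFn x) t) * 2 ^ j +
              startLen none (List.ofFn x) t) := by exact_mod_cast this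
          rw [← le_div_iff₀ (by positivity)] at h2
          refine h2.trans (le_of_eq ?_)
          field_simp
        refine (Finset.sum_le_sum fun t _ => h1 t).trans (le_of_eq ?_)
        rw [Finset.sum_add_distrib, ← Finset.mul_sum, ← Finset.mul_sum, totalCost]
        have h3 : (∑ t : Fin n, (startLen none (List.ofFn x) t : ℝ)) = n := by
          exact_mod_cast sum_startLen_ofFn x
        rw [h3]
        push_cast
        rfl)
      (sum_startLen_ofFn x).le (by positivity) (by positivity) hδ hk hB
    have hcalc : ((2 * s + 2 * j + 18 : ℝ) + 1) / (k * δ ^ 2 * (1 / 2 ^ j)) =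
        (2 * s + 2 * j + 19) * 2 ^ j / (k * δ ^ 2) := by
      field_simp
      ring
    rw [hcalc] at key
    refine le_trans (PMF.toOuterMeasure_mono _ ?_) key
    -- If the sampled runs fit the budget, the register holds the exact sum of their costs, so the
    -- program fails only where the sampling does.
    rintro l ⟨hl1, hl2⟩ ⟨hl3, hl4⟩
    refine hl1 ?_
    have hlen := samples_length hl2
    have hle : (l.map fun i : Fin n => runCost s (startLen none (List.ofFn x) i)).sum ≤
        k * (n + s) := by
      have := List.sum_le_card_nsmul
        (l.map fun i : Fin n => runCost s (startLen none (List.ofFn x) i)) (n + s) (by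
          intro y hy
          obtain ⟨i, -, rfl⟩ := List.mem_map.1 hy
          have := runCost_le_add s (startLen none (List.ofFn x) i)
          have := startLen_le x i
          omega)
      rwa [List.length_map, hlen, smul_eq_mul] at this
    have h7 := (hF l hl2).2 (by rw [h5]; exact hl3) (by omega)
    rw [h6, zero_add] at h7
    change IsAccurate s x k δ (1 / 2 ^ j) ((F l).reg 6)
    rw [h7]
    exact ⟨hl4, hle⟩

/-- Turn the sum in register `6` of the samples counted in register `13` into the output. -/
def finish : Prog :=
  block [.op .mul 0 6 0, .op .add 1 13 17]

theorem finish_spec {σ : Store} (hσ : Ready n s σ) :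
    ∃ σ', Runs b x finish σ 4 (PMF.pure σ') ∧
      ∀ k : ℕ, σ.reg 13 = k → σ.reg 6 * n < 2 ^ b → k < 2 ^ b →
        σ'.output = σ.reg 6 * n / k := by
  refine ⟨_, runs_block [.op .mul 0 6 0, .op .add 1 13 17] (by simp) (by simp [Instr.IsDet]) σ,
    fun k h13 h6 hk => ?_⟩
  simp [Instr.eff, set_reg, BinOp.eval, Store.output, hσ.zero, hσ.seventeen, h13,
    Nat.mod_eq_of_lt h6, Nat.mod_eq_of_lt hk]

theorem IsAccurate.abs_sub_le (hn0 : 0 < n) {k S : ℕ} {δ θ : ℝ} (hk : 0 < k)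
    (h : IsAccurate s x k δ θ S) :
    |(S * n / k : ℝ) - totalCost s x| ≤ δ * max (totalCost s x : ℝ) (θ * n) := by
  have hn' : (0 : ℝ) < n := Nat.cast_pos.2 hn0
  have hk' : (0 : ℝ) < k := Nat.cast_pos.2 hk
  have h1 : (S * n / k : ℝ) - totalCost s x = (S - k * (totalCost s x / n)) * (n / k) := by
    field_simp
  rw [h1, abs_mul, abs_of_pos (show (0 : ℝ) < n / k by positivity)]
  refine (mul_le_mul_of_nonneg_right h.1 (by positivity)).trans (le_of_eq ?_)
  have h2 : max (totalCost s x : ℝ) (θ * n) = max (totalCost s x / n : ℝ) θ * n := by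
    rw [max_mul_of_nonneg _ _ hn'.le, div_mul_cancel₀ _ hn'.ne']
  rw [h2]
  field_simp

theorem estimate_spec (hn0 : 0 < n) (hb : 2 < 2 ^ b) (hn : n < 2 ^ b)
    (hx : ∀ i, x i < 2 ^ b) {k B j : ℕ} {δ : ℝ} {σ : Store} (hσ : Ready n s σ)
    (h4 : σ.reg 4 = k) (h5 : σ.reg 5 = B) (h6 : σ.reg 6 = 0) (h13 : σ.reg 13 = k) (hk : 0 < k)
    (hB : 0 < B) (hδ : 0 < δ) (hB' : B < 2 ^ b) (hk' : k * (n + s) * n < 2 ^ b) :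
    ∃ μ, Runs b x (.seq sampleLoop finish) σ (44 * k + 28 * B + 6) μ ∧
      μ.toOuterMeasure {σ' | ¬|σ'.output - totalCost s x| ≤
          δ * max (totalCost s x : ℝ) (1 / 2 ^ j * n)} ≤
        ENNReal.ofReal ((2 * s + 2 * j + 19) * 2 ^ j / (k * δ ^ 2) + k / B) := by
  have hk1 : k * (n + s) < 2 ^ b := lt_of_le_of_lt (Nat.le_mul_of_pos_right _ hn0) hk'
  have hk2 : k < 2 ^ b := lt_of_le_of_lt (Nat.le_mul_of_pos_right _ (by omega)) hk1
  obtain ⟨μ, hrun, hf, hμ⟩ := sampleLoop_accurate (j := j) hn0 hb hn hx hσ h4 h5 h6 hk hB hδ hB' hk1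
  -- Stores outside the support receive an arbitrary value, since only those in the support are
  -- known to hold the constants.
  have fin (σ' : Store) : ∃ τ, σ' ∈ μ.support → Runs b x finish σ' 4 (PMF.pure τ) ∧
      (IsAccurate s x k δ (1 / 2 ^ j) (σ'.reg 6) →
        |τ.output - totalCost s x| ≤ δ * max (totalCost s x : ℝ) (1 / 2 ^ j * n)) := by
    by_cases hσ' : σ' ∈ μ.support
    · obtain ⟨τ, h1, h2⟩ := finish_spec (b := b) (x := x) (hσ.of_frame (hf σ' hσ'))
      refine ⟨τ, fun _ => ⟨h1, fun hacc => ?_⟩⟩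
      rw [h2 k (by rw [hf σ' hσ' 13 (by norm_num), h13])
        (lt_of_le_of_lt (Nat.mul_le_mul_right _ hacc.2) hk') hk2]
      exact hacc.abs_sub_le hn0 hk
    · exact ⟨σ', fun h => absurd h hσ'⟩
  choose τ hτ using fin
  refine ⟨_, hrun.seq (T' := 4) (ν := fun σ' => PMF.pure (τ σ')) fun σ' hσ' => (hτ σ' hσ').1, ?_⟩
  refine le_trans ?_ hμ
  change (PMF.map τ μ).toOuterMeasure _ ≤ _
  rw [PMF.toOuterMeasure_map_apply]
  refine PMF.toOuterMeasure_mono _ ?_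
  rintro σ' ⟨h1, h2⟩ h3
  exact h1 ((hτ σ' h2).2 h3)

end

/-! ### Word length -/

/-- Words hold numbers up to `V ^ κ`, where `V ≥ 2` is the range of the input. The constant is
absorbed by `K < 2 ^ K ≤ V ^ K`. -/
theorem lt_two_pow_wordLength {κ n m K e a : ℕ} (hn : 1 ≤ n) (hκ : K + e ≤ κ)
    (ha : a ≤ K * (2 ^ (n.size + m.size)) ^ e) : a < 2 ^ wordLength κ n m := by
  have hsize : 1 ≤ n.size := Nat.size_pos.2 hn
  have hV : 2 ≤ 2 ^ (n.size + m.size) :=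
    (Nat.pow_le_pow_right (by norm_num) (show 1 ≤ n.size + m.size by omega)).trans' (by norm_num)
  generalize hVdef : 2 ^ (n.size + m.size) = V at *
  have h1 : V ^ κ = 2 ^ wordLength κ n m := by
    rw [← hVdef, ← pow_mul, wordLength, mul_comm]
  rw [← h1]
  calc a ≤ K * V ^ e := ha
    _ < 2 ^ K * V ^ e := Nat.mul_lt_mul_of_pos_right Nat.lt_two_pow_self (by positivity)
    _ ≤ V ^ K * V ^ e := Nat.mul_le_mul_right _ (Nat.pow_le_pow_left hV K)
    _ = V ^ (K + e) := (pow_add V K e).symm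
    _ ≤ V ^ κ := Nat.pow_le_pow_right (by omega) hκ

theorem lt_two_pow_size_add_left (n m : ℕ) : n < 2 ^ (n.size + m.size) :=
  (Nat.lt_size_self n).trans_le (Nat.pow_le_pow_right (by norm_num) (by omega))

theorem lt_two_pow_size_add_right (n m : ℕ) : m < 2 ^ (n.size + m.size) :=
  (Nat.lt_size_self m).trans_le (Nat.pow_le_pow_right (by norm_num) (by omega))

theorem enc_lt {A : Type*} [Fintype A] (enc : A ≃ Fin (Fintype.card A)) (a : A) :
    (enc a : ℕ) < 2 ^ Nat.clog 2 (Fintype.card A) :=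
  (enc a).isLt.trans_le (Nat.le_pow_clog (by norm_num) _)

section Estimates

variable {A : Type*} [Fintype A] [DecidableEq A]

theorem totalCost_enc (enc : A ≃ Fin (Fintype.card A)) {n : ℕ} (w : Fin n → A) :
    totalCost (Nat.clog 2 (Fintype.card A)) (fun i => (enc (w i) : ℕ)) = rleCost w :=
  (rleCost_eq_sum w (e := fun a => (enc a : ℕ))
    (Fin.val_injective.comp enc.injective)).symm

theorem estimates_of_runs {P : Prog} {κ m T n : ℕ} {enc : A ≃ Fin (Fintype.card A)}
    {w : Fin n → A} {lam ε : ℝ} {μ : PMF Store} {S : Set Store} {q : ℝ}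
    (h : Runs (wordLength κ n m) (fun i => (enc (w i) : ℕ)) P (startStore n m) T μ)
    (hμ : μ.toOuterMeasure S ≤ ENNReal.ofReal q) (hq : q ≤ 1 / 3)
    (hS : ∀ σ, σ ∉ S → IsEstimate n lam ε (rleCost w) σ.output) :
    Estimates P κ enc w m lam ε := by
  refine two_thirds_le_outputProb_of_runs h ?_
  refine le_trans (PMF.toOuterMeasure_mono _ ?_) (hμ.trans (ENNReal.ofReal_le_ofReal hq))
  rintro σ ⟨h1, -⟩
  by_contra h2
  exact h1 (hS σ h2)

end Estimates

/-! ### Additive approximation -/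

/-- The number of samples for an additive estimate, divided by the square of the parameter. -/
def additiveFactor (s : ℕ) : ℕ := 6 * (2 * s + 19) * (1 + s) ^ 2

/-- The program for additive estimates. -/
def additive (s : ℕ) : Prog :=
  .seq (block [.const 2 1, .const 3 s, .const 4 (additiveFactor s), .op .mul 4 4 1, .op .mul 4 4 1,
    .const 5 6, .op .mul 5 5 4, .op .add 13 4 17]) (.seq sampleLoop finish)

theorem additive_setup {s b n m k : ℕ} {x : Fin n → ℕ} (hk : k = additiveFactor s * m * m)
    (hm : 1 ≤ m) (fs : s < 2 ^ b) (fB : 6 * k < 2 ^ b) :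
    ∃ σ₁, Runs b x (block [.const 2 1, .const 3 s, .const 4 (additiveFactor s), .op .mul 4 4 1,
        .op .mul 4 4 1, .const 5 6, .op .mul 5 5 4, .op .add 13 4 17]) (startStore n m) 16
        (PMF.pure σ₁) ∧
      Ready n s σ₁ ∧ σ₁.reg 4 = k ∧ σ₁.reg 5 = 6 * k ∧ σ₁.reg 6 = 0 ∧ σ₁.reg 13 = k := by
  have hF0 : 0 < additiveFactor s := by unfold additiveFactor; positivity
  subst hk
  generalize additiveFactor s = F at *
  have hk : F ≤ F * m := Nat.le_mul_of_pos_right _ hm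
  have hk' : F * m ≤ F * m * m := Nat.le_mul_of_pos_right _ hm
  have e1 : 1 % 2 ^ b = 1 := Nat.mod_eq_of_lt (by omega)
  have e6 : 6 % 2 ^ b = 6 := Nat.mod_eq_of_lt (by omega)
  have eF : F % 2 ^ b = F := Nat.mod_eq_of_lt (by omega)
  have eFm : F * m % 2 ^ b = F * m := Nat.mod_eq_of_lt (by omega)
  have ek : F * m * m % 2 ^ b = F * m * m := Nat.mod_eq_of_lt (by omega)
  have eB : 6 * (F * m * m) % 2 ^ b = 6 * (F * m * m) := Nat.mod_eq_of_lt (by omega)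
  have es : s % 2 ^ b = s := Nat.mod_eq_of_lt fs
  refine ⟨_, runs_block _ (by simp) (by simp [Instr.IsDet]) _, ⟨?_, ?_, ?_, ?_⟩, ?_, ?_, ?_, ?_⟩ <;>
    simp [Instr.eff, set_reg, BinOp.eval, startStore, e1, es, eF, eFm, ek, e6, eB]

theorem additive_spec {s κ n m : ℕ} {x : Fin n → ℕ} (hn : 1 ≤ n) (hm : 1 ≤ m)
    (hx : ∀ i, x i < 2 ^ s) (hκ : 6 * additiveFactor s * (1 + s) + 2 ^ s + 4 ≤ κ) :
    ∃ μ, Runs (wordLength κ n m) x (additive s) (startStore n m)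
        (212 * (additiveFactor s * m * m) + 23) μ ∧
      μ.toOuterMeasure {σ' | ¬|σ'.output - totalCost s x| ≤ (1 / m : ℝ) * n} ≤
        ENNReal.ofReal (1 / 3) := by
  have hV1 := lt_two_pow_size_add_left n m
  have hV2 := lt_two_pow_size_add_right n m
  have fit (a : ℕ) (ha : a ≤ (6 * additiveFactor s * (1 + s) + 2 ^ s) *
      (2 ^ (n.size + m.size)) ^ 4) : a < 2 ^ wordLength κ n m := lt_two_pow_wordLength hn hκ ha
  clear hκ
  generalize 2 ^ (n.size + m.size) = V at *
  generalize wordLength κ n m = b at *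
  have hF0 : 0 < additiveFactor s := by unfold additiveFactor; positivity
  have hV4 : 0 < V ^ 4 := Nat.pow_pos (by omega)
  have hVV : V ≤ V ^ 4 := Nat.le_self_pow (by norm_num) _
  have hs : s < 2 ^ s := Nat.lt_two_pow_self
  have fit1 (a : ℕ) (ha : a ≤ 2 ^ s) : a < 2 ^ b := fit a
    (ha.trans ((Nat.le_add_left _ _).trans (Nat.le_mul_of_pos_right _ hV4)))
  have fit2 (a : ℕ) (ha : a ≤ 6 * additiveFactor s * (1 + s) * V ^ 4) : a < 2 ^ b := fit a
    (ha.trans (Nat.mul_le_mul_right _ (Nat.le_add_right _ _)))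
  have hmn : m ^ 2 * n ^ 2 ≤ V ^ 4 := by
    rw [show V ^ 4 = V ^ 2 * V ^ 2 by ring]
    gcongr
  have fn : n < 2 ^ b := fit2 n (by
    refine (hV1.le.trans hVV).trans (Nat.le_mul_of_pos_left _ (by positivity)))
  have hkV : additiveFactor s * m * m * (n + s) * n ≤ additiveFactor s * (1 + s) * V ^ 4 := by
    have h1 : n + s ≤ (1 + s) * n := by nlinarith
    calc additiveFactor s * m * m * (n + s) * n
        ≤ additiveFactor s * m * m * ((1 + s) * n) * n := by gcongr
      _ = additiveFactor s * (1 + s) * (m ^ 2 * n ^ 2) := by ring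
      _ ≤ _ := by gcongr
  have hk0 : 0 < additiveFactor s * m * m := by positivity
  have hδ : (additiveFactor s : ℝ) = 6 * (2 * s + 19) * (1 + s) ^ 2 := by
    simp [additiveFactor]
  obtain ⟨k, hk⟩ : ∃ k, k = additiveFactor s * m * m := ⟨_, rfl⟩
  rw [← hk] at hkV hk0 ⊢
  have fS : 6 * (k * (n + s) * n) < 2 ^ b := fit2 _ (by
    rw [mul_assoc 6, mul_assoc 6]
    exact Nat.mul_le_mul_left _ hkV)
  have hkS : k ≤ k * (n + s) * n := by
    rw [mul_assoc]
    exact Nat.le_mul_of_pos_right _ (by positivity)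
  obtain ⟨σ₁, run0, hready, h4, h5, h6, h13⟩ := additive_setup (b := b) (n := n) (x := x) hk hm
    (fit1 s hs.le) (by omega)
  -- With `j = 0` the error is at most `δ max(C, n) ≤ δ (1 + s) n`, so this `δ` makes it `n / m`.
  obtain ⟨μ, hrun, hμ⟩ := estimate_spec (b := b) (x := x) (j := 0) (δ := 1 / (m * (1 + s))) hn
    (by omega) fn (fun i => fit1 _ (hx i).le) hready h4 h5 h6 h13 hk0 (by omega) (by positivity)
    (by omega) (by omega)
  refine ⟨μ, (run0.seq_pure hrun).mono (by omega), ?_⟩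
  refine le_trans (PMF.toOuterMeasure_mono _ ?_) (hμ.trans (ENNReal.ofReal_le_ofReal ?_))
  · rintro σ ⟨h1, -⟩ h2
    refine h1 (h2.trans ?_)
    have h3 : (totalCost s x : ℝ) ≤ (1 + s) * n := by exact_mod_cast totalCost_le s x
    have h4 : max (totalCost s x : ℝ) (1 / 2 ^ 0 * n) ≤ (1 + s) * n := by
      refine max_le h3 ?_
      have : (0 : ℝ) ≤ s * n := by positivity
      linarith
    refine (mul_le_mul_of_nonneg_left h4 (by positivity)).trans (le_of_eq ?_)
    field_simp
  -- The sampling error and the exhausted budget each contribute `1 / 6`.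
  · have hm' : (0 : ℝ) < m := Nat.cast_pos.2 hm
    have hk' : (0 : ℝ) < k := Nat.cast_pos.2 hk0
    have h5 : (k : ℝ) / ((6 * k : ℕ) : ℝ) = 1 / 6 := by
      push_cast
      field_simp
    have h6 : ((2 * s + 2 * (0 : ℕ) + 19 : ℝ) * 2 ^ 0 / (k * (1 / (m * (1 + s))) ^ 2)) = 1 / 6 := by
      rw [hk]
      push_cast
      rw [hδ]
      have : (0 : ℝ) < 2 * s + 19 := by positivity
      field_simp
      ring
    rw [h5, h6]
    norm_num

theorem ceil_one_div_le {ε : ℝ} (h0 : 0 < ε) (h1 : ε < 1) : (⌈1 / ε⌉₊ : ℝ) ≤ 2 * (1 / ε) := by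
  have := Nat.ceil_lt_add_one (show 0 ≤ 1 / ε by positivity)
  have : 1 < 1 / ε := by rwa [lt_div_iff₀ h0, one_mul]
  linarith

theorem one_div_ceil_le {ε : ℝ} (h0 : 0 < ε) : (1 / ⌈1 / ε⌉₊ : ℝ) ≤ ε := by
  have h1 : 0 < 1 / ε := by positivity
  have := Nat.le_ceil (1 / ε)
  rw [div_le_iff₀ (by linarith), mul_comm]
  rwa [div_le_iff₀ h0] at this

/-- The time is of order `1 / ε ^ 2`, below the required cubic bound, so no logarithmic factor is
needed. -/
theorem exists_additive (A : Type*) [Fintype A] [DecidableEq A] :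
    ∃ (P : Prog) (κ : ℕ) (K : ℝ) (c : ℕ), 0 < κ ∧
      ∀ (enc : A ≃ Fin (Fintype.card A)) (n : ℕ) (w : Fin n → A) (ε : ℝ),
        1 ≤ n → 0 < ε → ε < 1 →
        Estimates P κ enc w ⌈1 / ε⌉₊ 1 ε ∧
        HaltsWithin P κ (fun i => (enc (w i) : ℕ)) ⌈1 / ε⌉₊ (softBound K c (1 / ε ^ 3)) := by
  set s := Nat.clog 2 (Fintype.card A) with hs
  refine ⟨additive s, 6 * additiveFactor s * (1 + s) + 2 ^ s + 4, 848 * additiveFactor s + 23, 0,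
    by positivity, fun enc n w ε hn h0 h1 => ?_⟩
  have hε : 1 < 1 / ε := by rwa [lt_div_iff₀ h0, one_mul]
  obtain ⟨μ, hrun, hμ⟩ := additive_spec (s := s) (m := ⌈1 / ε⌉₊)
    (x := fun i => (enc (w i) : ℕ)) hn (Nat.ceil_pos.2 (by linarith))
    (fun i => enc_lt enc (w i)) le_rfl
  refine ⟨estimates_of_runs hrun hμ le_rfl fun σ hσ => ?_, haltsWithin_of_runs hrun ?_⟩
  · rw [Set.mem_ofPred_eq, not_not, hs, totalCost_enc, abs_le] at hσ
    have := mul_le_mul_of_nonneg_right (one_div_ceil_le h0) (Nat.cast_nonneg (α := ℝ) n)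
    constructor <;> linarith [hσ.1, hσ.2]
  · have hm := ceil_one_div_le h0 h1
    have h3 : 1 / ε ^ 3 = (1 / ε) * (1 / ε) * (1 / ε) := by field_simp
    rw [softBound, pow_zero, mul_one, h3]
    push_cast
    have h4 : (⌈1 / ε⌉₊ : ℝ) * ⌈1 / ε⌉₊ ≤ 2 * (1 / ε) * (2 * (1 / ε)) :=
      mul_le_mul hm hm (by positivity) (by positivity)
    generalize (⌈1 / ε⌉₊ : ℝ) = m at *
    generalize 1 / ε = y at *
    have hF : (0 : ℝ) ≤ additiveFactor s := Nat.cast_nonneg _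
    have hy2 : 1 ≤ y * y := by nlinarith
    have hy3 : y * y ≤ y * y * y := by nlinarith
    have h5 := mul_le_mul_of_nonneg_left (h4.trans (show _ ≤ 4 * (y * y * y) by nlinarith)) hF
    nlinarith

/-! ### Combined approximation -/

/-- The number of samples for a combined estimate, up to factors depending on the parameter. -/
def combinedFactor (s : ℕ) : ℕ := 48 * (2 * s + 21)

/-- Compute the number of samples and the budget for a combined estimate. -/
def combinedSetup (s : ℕ) : Prog :=
  .seq (block [.const 2 1, .const 3 s, .op .add 9 1 17]) (.seq sizeLoop
    (block [.const 4 (combinedFactor s), .op .mul 4 4 1, .op .mul 4 4 6, .const 5 6,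
      .op .mul 5 5 4, .op .add 13 4 17, .const 6 0]))

/-- The program for combined estimates. -/
def combined (s : ℕ) : Prog :=
  .seq (combinedSetup s) (.seq sampleLoop finish)

theorem combinedSetup_spec {s b n m k : ℕ} {x : Fin n → ℕ}
    (hk : k = combinedFactor s * m * Nat.clog 2 (m + 1)) (hm : 1 ≤ m) (fs : s < 2 ^ b)
    (fB : 6 * k < 2 ^ b) :
    ∃ σ₁, Runs b x (combinedSetup s) (startStore n m) (8 * Nat.clog 2 (m + 1) + 23)
        (PMF.pure σ₁) ∧
      Ready n s σ₁ ∧ σ₁.reg 4 = k ∧ σ₁.reg 5 = 6 * k ∧ σ₁.reg 6 = 0 ∧ σ₁.reg 13 = k := by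
  have hF0 : 0 < combinedFactor s := by unfold combinedFactor; positivity
  rw [combinedSetup]
  generalize combinedFactor s = F at *
  have hu : 0 < Nat.clog 2 (m + 1) := Nat.clog_pos (by norm_num) (by omega)
  have hkF : F ≤ F * m := Nat.le_mul_of_pos_right _ hm
  have hkm : m ≤ F * m := Nat.le_mul_of_pos_left _ hF0
  have hk' : F * m ≤ k := hk ▸ Nat.le_mul_of_pos_right _ hu
  have hku : Nat.clog 2 (m + 1) ≤ k := hk ▸ Nat.le_mul_of_pos_left _ (by positivity)
  have e1 : 1 % 2 ^ b = 1 := Nat.mod_eq_of_lt (by omega)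
  have e6 : 6 % 2 ^ b = 6 := Nat.mod_eq_of_lt (by omega)
  have em : m % 2 ^ b = m := Nat.mod_eq_of_lt (by omega)
  have eF : F % 2 ^ b = F := Nat.mod_eq_of_lt (by omega)
  have eFm : F * m % 2 ^ b = F * m := Nat.mod_eq_of_lt (by omega)
  have ek : k % 2 ^ b = k := Nat.mod_eq_of_lt (by omega)
  have eB : 6 * k % 2 ^ b = 6 * k := Nat.mod_eq_of_lt (by omega)
  have es : s % 2 ^ b = s := Nat.mod_eq_of_lt fs
  have run0 := runs_block (b := b) (x := x) [.const 2 1, .const 3 s, .op .add 9 1 17] (by simp)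
    (by simp [Instr.IsDet]) (startStore n m)
  set σ₀ := [Instr.const 2 1, .const 3 s, .op .add 9 1 17].foldl (Instr.eff b x) (startStore n m)
    with hσ₀
  have hready : Ready n s σ₀ := by
    constructor <;> simp [hσ₀, Instr.eff, set_reg, startStore, e1, es]
  have h9 : σ₀.reg 9 = m := by
    simp [hσ₀, Instr.eff, set_reg, BinOp.eval, startStore, em]
  have h1 : σ₀.reg 1 = m := by
    simp [hσ₀, Instr.eff, set_reg, startStore]
  have h6 : σ₀.reg 6 = 0 := by
    simp [hσ₀, Instr.eff, set_reg, startStore]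
  obtain ⟨σ₁, run1, k6, -, -, kf⟩ := sizeLoop_spec (b := b) (x := x) (by omega) hready.two
    (by omega)
  rw [h9] at run1 k6
  rw [h6, zero_add] at k6
  specialize k6 (by omega)
  have l1 := (kf 1 (by norm_num)).trans h1
  have hready1 := hready.of_frame kf
  have run2 := runs_block (b := b) (x := x) [.const 4 F, .op .mul 4 4 1, .op .mul 4 4 6,
    .const 5 6, .op .mul 5 5 4, .op .add 13 4 17, .const 6 0] (by simp) (by simp [Instr.IsDet]) σ₁
  refine ⟨_, (run0.seq_pure (run1.seq_pure run2)).mono (by simp; omega), ⟨?_, ?_, ?_, ?_⟩, ?_, ?_,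
    ?_, ?_⟩ <;>
    simp [Instr.eff, set_reg, BinOp.eval, hready1.zero, hready1.two, hready1.three,
      hready1.seventeen, eF, eFm, e6, l1, k6, ← hk, ek, eB]

theorem combined_spec {s κ n m : ℕ} {x : Fin n → ℕ} (hn : 1 ≤ n) (hm : 1 ≤ m)
    (hx : ∀ i, x i < 2 ^ s) (hκ : 6 * combinedFactor s * (1 + s) + 2 ^ s + 4 ≤ κ) :
    ∃ μ, Runs (wordLength κ n m) x (combined s) (startStore n m)
        (212 * (combinedFactor s * m * Nat.clog 2 (m + 1)) + 8 * Nat.clog 2 (m + 1) + 30) μ ∧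
      μ.toOuterMeasure {σ' | ¬|σ'.output - totalCost s x| ≤
          1 / 2 * max (totalCost s x : ℝ) (1 / m * n)} ≤ ENNReal.ofReal (1 / 3) := by
  have hV1 := lt_two_pow_size_add_left n m
  have hV2 := lt_two_pow_size_add_right n m
  have fit (a : ℕ) (ha : a ≤ (6 * combinedFactor s * (1 + s) + 2 ^ s) *
      (2 ^ (n.size + m.size)) ^ 4) : a < 2 ^ wordLength κ n m := lt_two_pow_wordLength hn hκ ha
  clear hκ
  generalize 2 ^ (n.size + m.size) = V at *
  generalize wordLength κ n m = b at *
  have hF0 : 0 < combinedFactor s := by unfold combinedFactor; positivity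
  have hV4 : 0 < V ^ 4 := Nat.pow_pos (by omega)
  have hVV : V ≤ V ^ 4 := Nat.le_self_pow (by norm_num) _
  have hs : s < 2 ^ s := Nat.lt_two_pow_self
  have hu : 0 < Nat.clog 2 (m + 1) := Nat.clog_pos (by norm_num) (by omega)
  have hum : Nat.clog 2 (m + 1) ≤ m := Nat.clog_le_of_le_pow Nat.lt_two_pow_self
  have hpow1 : m + 1 ≤ 2 ^ Nat.clog 2 (m + 1) := Nat.le_pow_clog (by norm_num) _
  -- Rounding up to a power of two costs a factor of at most two: `2 ^ (u - 1) < m + 1` for `u =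
  -- ⌈log₂ (m + 1)⌉`.
  have hpow2 : 2 ^ Nat.clog 2 (m + 1) ≤ 2 * m := by
    have h1 := Nat.pow_pred_clog_lt_self (b := 2) (x := m + 1) (by norm_num) (by omega)
    obtain ⟨v, hv⟩ : ∃ v, Nat.clog 2 (m + 1) = v + 1 := ⟨_, (Nat.succ_pred hu.ne').symm⟩
    rw [hv, Nat.pred_succ] at h1
    rw [hv, pow_succ]
    omega
  have fit1 (a : ℕ) (ha : a ≤ 2 ^ s) : a < 2 ^ b := fit a
    (ha.trans ((Nat.le_add_left _ _).trans (Nat.le_mul_of_pos_right _ hV4)))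
  have fit2 (a : ℕ) (ha : a ≤ 6 * combinedFactor s * (1 + s) * V ^ 4) : a < 2 ^ b := fit a
    (ha.trans (Nat.mul_le_mul_right _ (Nat.le_add_right _ _)))
  have hmn : m ^ 2 * n ^ 2 ≤ V ^ 4 := by
    rw [show V ^ 4 = V ^ 2 * V ^ 2 by ring]
    gcongr
  have fn : n < 2 ^ b := fit2 n (by
    refine (hV1.le.trans hVV).trans (Nat.le_mul_of_pos_left _ (by positivity)))
  obtain ⟨u, huu⟩ : ∃ u, u = Nat.clog 2 (m + 1) := ⟨_, rfl⟩
  have hkV : combinedFactor s * m * u * (n + s) * n ≤ combinedFactor s * (1 + s) * V ^ 4 := by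
    have h1 : n + s ≤ (1 + s) * n := by nlinarith
    calc combinedFactor s * m * u * (n + s) * n
        ≤ combinedFactor s * m * m * ((1 + s) * n) * n := by gcongr; omega
      _ = combinedFactor s * (1 + s) * (m ^ 2 * n ^ 2) := by ring
      _ ≤ _ := by gcongr
  rw [← huu] at hu hum hpow1 hpow2 ⊢
  have hk0 : 0 < combinedFactor s * m * u := by positivity
  have hδ : (combinedFactor s : ℝ) = 48 * (2 * s + 21) := by
    simp [combinedFactor]
  obtain ⟨k, hk⟩ : ∃ k, k = combinedFactor s * m * u := ⟨_, rfl⟩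
  rw [← hk] at hkV hk0 ⊢
  have fS : 6 * (k * (n + s) * n) < 2 ^ b := fit2 _ (by
    rw [mul_assoc 6, mul_assoc 6]
    exact Nat.mul_le_mul_left _ hkV)
  have hkS : k ≤ k * (n + s) * n := by
    rw [mul_assoc]
    exact Nat.le_mul_of_pos_right _ (by positivity)
  obtain ⟨σ₁, run0, hready, h4, h5, h6, h13⟩ := combinedSetup_spec (b := b) (n := n) (x := x)
    (huu ▸ hk) hm (fit1 s hs.le) (by omega)
  rw [← huu] at run0
  -- The threshold `1 / 2 ^ u` is at most `1 / m`, which gives the additive term. Since `2 ^ u ≤ 2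
  -- m`, a number of samples proportional to `m u` suffices.
  obtain ⟨μ, hrun, hμ⟩ := estimate_spec (b := b) (x := x) (j := u) (δ := 1 / 2) hn
    (by omega) fn (fun i => fit1 _ (hx i).le) hready h4 h5 h6 h13 hk0 (by omega) (by positivity)
    (by omega) (by omega)
  have hm' : (0 : ℝ) < m := Nat.cast_pos.2 hm
  have hpow1' : (m : ℝ) ≤ 2 ^ u := by exact_mod_cast (Nat.le_succ m).trans hpow1
  have hpow2' : (2 ^ u : ℝ) ≤ 2 * m := by exact_mod_cast hpow2
  refine ⟨μ, (run0.seq_pure hrun).mono (by omega), ?_⟩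
  refine le_trans (PMF.toOuterMeasure_mono _ ?_) (hμ.trans (ENNReal.ofReal_le_ofReal ?_))
  · rintro σ ⟨h1, -⟩ h2
    refine h1 (h2.trans ?_)
    gcongr
  · have hk' : (0 : ℝ) < k := Nat.cast_pos.2 hk0
    have hu' : (1 : ℝ) ≤ u := by exact_mod_cast hu
    have h5 : (k : ℝ) / ((6 * k : ℕ) : ℝ) = 1 / 6 := by
      push_cast
      field_simp
    have h6 : ((2 * s + 2 * u + 19 : ℝ) * 2 ^ u / (k * (1 / 2) ^ 2)) ≤ 1 / 6 := by
      rw [div_le_iff₀ (by positivity), hk]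
      push_cast
      rw [hδ]
      have h7 : (2 * s + 2 * u + 19 : ℝ) ≤ (2 * s + 21) * u := by
        have : (0 : ℝ) ≤ s := Nat.cast_nonneg _
        nlinarith
      calc (2 * s + 2 * u + 19 : ℝ) * 2 ^ u ≤ ((2 * s + 21) * u) * (2 * m) := by gcongr
        _ = _ := by ring
    rw [h5]
    linarith

theorem half_lt_log_two : (1 / 2 : ℝ) < Real.log 2 := by
  linarith [Real.log_two_gt_d9]

/-- Take logarithms, with `1 / 2 < log 2 ≤ log (2 + y)`. -/
theorem natCast_le_log_of_two_pow_le {u a : ℕ} {y : ℝ} (hy : 0 ≤ y)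
    (h : (2 : ℝ) ^ u ≤ 2 ^ a * (2 + y)) : (u : ℝ) ≤ 2 * (a + 1) * Real.log (2 + y) := by
  have h1 := Real.log_le_log (by positivity) h
  rw [Real.log_mul (by positivity) (by positivity), Real.log_pow, Real.log_pow] at h1
  have h2 := half_lt_log_two
  have h3 : Real.log 2 ≤ Real.log (2 + y) := Real.log_le_log (by norm_num) (by linarith)
  have h4 : (a : ℝ) * Real.log 2 ≤ a * Real.log (2 + y) := by gcongr
  have h5 : (u : ℝ) * (1 / 2) ≤ u * Real.log 2 := by gcongr
  nlinarith

theorem exists_combined (A : Type*) [Fintype A] [DecidableEq A] :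
    ∃ (P : Prog) (κ : ℕ) (K : ℝ) (c : ℕ), 0 < κ ∧
      ∀ (enc : A ≃ Fin (Fintype.card A)) (n : ℕ) (w : Fin n → A) (ε : ℝ),
        1 ≤ n → 0 < ε → ε < 1 →
        Estimates P κ enc w ⌈1 / ε⌉₊ 3 ε ∧
        HaltsWithin P κ (fun i => (enc (w i) : ℕ)) ⌈1 / ε⌉₊ (softBound K c (1 / ε)) := by
  set s := Nat.clog 2 (Fintype.card A) with hs
  refine ⟨combined s, 6 * combinedFactor s * (1 + s) + 2 ^ s + 4,
    2 * (212 * combinedFactor s + 38) * 6, 1, by positivity, fun enc n w ε hn h0 h1 => ?_⟩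
  have hε : 1 < 1 / ε := by rwa [lt_div_iff₀ h0, one_mul]
  have hm1 : 1 ≤ ⌈1 / ε⌉₊ := Nat.ceil_pos.2 (by linarith)
  obtain ⟨μ, hrun, hμ⟩ := combined_spec (s := s) (m := ⌈1 / ε⌉₊)
    (x := fun i => (enc (w i) : ℕ)) hn hm1 (fun i => enc_lt enc (w i)) le_rfl
  refine ⟨estimates_of_runs hrun hμ le_rfl fun σ hσ => ?_, haltsWithin_of_runs hrun ?_⟩
  · rw [Set.mem_ofPred_eq, not_not, hs, totalCost_enc, abs_le] at hσ
    have h2 := mul_le_mul_of_nonneg_right (one_div_ceil_le h0) (Nat.cast_nonneg (α := ℝ) n)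
    have h3 : (0 : ℝ) ≤ rleCost w := Nat.cast_nonneg _
    have h4 : 0 ≤ ε * n := by positivity
    -- The error is at most `(C + ε n) / 2`, so the factor `3` leaves room.
    have h5 : max (rleCost w : ℝ) (1 / ⌈1 / ε⌉₊ * n) ≤ rleCost w + ε * n :=
      max_le (by linarith) (by linarith)
    constructor <;> linarith [hσ.1, hσ.2]
  · have hm := ceil_one_div_le h0 h1
    have hu : (Nat.clog 2 (⌈1 / ε⌉₊ + 1) : ℝ) ≤ 6 * Real.log (2 + 1 / ε) := by
      have := natCast_le_log_of_two_pow_le (u := Nat.clog 2 (⌈1 / ε⌉₊ + 1)) (a := 2)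
        (y := 1 / ε) (by linarith) (by
          have h2 := Nat.pow_pred_clog_lt_self (b := 2) (x := ⌈1 / ε⌉₊ + 1) (by norm_num) (by omega)
          obtain ⟨v, hv⟩ : ∃ v, Nat.clog 2 (⌈1 / ε⌉₊ + 1) = v + 1 :=
            ⟨_, (Nat.succ_pred (Nat.clog_pos (by norm_num) (by omega)).ne').symm⟩
          rw [hv, Nat.pred_succ] at h2
          have h3 : (2 : ℝ) ^ v ≤ ⌈1 / ε⌉₊ := by exact_mod_cast Nat.lt_succ_iff.1 h2
          rw [hv, pow_succ]
          linarith)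
      refine this.trans (le_of_eq ?_)
      norm_num
    have hu1 : (1 : ℝ) ≤ Nat.clog 2 (⌈1 / ε⌉₊ + 1) := by
      exact_mod_cast Nat.clog_pos (b := 2) (by norm_num) (show 1 < ⌈1 / ε⌉₊ + 1 by omega)
    have hm1' : (1 : ℝ) ≤ ⌈1 / ε⌉₊ := by exact_mod_cast hm1
    rw [softBound, pow_one]
    push_cast
    generalize (⌈1 / ε⌉₊ : ℝ) = m at *
    generalize (Nat.clog 2 (⌈1 / ε⌉₊ + 1) : ℝ) = u at *
    generalize Real.log (2 + 1 / ε) = z at *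
    generalize 1 / ε = y at *
    have hF : (0 : ℝ) ≤ combinedFactor s := Nat.cast_nonneg _
    have hmu : u ≤ m * u := by nlinarith
    have hmu' : m * u ≤ 2 * y * (6 * z) := mul_le_mul hm hu (by linarith) (by linarith)
    calc 212 * (combinedFactor s * m * u) + 8 * u + 30
        ≤ (212 * combinedFactor s + 38) * (m * u) := by nlinarith
      _ ≤ (212 * combinedFactor s + 38) * (2 * y * (6 * z)) := by gcongr
      _ = _ := by ring

/-! ### Multiplicative approximation

Register `14` holds `2 ^ j` and register `15` holds `j` in the `j`-th round; register `16` says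
whether another round is needed. -/

/-- The constant factor in the number of samples of a round. -/
def roundFactor (s : ℕ) : ℕ := 128 * (2 * s + 21)

/-- The number of samples in round `j`. -/
def roundSamples (s m j : ℕ) : ℕ :=
  roundFactor s * j * j * (j + 1) * 2 ^ j * (m + 1) * (m + 1)

/-- The budget of scanning steps in round `j`. -/
def roundBudget (s m j : ℕ) : ℕ :=
  128 * j * (j + 1) * roundSamples s m j

/-- Compute the number of samples and the budget of the next round. -/
def roundSetup (s : ℕ) : List Instr :=
  [.op .add 14 14 14, .op .add 15 15 2, .const 4 (roundFactor s), .op .mul 4 4 15,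
    .op .mul 4 4 15, .op .add 11 15 2, .op .mul 4 4 11, .op .mul 4 4 14, .op .add 12 1 2,
    .op .mul 4 4 12, .op .mul 4 4 12, .const 5 128, .op .mul 5 5 15, .op .mul 5 5 11,
    .op .mul 5 5 4, .op .add 13 4 17, .const 6 0]

/-- Decide whether another round is needed. -/
def roundEnd : List Instr :=
  [.op .mul 11 6 14, .op .add 12 13 13, .op .lt 11 11 12, .op .lt 12 14 0, .op .mul 16 11 12]

/-- One round. -/
def round (s : ℕ) : Prog :=
  .seq (block (roundSetup s)) (.seq sampleLoop (block roundEnd))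

/-- The program for multiplicative estimates. -/
def multiplicative (s : ℕ) : Prog :=
  .seq (block [.const 2 1, .const 3 s, .const 14 1, .const 16 1])
    (.seq (.whilenz 16 (round s)) finish)

/-- The state after `i` rounds. -/
structure AfterRounds (n s m i : ℕ) (σ : Store) : Prop extends Ready n s σ where
  one : σ.reg 1 = m
  fourteen : σ.reg 14 = 2 ^ i
  fifteen : σ.reg 15 = i

/-- The numbers that occur in round `j` fit into words of `b` bits. -/
structure Fits (b n s m j : ℕ) : Prop where
  budget : roundBudget s m j < 2 ^ b
  sum : 2 * (roundSamples s m j * (n + s) * 2 ^ j) < 2 ^ b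
  out : roundSamples s m j * (n + s) * n < 2 ^ b

theorem roundSamples_pos {s m j : ℕ} (hj : 1 ≤ j) : 0 < roundSamples s m j := by
  unfold roundSamples roundFactor
  positivity

theorem roundBudget_pos {s m j : ℕ} (hj : 1 ≤ j) : 0 < roundBudget s m j := by
  have := roundSamples_pos (s := s) (m := m) hj
  unfold roundBudget
  positivity

/-! ### A single round of the multiplicative estimate -/

section

variable {b n s m : ℕ} {x : Fin n → ℕ}

theorem roundSetup_spec {i : ℕ} (hfit : roundBudget s m (i + 1) < 2 ^ b) {σ : Store}
    (hσ : AfterRounds n s m i σ) :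
    ∃ σ₁, Runs b x (block (roundSetup s)) σ 34 (PMF.pure σ₁) ∧ AfterRounds n s m (i + 1) σ₁ ∧
      σ₁.reg 4 = roundSamples s m (i + 1) ∧ σ₁.reg 5 = roundBudget s m (i + 1) ∧
      σ₁.reg 6 = 0 ∧ σ₁.reg 13 = roundSamples s m (i + 1) := by
  have hF : 0 < roundFactor s := by unfold roundFactor; positivity
  have hk := roundSamples_pos (s := s) (m := m) (Nat.le_add_left 1 i)
  have hkdef : roundSamples s m (i + 1) = roundFactor s * (i + 1) * (i + 1) * (i + 1 + 1) *
      2 ^ (i + 1) * (m + 1) * (m + 1) := rfl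
  have hBdef : roundBudget s m (i + 1) = 128 * (i + 1) * (i + 1 + 1) * roundSamples s m (i + 1) :=
    rfl
  rw [roundSetup]
  generalize roundBudget s m (i + 1) = B at *
  generalize roundSamples s m (i + 1) = k at *
  generalize roundFactor s = F at *
  have hp : 2 ^ (i + 1) = 2 ^ i + 2 ^ i := by rw [pow_succ]; omega
  have l1 : F ≤ F * (i + 1) := Nat.le_mul_of_pos_right _ (by omega)
  have l2 : F * (i + 1) ≤ F * (i + 1) * (i + 1) := Nat.le_mul_of_pos_right _ (by omega)
  have l3 : F * (i + 1) * (i + 1) ≤ F * (i + 1) * (i + 1) * (i + 1 + 1) :=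
    Nat.le_mul_of_pos_right _ (by omega)
  have l3' : i + 1 + 1 ≤ F * (i + 1) * (i + 1) * (i + 1 + 1) :=
    Nat.le_mul_of_pos_left _ (by positivity)
  have l4 : F * (i + 1) * (i + 1) * (i + 1 + 1) ≤
      F * (i + 1) * (i + 1) * (i + 1 + 1) * 2 ^ (i + 1) :=
    Nat.le_mul_of_pos_right _ (by positivity)
  have l4' : 2 ^ (i + 1) ≤ F * (i + 1) * (i + 1) * (i + 1 + 1) * 2 ^ (i + 1) :=
    Nat.le_mul_of_pos_left _ (by positivity)
  have l5 : F * (i + 1) * (i + 1) * (i + 1 + 1) * 2 ^ (i + 1) ≤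
      F * (i + 1) * (i + 1) * (i + 1 + 1) * 2 ^ (i + 1) * (m + 1) :=
    Nat.le_mul_of_pos_right _ (by omega)
  have l6 : F * (i + 1) * (i + 1) * (i + 1 + 1) * 2 ^ (i + 1) * (m + 1) ≤
      F * (i + 1) * (i + 1) * (i + 1 + 1) * 2 ^ (i + 1) * (m + 1) * (m + 1) :=
    Nat.le_mul_of_pos_right _ (by omega)
  have l6' : m + 1 ≤ F * (i + 1) * (i + 1) * (i + 1 + 1) * 2 ^ (i + 1) * (m + 1) * (m + 1) :=
    Nat.le_mul_of_pos_left _ (by positivity)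
  have l7 : k ≤ 128 * (i + 1) * (i + 1 + 1) * k := Nat.le_mul_of_pos_left _ (by positivity)
  have l8 : 128 * (i + 1) ≤ 128 * (i + 1) * (i + 1 + 1) := Nat.le_mul_of_pos_right _ (by omega)
  have l9 : 128 * (i + 1) * (i + 1 + 1) ≤ 128 * (i + 1) * (i + 1 + 1) * k :=
    Nat.le_mul_of_pos_right _ hk
  have v1 : (2 ^ i + 2 ^ i) % 2 ^ b = 2 ^ (i + 1) := by rw [← hp]; exact Nat.mod_eq_of_lt (by omega)
  have v2 : (i + 1) % 2 ^ b = i + 1 := Nat.mod_eq_of_lt (by omega)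
  have v3 : F % 2 ^ b = F := Nat.mod_eq_of_lt (by omega)
  have v4 : F * (i + 1) % 2 ^ b = F * (i + 1) := Nat.mod_eq_of_lt (by omega)
  have v5 : F * (i + 1) * (i + 1) % 2 ^ b = F * (i + 1) * (i + 1) := Nat.mod_eq_of_lt (by omega)
  have v6 : (i + 1 + 1) % 2 ^ b = i + 1 + 1 := Nat.mod_eq_of_lt (by omega)
  have v7 : F * (i + 1) * (i + 1) * (i + 1 + 1) % 2 ^ b = F * (i + 1) * (i + 1) * (i + 1 + 1) :=
    Nat.mod_eq_of_lt (by omega)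
  have v8 : F * (i + 1) * (i + 1) * (i + 1 + 1) * 2 ^ (i + 1) % 2 ^ b =
      F * (i + 1) * (i + 1) * (i + 1 + 1) * 2 ^ (i + 1) := Nat.mod_eq_of_lt (by omega)
  have v9 : (m + 1) % 2 ^ b = m + 1 := Nat.mod_eq_of_lt (by omega)
  have v10 : F * (i + 1) * (i + 1) * (i + 1 + 1) * 2 ^ (i + 1) * (m + 1) % 2 ^ b =
      F * (i + 1) * (i + 1) * (i + 1 + 1) * 2 ^ (i + 1) * (m + 1) := Nat.mod_eq_of_lt (by omega)
  have v11 : k % 2 ^ b = k := Nat.mod_eq_of_lt (by omega)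
  have v12 : 128 % 2 ^ b = 128 := Nat.mod_eq_of_lt (by omega)
  have v13 : 128 * (i + 1) % 2 ^ b = 128 * (i + 1) := Nat.mod_eq_of_lt (by omega)
  have v14 : 128 * (i + 1) * (i + 1 + 1) % 2 ^ b = 128 * (i + 1) * (i + 1 + 1) :=
    Nat.mod_eq_of_lt (by omega)
  have v15 : B % 2 ^ b = B := Nat.mod_eq_of_lt hfit
  refine ⟨_, runs_block _ (by simp) (by simp [Instr.IsDet]) _, ⟨⟨?_, ?_, ?_, ?_⟩, ?_, ?_, ?_⟩, ?_,
    ?_, ?_, ?_⟩ <;>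
  simp only [List.foldl_cons, List.foldl_nil, Instr.eff, set_reg, BinOp.eval, hσ.zero, hσ.two,
    hσ.three, hσ.seventeen, hσ.one, hσ.fourteen, hσ.fifteen, Nat.reduceEqDiff, if_true, if_false,
    v1, v2, v3, v4, v5, v6, v7, v8, v9, v10, ← hkdef, v11, v12, v13, v14, ← hBdef, v15,
    Nat.zero_mod, add_zero, OfNat.zero_ne_ofNat, OfNat.one_ne_ofNat]

/-- What is to be true after round `j`: the estimate is accurate, and no further round is asked
for exactly if the estimate is large or the precision is sufficient. -/
def RoundGood (s m : ℕ) (x : Fin n → ℕ) (j : ℕ) (σ : Store) : Prop :=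
  IsAccurate s x (roundSamples s m j) (1 / (m + 1)) (1 / 2 ^ j) (σ.reg 6) ∧
    (σ.reg 16 = 0 ↔ ¬(σ.reg 6 * 2 ^ j < 2 * roundSamples s m j ∧ 2 ^ j < n))

/-- Samples and budget are chosen so that each of the two kinds of failure has probability at most
`1 / (128 j (j + 1))`. These bounds telescope when summed over the rounds. -/
theorem round_failure_le {j : ℕ} (hj : 1 ≤ j) :
    (2 * s + 2 * j + 19) * 2 ^ j / (roundSamples s m j * (1 / (m + 1 : ℝ)) ^ 2) +
      roundSamples s m j / roundBudget s m j ≤ 1 / (64 * j * (j + 1)) := by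
  have hk : (0 : ℝ) < roundSamples s m j := Nat.cast_pos.2 (roundSamples_pos hj)
  have hj' : (1 : ℝ) ≤ j := by exact_mod_cast hj
  have hj0 : (0 : ℝ) < j := by linarith
  have h1 : (roundSamples s m j : ℝ) / roundBudget s m j = 1 / (128 * j * (j + 1)) := by
    rw [roundBudget]
    push_cast
    field_simp
  have h2 : (2 * s + 2 * j + 19) * 2 ^ j / (roundSamples s m j * (1 / (m + 1 : ℝ)) ^ 2) ≤
      1 / (128 * j * (j + 1)) := by
    have hkr : (roundSamples s m j : ℝ) * (1 / (m + 1 : ℝ)) ^ 2 =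
        (2 * s + 21) * j * 2 ^ j * (128 * j * (j + 1)) := by
      rw [roundSamples, roundFactor]
      push_cast
      field_simp
    rw [hkr, div_le_div_iff₀ (by positivity) (by positivity), one_mul]
    gcongr
    have : (0 : ℝ) ≤ s := Nat.cast_nonneg _
    nlinarith
  rw [h1]
  refine (add_le_add_left h2 _).trans (le_of_eq ?_)
  field_simp
  norm_num

/-- That another round requires `2 ^ (i + 1) < n` holds on every path, accurate or not; this bounds
the number of rounds. The comparison of the sum is known to be free of overflow only when the round
is accurate. -/
theorem round_spec (hn0 : 0 < n) (hb : 2 < 2 ^ b) (hn : n < 2 ^ b) (hx : ∀ i, x i < 2 ^ b)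
    {i : ℕ} (hfit : Fits b n s m (i + 1)) {σ : Store} (hσ : AfterRounds n s m i σ) :
    ∃ μ, Runs b x (round s) σ
        (44 * roundSamples s m (i + 1) + 28 * roundBudget s m (i + 1) + 47) μ ∧
      (∀ σ' ∈ μ.support, AfterRounds n s m (i + 1) σ' ∧ σ'.reg 13 = roundSamples s m (i + 1) ∧
        (σ'.reg 16 ≠ 0 → 2 ^ (i + 1) < n)) ∧
      μ.toOuterMeasure {σ' | ¬RoundGood s m x (i + 1) σ'} ≤
        ENNReal.ofReal (1 / (64 * (i + 1 : ℕ) * ((i + 1 : ℕ) + 1))) := by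
  obtain ⟨σ₁, run0, hσ₁, h4, h5, h6, h13⟩ := roundSetup_spec (x := x) hfit.budget hσ
  have hk := roundSamples_pos (s := s) (m := m) (Nat.le_add_left 1 i)
  have hB := roundBudget_pos (s := s) (m := m) (Nat.le_add_left 1 i)
  have hkS : roundSamples s m (i + 1) * (n + s) ≤
      roundSamples s m (i + 1) * (n + s) * 2 ^ (i + 1) := Nat.le_mul_of_pos_right _ (by positivity)
  have hkk : roundSamples s m (i + 1) ≤ roundSamples s m (i + 1) * (n + s) :=
    Nat.le_mul_of_pos_right _ (by omega)
  have fsum := hfit.sum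
  obtain ⟨μ, run1, hf, hμ⟩ := sampleLoop_accurate (j := i + 1) (δ := 1 / (m + 1)) hn0 hb hn hx
    hσ₁.toReady h4 h5 h6 hk hB (by positivity) hfit.budget (by omega)
  set φ : Store → Store := fun σ => roundEnd.foldl (Instr.eff b x) σ with hφ
  have run2 (σ' : Store) : Runs b x (block roundEnd) σ' 10 (PMF.pure (φ σ')) :=
    runs_block (b := b) (x := x) roundEnd (by simp [roundEnd]) (by simp [roundEnd, Instr.IsDet]) σ'
  have e1 : 1 % 2 ^ b = 1 := Nat.mod_eq_of_lt (by omega)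
  have reg (σ' : Store) (r : ℕ) (h11 : r ≠ 11) (h12 : r ≠ 12) (h16 : r ≠ 16) :
      (φ σ').reg r = σ'.reg r := by
    simp [hφ, roundEnd, Instr.eff, set_reg, h11, h12, h16]
  have main (σ' : Store) (hσ' : σ' ∈ μ.support) : AfterRounds n s m (i + 1) (φ σ') ∧
      (φ σ').reg 13 = roundSamples s m (i + 1) ∧ ((φ σ').reg 16 ≠ 0 → 2 ^ (i + 1) < n) ∧
      (IsAccurate s x (roundSamples s m (i + 1)) (1 / (m + 1)) (1 / 2 ^ (i + 1)) (σ'.reg 6) →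
        RoundGood s m x (i + 1) (φ σ')) := by
    have keep (r : ℕ) (hr : r < 4 ∨ 12 < r) (h16 : r ≠ 16) : (φ σ').reg r = σ₁.reg r :=
      (reg σ' r (by omega) (by omega) h16).trans (hf σ' hσ' r hr)
    have f0 := (hf σ' hσ' 0 (by norm_num)).trans hσ₁.zero
    have f13 := (hf σ' hσ' 13 (by norm_num)).trans h13
    have f14 := (hf σ' hσ' 14 (by norm_num)).trans hσ₁.fourteen
    have e2k : (2 * roundSamples s m (i + 1)) % 2 ^ b = 2 * roundSamples s m (i + 1) :=
      Nat.mod_eq_of_lt (by omega)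
    have h16 : (φ σ').reg 16 = 0 ↔ ¬((σ'.reg 6 * 2 ^ (i + 1)) % 2 ^ b <
        2 * roundSamples s m (i + 1) ∧ 2 ^ (i + 1) < n) := by
      simp only [hφ, roundEnd, List.foldl_cons, List.foldl_nil, Instr.eff, set_reg, BinOp.eval]
      simp only [f0, f13, f14, Nat.reduceEqDiff, if_true, if_false, e2k, ← two_mul,
        OfNat.zero_ne_ofNat]
      by_cases h1 : (σ'.reg 6 * 2 ^ (i + 1)) % 2 ^ b < 2 * roundSamples s m (i + 1) <;>
        by_cases h2 : 2 ^ (i + 1) < n <;> simp [h1, h2, e1]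
    refine ⟨⟨⟨?_, ?_, ?_, ?_⟩, ?_, ?_, ?_⟩, ?_, fun h => ?_, fun hacc => ⟨?_, ?_⟩⟩
    · exact (keep 0 (by norm_num) (by norm_num)).trans hσ₁.zero
    · exact (keep 2 (by norm_num) (by norm_num)).trans hσ₁.two
    · exact (keep 3 (by norm_num) (by norm_num)).trans hσ₁.three
    · exact (keep 17 (by norm_num) (by norm_num)).trans hσ₁.seventeen
    · exact (keep 1 (by norm_num) (by norm_num)).trans hσ₁.one
    · exact (keep 14 (by norm_num) (by norm_num)).trans hσ₁.fourteen
    · exact (keep 15 (by norm_num) (by norm_num)).trans hσ₁.fifteen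
    · exact (keep 13 (by norm_num) (by norm_num)).trans h13
    · by_contra h'
      exact h (h16.2 fun h'' => h' h''.2)
    · rw [reg σ' 6 (by norm_num) (by norm_num) (by norm_num)]
      exact hacc
    · rw [h16, reg σ' 6 (by norm_num) (by norm_num) (by norm_num), Nat.mod_eq_of_lt]
      have := Nat.mul_le_mul_right (2 ^ (i + 1)) hacc.2
      omega
  refine ⟨μ.bind fun σ' => PMF.pure (φ σ'), ?_, fun σ' hσ' => ?_, ?_⟩
  · exact (run0.seq_pure (run1.seq fun σ' _ => run2 σ')).mono (by omega)
  · rw [PMF.mem_support_bind_iff] at hσ'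
    obtain ⟨σ'', h1, h2⟩ := hσ'
    rw [PMF.mem_support_pure_iff] at h2
    subst h2
    exact ⟨(main σ'' h1).1, (main σ'' h1).2.1, (main σ'' h1).2.2.1⟩
  · refine le_trans ?_ (hμ.trans (ENNReal.ofReal_le_ofReal
      (round_failure_le (Nat.le_add_left 1 i))))
    change (PMF.map φ μ).toOuterMeasure _ ≤ _
    rw [PMF.toOuterMeasure_map_apply]
    refine PMF.toOuterMeasure_mono _ ?_
    rintro σ' ⟨h1, h2⟩ h3
    exact h1 ((main σ' h2).2.2.2 h3)

end

/-! ### The stopping rule and the error probability of the rounds -/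

section

variable {b n s m : ℕ} {x : Fin n → ℕ}

/-- It suffices that `C ≥ n / 2 ^ j`. Otherwise the estimate would be at most `C + n / 2 ^ j < 2 n /
2 ^ j`, contrary to the test; and if the loop stopped because `2 ^ j ≥ n`, then `C ≥ 1` is enough.
-/
theorem RoundGood.abs_sub_le_of_stop (hn0 : 0 < n) {j : ℕ} (hj : 1 ≤ j) {σ : Store}
    (h : RoundGood s m x j σ) (h16 : σ.reg 16 = 0) :
    |(σ.reg 6 * n / roundSamples s m j : ℝ) - totalCost s x| ≤
      1 / (m + 1) * totalCost s x := by
  have hk := roundSamples_pos (s := s) (m := m) hj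
  have hk' : (0 : ℝ) < roundSamples s m j := Nat.cast_pos.2 hk
  have hn' : (0 : ℝ) < n := Nat.cast_pos.2 hn0
  have hacc := h.1.abs_sub_le hn0 hk
  suffices hC : (1 / 2 ^ j * n : ℝ) ≤ totalCost s x by rwa [max_eq_left hC] at hacc
  rcases not_and_or.1 (h.2.1 h16) with h1 | h1
  · by_contra! hC
    rw [max_eq_right hC.le] at hacc
    have h2 : (2 * roundSamples s m j : ℝ) ≤ σ.reg 6 * 2 ^ j := by exact_mod_cast not_lt.1 h1
    have h3 : 2 * (1 / 2 ^ j * n : ℝ) ≤ σ.reg 6 * n / roundSamples s m j := by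
      rw [le_div_iff₀ hk']
      calc 2 * (1 / 2 ^ j * n : ℝ) * roundSamples s m j
          = (2 * roundSamples s m j) * (n / 2 ^ j) := by ring
        _ ≤ (σ.reg 6 * 2 ^ j) * (n / 2 ^ j) := by gcongr
        _ = _ := by field_simp
    have h4 : (1 / (m + 1 : ℝ)) * (1 / 2 ^ j * n) ≤ 1 / 2 ^ j * n := by
      refine mul_le_of_le_one_left (by positivity) ?_
      rw [div_le_one (by positivity)]
      linarith [Nat.cast_nonneg (α := ℝ) m]
    linarith [(abs_le.1 hacc).2]
  · have h2 : (n : ℝ) ≤ 2 ^ j := by exact_mod_cast not_lt.1 h1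
    have h3 : (1 : ℝ) ≤ totalCost s x := by exact_mod_cast totalCost_pos hn0 s x
    refine le_trans ?_ h3
    rwa [one_div, inv_mul_eq_div, div_le_one (by positivity)]

/-- For `m ≥ 1` the relative error is at most `1 / 2`, so the estimate is at least `C / 2 ≥ 2 n / 2
^ j` and passes the test. -/
theorem RoundGood.reg_eq_zero_of_large (hn0 : 0 < n) {j : ℕ} (hj : 1 ≤ j) (hm : 1 ≤ m) {σ : Store}
    (h : RoundGood s m x j σ) (hC : 4 * n ≤ 2 ^ j * totalCost s x) : σ.reg 16 = 0 := by
  have hk := roundSamples_pos (s := s) (m := m) hj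
  have hk' : (0 : ℝ) < roundSamples s m j := Nat.cast_pos.2 hk
  have hn' : (0 : ℝ) < n := Nat.cast_pos.2 hn0
  have hacc := h.1.abs_sub_le hn0 hk
  have hC' : (4 * n : ℝ) ≤ 2 ^ j * totalCost s x := by exact_mod_cast hC
  have hC1 : 4 * (1 / 2 ^ j * n : ℝ) ≤ totalCost s x := by
    calc 4 * (1 / 2 ^ j * n : ℝ) = 4 * n / 2 ^ j := by ring
      _ ≤ _ := by rwa [div_le_iff₀' (by positivity)]
  have hpos : (0 : ℝ) ≤ 1 / 2 ^ j * n := by positivity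
  rw [max_eq_left (by linarith)] at hacc
  refine h.2.2 fun h1 => ?_
  have h2 : (σ.reg 6 * 2 ^ j : ℝ) < 2 * roundSamples s m j := by exact_mod_cast h1.1
  have h3 : (σ.reg 6 * n / roundSamples s m j : ℝ) < 2 * (1 / 2 ^ j * n) := by
    rw [div_lt_iff₀ hk']
    calc (σ.reg 6 * n : ℝ) = (σ.reg 6 * 2 ^ j) * (n / 2 ^ j) := by field_simp
      _ < (2 * roundSamples s m j) * (n / 2 ^ j) := by gcongr
      _ = _ := by ring
  have hm' : (1 : ℝ) ≤ m := by exact_mod_cast hm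
  have h4 : (1 / (m + 1 : ℝ)) * totalCost s x ≤ 1 / 2 * totalCost s x := by
    gcongr
    linarith
  linarith [(abs_le.1 hacc).1]

/-- A union bound: a failure happens either now, in `G`, or later with probability at most `a`. -/
theorem toOuterMeasure_bind_le {α β : Type*} (μ : PMF α) (ν : α → PMF β) (S : Set β) (G : Set α)
    (a : ℝ≥0∞) (h : ∀ σ ∈ μ.support, (ν σ).toOuterMeasure S ≤ G.indicator 1 σ + a) :
    (μ.bind ν).toOuterMeasure S ≤ μ.toOuterMeasure G + a := by
  rw [PMF.toOuterMeasure_bind_apply, PMF.toOuterMeasure_apply]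
  have h1 : a = ∑' σ, μ σ * a := by rw [ENNReal.tsum_mul_right, PMF.tsum_coe, one_mul]
  conv_rhs => rw [h1, ← ENNReal.tsum_add]
  refine ENNReal.tsum_le_tsum fun σ => ?_
  by_cases hσ : μ σ = 0
  · simp [hσ]
  · refine (mul_le_mul_right (h σ ((PMF.mem_support_iff _ _).2 hσ)) _).trans (le_of_eq ?_)
    rw [mul_add]
    by_cases hG : σ ∈ G <;> simp [hG]

/-- The loop has stopped after an accurate round. -/
def StopGood (b s m : ℕ) (x : Fin n → ℕ) (σ : Store) : Prop :=
  Ready n s σ ∧ σ.reg 16 = 0 ∧ ∃ j, 1 ≤ j ∧ RoundGood s m x j σ ∧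
    σ.reg 13 = roundSamples s m j ∧ Fits b n s m j

theorem two_pow_succ_le_of {i : ℕ} (hn0 : 0 < n) (hi : i = 0 ∨ 2 ^ i < n) :
    2 ^ (i + 1) ≤ 2 * n := by
  rcases hi with rfl | hi
  · simp; omega
  · rw [pow_succ]; omega

/-- The bound is the sum of `1 / (64 j (j + 1))` over `j > i`. The induction is on the rounds that
can remain, which are finitely many since `i < 2 ^ i < n`. -/
theorem loop_spec (hn0 : 0 < n) (hb : 2 < 2 ^ b) (hn : n < 2 ^ b) (hx : ∀ i, x i < 2 ^ b)
    (hfit : ∀ j, 1 ≤ j → 2 ^ j ≤ 2 * n → Fits b n s m j) (N i : ℕ) (hN : n ≤ i + N)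
    (hi : i = 0 ∨ 2 ^ i < n) :
    ∃ T, ∀ σ, AfterRounds n s m i σ → σ.reg 16 ≠ 0 →
      ∃ μ, Runs b x (.whilenz 16 (round s)) σ T μ ∧
        μ.toOuterMeasure {σ' | ¬StopGood b s m x σ'} ≤ ENNReal.ofReal (1 / (64 * (i + 1 : ℕ))) := by
  induction N generalizing i with
  | zero =>
    rcases hi with hi | hi
    · omega
    · have := (Nat.lt_two_pow_self (n := i))
      omega
  | succ N ih =>
    have hfit' := hfit (i + 1) (by omega) (two_pow_succ_le_of hn0 hi)
    have next : ∃ T, ∀ σ, AfterRounds n s m (i + 1) σ → σ.reg 16 ≠ 0 → 2 ^ (i + 1) < n →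
        ∃ μ, Runs b x (.whilenz 16 (round s)) σ T μ ∧
          μ.toOuterMeasure {σ' | ¬StopGood b s m x σ'} ≤
            ENNReal.ofReal (1 / (64 * (i + 1 + 1 : ℕ))) := by
      by_cases hlt : 2 ^ (i + 1) < n
      · obtain ⟨T, hT⟩ := ih (i + 1) (by omega) (Or.inr hlt)
        exact ⟨T, fun σ h1 h2 _ => hT σ h1 h2⟩
      · exact ⟨0, fun σ _ _ h => absurd h hlt⟩
    obtain ⟨T, hT⟩ := next
    refine ⟨44 * roundSamples s m (i + 1) + 28 * roundBudget s m (i + 1) + 47 + (T + 1) + 1,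
      fun σ hσ h16 => ?_⟩
    obtain ⟨μ, hrun, hμ, hbad⟩ := round_spec hn0 hb hn hx hfit' hσ
    have step (σ' : Store) : ∃ ν, σ' ∈ μ.support →
        Runs b x (.whilenz 16 (round s)) σ' (T + 1) ν ∧
        ν.toOuterMeasure {σ'' | ¬StopGood b s m x σ''} ≤
          Set.indicator {σ' | ¬RoundGood s m x (i + 1) σ'} 1 σ' +
            ENNReal.ofReal (1 / (64 * (i + 1 + 1 : ℕ))) := by
      by_cases hσ' : σ' ∈ μ.support
      · obtain ⟨h1, h2, h3⟩ := hμ σ' hσ'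
        by_cases h16' : σ'.reg 16 = 0
        · refine ⟨PMF.pure σ', fun _ => ⟨(runs_whilenz_zero h16').mono (by omega), ?_⟩⟩
          by_cases hg : RoundGood s m x (i + 1) σ'
          · rw [PMF.toOuterMeasure_pure_apply, if_neg]
            · exact zero_le
            · exact fun h => h ⟨h1.toReady, h16', i + 1, by omega, hg, h2, hfit'⟩
          · refine le_trans ?_ le_self_add
            rw [Set.indicator_of_mem (show σ' ∈ {σ' | ¬RoundGood s m x (i + 1) σ'} from hg),
              PMF.toOuterMeasure_pure_apply]
            split_ifs <;> simp
        · obtain ⟨ν, h4, h5⟩ := hT σ' h1 h16' (h3 h16')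
          exact ⟨ν, fun _ => ⟨h4.mono (by omega), h5.trans le_add_self⟩⟩
      · exact ⟨μ, fun h => absurd h hσ'⟩
    choose ν hν using step
    refine ⟨_, runs_whilenz_ne h16 hrun fun σ' hσ' => (hν σ' hσ').1, ?_⟩
    refine (toOuterMeasure_bind_le _ _ _ _ _ fun σ' hσ' => (hν σ' hσ').2).trans ?_
    refine (add_le_add_left hbad _).trans (le_of_eq ?_)
    -- The telescoping identity `1 / ((i + 1) (i + 2)) + 1 / (i + 2) = 1 / (i + 1)`.
    rw [← ENNReal.ofReal_add (by positivity) (by positivity)]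
    congr 1
    push_cast
    field_simp
    ring

/-! ### The expected time of the rounds -/

theorem tsum_map_mul {α β : Type*} (p : PMF α) (f : α → β) (g : β → ℝ≥0∞) :
    ∑' y, p.map f y * g y = ∑' a, p a * g (f a) := by
  rw [PMF.map, tsum_bind_mul]
  exact tsum_congr fun a => by rw [Function.comp_apply, tsum_pure_mul]

theorem timeFrom_loop_zero {σ : Store} (h16 : σ.reg 16 = 0) :
    timeFrom b x ([.whilenz 16 (round s), finish], σ) ≤ 5 := by
  have run1 := runs_whilenz_zero (b := b) (x := x) (p := round s) h16
  have run2 := runs_block (b := b) (x := x) [.op .mul 0 6 0, .op .add 1 13 17] (by simp)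
    (by simp [Instr.IsDet]) σ
  have := run1.then [finish] [] (ν := fun _ => PMF.pure _) fun σ' hσ' => by
    rw [PMF.mem_support_pure_iff] at hσ'
    subst hσ'
    exact run2 []
  refine this.timeFrom_le.trans ?_
  rw [tsum_map_mul]
  simp only [timeFrom_halted]
  norm_num

/-- The expected time of a loop whose round `i + 1` is repeated with the probability
`p`. -/
theorem timeFrom_loop_le (hn0 : 0 < n) (hb : 2 < 2 ^ b) (hn : n < 2 ^ b) (hx : ∀ i, x i < 2 ^ b)
    {i : ℕ} (hfit : Fits b n s m (i + 1)) {σ : Store} (hσ : AfterRounds n s m i σ)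
    (h16 : σ.reg 16 ≠ 0) {e : ℝ≥0∞}
    (he : 2 ^ (i + 1) < n → ∀ σ', AfterRounds n s m (i + 1) σ' → σ'.reg 16 ≠ 0 →
      timeFrom b x ([.whilenz 16 (round s), finish], σ') ≤ e) {p : ℝ≥0∞}
    (hp : 1 ≤ p ∨ ENNReal.ofReal (1 / (64 * (i + 1 : ℕ) * ((i + 1 : ℕ) + 1))) ≤ p ∧
      ∀ σ', RoundGood s m x (i + 1) σ' → σ'.reg 16 = 0) :
    timeFrom b x ([.whilenz 16 (round s), finish], σ) ≤
      (44 * roundSamples s m (i + 1) + 28 * roundBudget s m (i + 1) + 53 : ℕ) + p * e := by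
  obtain ⟨μ, hrun, hμ, hbad⟩ := round_spec hn0 hb hn hx hfit hσ
  have hexec := Exec.of_step (b := b) (x := x) (c := ([.whilenz 16 (round s), finish], σ))
    (by rw [step, if_neg h16]) (hrun [.whilenz 16 (round s), finish])
  refine hexec.timeFrom_le.trans ?_
  rw [tsum_map_mul]
  -- Another round happens either with the trivial bound `1`, or only after an inaccurate round.
  have hcont : μ.toOuterMeasure {σ' | σ'.reg 16 ≠ 0} ≤ p := by
    rcases hp with hp | ⟨hp1, hp2⟩
    · refine le_trans ?_ hp
      rw [← toOuterMeasure_add_compl μ {σ' | σ'.reg 16 ≠ 0}]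
      exact le_self_add
    · refine (PMF.toOuterMeasure_mono _ ?_).trans (hbad.trans hp1)
      rintro σ' ⟨h1, -⟩ h2
      exact h1 (hp2 σ' h2)
  have hsum : ∑' σ', μ σ' * timeFrom b x ([.whilenz 16 (round s), finish], σ') ≤
      ∑' σ', (μ σ' * 5 + Set.indicator {σ' : Store | σ'.reg 16 ≠ 0} μ σ' * e) := by
    refine ENNReal.tsum_le_tsum fun σ' => ?_
    by_cases h0 : μ σ' = 0
    · simp [h0]
    · by_cases h1 : σ'.reg 16 = 0
      · exact (mul_le_mul_right (timeFrom_loop_zero h1) _).trans le_self_add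
      · obtain ⟨h2, -, h3⟩ := hμ σ' ((PMF.mem_support_iff _ _).2 h0)
        rw [Set.indicator_of_mem (show σ' ∈ {σ' : Store | σ'.reg 16 ≠ 0} from h1)]
        exact (mul_le_mul_right (he (h3 h1) σ' h2 h1) _).trans le_add_self
  rw [ENNReal.tsum_add, ENNReal.tsum_mul_right, ENNReal.tsum_mul_right, PMF.tsum_coe, one_mul,
    ← PMF.toOuterMeasure_apply] at hsum
  calc _ ≤ ((44 * roundSamples s m (i + 1) + 28 * roundBudget s m (i + 1) + 47 + 1 : ℕ) : ℝ≥0∞) +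
        (5 + p * e) := by
        gcongr
        exact hsum.trans (by gcongr)
    _ = _ := by
        push_cast
        ring

/-- The constant in the bound for the expected time. -/
noncomputable def timeFactor (s m : ℕ) : ℝ :=
  30000 * roundFactor s * (m + 1) ^ 2

theorem timeFactor_nonneg (s m : ℕ) : 0 ≤ timeFactor s m := by
  unfold timeFactor
  positivity

/-- The samples grow like `j ^ 3 2 ^ j` and the budget has a further factor `j ^ 2`. Only half of
`timeFactor` is used; the other half pays for later rounds. -/
theorem round_time_le {j : ℕ} (hj : 1 ≤ j) :
    ((44 * roundSamples s m j + 28 * roundBudget s m j + 53 : ℕ) : ℝ) ≤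
      timeFactor s m / 2 * (j ^ 5 * 2 ^ j) := by
  have h1 : roundBudget s m j ≤ 256 * j ^ 2 * roundSamples s m j := by
    rw [roundBudget]
    refine Nat.mul_le_mul_right _ ?_
    nlinarith
  have h2 : roundSamples s m j ≤ 2 * roundFactor s * j ^ 3 * 2 ^ j * (m + 1) ^ 2 := by
    rw [roundSamples]
    calc roundFactor s * j * j * (j + 1) * 2 ^ j * (m + 1) * (m + 1)
        ≤ roundFactor s * j * j * (j + j) * 2 ^ j * (m + 1) * (m + 1) := by gcongr
      _ = _ := by ring
  have h3 := roundSamples_pos (s := s) (m := m) hj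
  have h4 : 44 * roundSamples s m j + 28 * roundBudget s m j + 53 ≤
      7265 * j ^ 2 * roundSamples s m j := by
    have h5 : roundSamples s m j ≤ j ^ 2 * roundSamples s m j :=
      Nat.le_mul_of_pos_left _ (by positivity)
    rw [mul_assoc] at h1 ⊢
    omega
  have h6 : 44 * roundSamples s m j + 28 * roundBudget s m j + 53 ≤
      15000 * roundFactor s * (m + 1) ^ 2 * (j ^ 5 * 2 ^ j) := by
    calc _ ≤ 7265 * j ^ 2 * roundSamples s m j := h4
      _ ≤ 7265 * j ^ 2 * (2 * roundFactor s * j ^ 3 * 2 ^ j * (m + 1) ^ 2) := by gcongr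
      _ = 14530 * (roundFactor s * (m + 1) ^ 2 * (j ^ 5 * 2 ^ j)) := by ring
      _ ≤ 15000 * (roundFactor s * (m + 1) ^ 2 * (j ^ 5 * 2 ^ j)) := by gcongr; norm_num
      _ = _ := by ring
  calc _ ≤ ((15000 * roundFactor s * (m + 1) ^ 2 * (j ^ 5 * 2 ^ j) : ℕ) : ℝ) := by
        exact_mod_cast h6
    _ = _ := by
        rw [timeFactor]
        push_cast
        ring

/-- Once `C ≥ 4 n / 2 ^ (i + 1)`, only inaccurate rounds continue. The bound grows by at most `2 ^ 5
* 2 = 64` per round while the probability of continuing is at most `1 / 128`, so later rounds cost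
at most the other half. -/
theorem timeFrom_loop_le_of_large (hn0 : 0 < n) (hb : 2 < 2 ^ b) (hn : n < 2 ^ b)
    (hx : ∀ i, x i < 2 ^ b) (hm : 1 ≤ m)
    (hfit : ∀ j, 1 ≤ j → 2 ^ j ≤ 2 * n → Fits b n s m j) (N i : ℕ) (hN : n ≤ i + N)
    (hi : i = 0 ∨ 2 ^ i < n) (hC : 4 * n ≤ 2 ^ (i + 1) * totalCost s x) {σ : Store}
    (hσ : AfterRounds n s m i σ) (h16 : σ.reg 16 ≠ 0) :
    timeFrom b x ([.whilenz 16 (round s), finish], σ) ≤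
      ENNReal.ofReal (timeFactor s m * ((i + 1 : ℕ) ^ 5 * 2 ^ (i + 1))) := by
  induction N generalizing i σ with
  | zero =>
    rcases hi with hi | hi
    · omega
    · have := (Nat.lt_two_pow_self (n := i))
      omega
  | succ N ih =>
    have hC' : 4 * n ≤ 2 ^ (i + 1 + 1) * totalCost s x := by
      rw [pow_succ, mul_right_comm]
      omega
    refine (timeFrom_loop_le hn0 hb hn hx (hfit (i + 1) (by omega) (two_pow_succ_le_of hn0 hi))
      hσ h16 (fun hlt σ' h1 h2 => ih (i + 1) (by omega) (Or.inr hlt) hC' h1 h2)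
      (Or.inr ⟨le_rfl, fun σ' h1 => h1.reg_eq_zero_of_large hn0 (by omega) hm hC⟩)).trans ?_
    have hD := timeFactor_nonneg s m
    rw [← ENNReal.ofReal_mul (by positivity), ← ENNReal.ofReal_natCast,
      ← ENNReal.ofReal_add (by positivity) (by positivity)]
    refine ENNReal.ofReal_le_ofReal ?_
    have h1 := round_time_le (s := s) (m := m) (Nat.le_add_left 1 i)
    have h2 : (1 / (64 * (i + 1 : ℕ) * ((i + 1 : ℕ) + 1)) : ℝ) *
        (timeFactor s m * ((i + 1 + 1 : ℕ) ^ 5 * 2 ^ (i + 1 + 1))) ≤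
        timeFactor s m / 2 * ((i + 1 : ℕ) ^ 5 * 2 ^ (i + 1)) := by
      have h3 : ((i + 1 + 1 : ℕ) : ℝ) ≤ 2 * (i + 1 : ℕ) := by
        push_cast
        linarith [Nat.cast_nonneg (α := ℝ) i]
      have h4 : (1 / (64 * (i + 1 : ℕ) * ((i + 1 : ℕ) + 1)) : ℝ) ≤ 1 / 128 := by
        refine one_div_le_one_div_of_le (by norm_num) ?_
        push_cast
        nlinarith [Nat.cast_nonneg (α := ℝ) i]
      calc _ ≤ (1 / 128 : ℝ) * (timeFactor s m * ((2 * (i + 1 : ℕ)) ^ 5 * 2 ^ (i + 1 + 1))) := by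
            gcongr
        _ = _ := by ring
    linarith

/-- Up to round `J` every round is charged in full. The factors `j ^ 5` are at most `J ^ 5`, and the
powers of two form a geometric sum. -/
theorem timeFrom_loop_le_of_small (hn0 : 0 < n) (hb : 2 < 2 ^ b) (hn : n < 2 ^ b)
    (hx : ∀ i, x i < 2 ^ b) (hm : 1 ≤ m)
    (hfit : ∀ j, 1 ≤ j → 2 ^ j ≤ 2 * n → Fits b n s m j) {J : ℕ}
    (hJ : 4 * n ≤ 2 ^ J * totalCost s x) (d i : ℕ) (hd : i + 1 + d = J)
    (hi : i = 0 ∨ 2 ^ i < n) {σ : Store}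
    (hσ : AfterRounds n s m i σ) (h16 : σ.reg 16 ≠ 0) :
    timeFrom b x ([.whilenz 16 (round s), finish], σ) ≤
      ENNReal.ofReal (timeFactor s m * (J ^ 5 * (2 * 2 ^ J - 2 ^ (i + 1)))) := by
  induction d generalizing i σ with
  | zero =>
    subst hd
    refine (timeFrom_loop_le_of_large hn0 hb hn hx hm hfit n i (by omega) hi hJ hσ h16).trans
      (le_of_eq ?_)
    congr 1
    rw [add_zero]
    ring
  | succ d ih =>
    refine (timeFrom_loop_le hn0 hb hn hx (hfit (i + 1) (by omega) (two_pow_succ_le_of hn0 hi))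
      hσ h16 (fun hlt σ' h1 h2 => ih (i + 1) (by omega) (Or.inr hlt) h1 h2)
      (Or.inl le_rfl)).trans ?_
    have hD := timeFactor_nonneg s m
    have hpow : (2 : ℝ) ^ (i + 1 + 1) ≤ 2 ^ J := pow_le_pow_right₀ (by norm_num) (by omega)
    rw [one_mul, ← ENNReal.ofReal_natCast, ← ENNReal.ofReal_add (by positivity) (by
      have : (0 : ℝ) ≤ 2 * 2 ^ J - 2 ^ (i + 1 + 1) := by linarith [pow_pos (two_pos (α := ℝ)) J]
      positivity)]
    refine ENNReal.ofReal_le_ofReal ?_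
    have h1 := round_time_le (s := s) (m := m) (Nat.le_add_left 1 i)
    have h2 : timeFactor s m / 2 * ((i + 1 : ℕ) ^ 5 * 2 ^ (i + 1)) ≤
        timeFactor s m * (J ^ 5 * 2 ^ (i + 1)) := by
      have : ((i + 1 : ℕ) : ℝ) ≤ J := by exact_mod_cast (show i + 1 ≤ J by omega)
      have h3 : timeFactor s m / 2 ≤ timeFactor s m := by linarith
      gcongr
    have h4 : timeFactor s m * (J ^ 5 * (2 * 2 ^ J - 2 ^ (i + 1))) =
        timeFactor s m * (J ^ 5 * 2 ^ (i + 1)) +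
          timeFactor s m * (J ^ 5 * (2 * 2 ^ J - 2 ^ (i + 1 + 1))) := by
      rw [pow_succ 2 (i + 1)]
      ring
    linarith

end

/-! ### The multiplicative program: accuracy, word size and expected time -/

section

variable {b n s m : ℕ} {x : Fin n → ℕ}

theorem multiplicative_setup (hb : 2 < 2 ^ b) (fs : s < 2 ^ b) {σ : Store} (h0 : σ.reg 0 = n)
    (h1 : σ.reg 1 = m) (h15 : σ.reg 15 = 0) (h17 : σ.reg 17 = 0) :
    ∃ σ₁, Runs b x (block [.const 2 1, .const 3 s, .const 14 1, .const 16 1]) σ 8 (PMF.pure σ₁) ∧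
      AfterRounds n s m 0 σ₁ ∧ σ₁.reg 16 ≠ 0 := by
  have e1 : 1 % 2 ^ b = 1 := Nat.mod_eq_of_lt (by omega)
  have es : s % 2 ^ b = s := Nat.mod_eq_of_lt fs
  refine ⟨_, runs_block _ (by simp) (by simp [Instr.IsDet]) _, ⟨⟨?_, ?_, ?_, ?_⟩, ?_, ?_, ?_⟩,
    ?_⟩ <;>
    simp [Instr.eff, set_reg, h0, h1, h15, h17, e1, es]

theorem multiplicative_estimate (hn0 : 0 < n) (hb : 2 < 2 ^ b) (hn : n < 2 ^ b)
    (hx : ∀ i, x i < 2 ^ b) (fs : s < 2 ^ b)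
    (hfit : ∀ j, 1 ≤ j → 2 ^ j ≤ 2 * n → Fits b n s m j) {σ : Store} (h0 : σ.reg 0 = n)
    (h1 : σ.reg 1 = m) (h15 : σ.reg 15 = 0) (h17 : σ.reg 17 = 0) :
    ∃ T μ, Runs b x (multiplicative s) σ T μ ∧
      μ.toOuterMeasure {σ' | ¬|σ'.output - totalCost s x| ≤ 1 / (m + 1) * totalCost s x} ≤
        ENNReal.ofReal (1 / 64) := by
  obtain ⟨σ₁, run0, hσ₁, h16⟩ := multiplicative_setup (x := x) hb fs h0 h1 h15 h17
  obtain ⟨T, hT⟩ := loop_spec hn0 hb hn hx hfit n 0 (by omega) (Or.inl rfl)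
  obtain ⟨μ, run1, hμ⟩ := hT σ₁ hσ₁ h16
  set τ : Store → Store := fun σ' =>
    [Instr.op .mul 0 6 0, .op .add 1 13 17].foldl (Instr.eff b x) σ' with hτ
  have run2 (σ' : Store) : Runs b x finish σ' 4 (PMF.pure (τ σ')) :=
    runs_block [.op .mul 0 6 0, .op .add 1 13 17] (by simp) (by simp [Instr.IsDet]) σ'
  refine ⟨_, _, run0.seq_pure (run1.seq fun σ' _ => run2 σ'), ?_⟩
  refine le_trans ?_ (hμ.trans (ENNReal.ofReal_le_ofReal (by norm_num)))
  change (PMF.map τ μ).toOuterMeasure _ ≤ _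
  rw [PMF.toOuterMeasure_map_apply]
  refine PMF.toOuterMeasure_mono _ ?_
  rintro σ' ⟨h2, -⟩ ⟨hready, h3, j, hj, hgood, h13, hfit'⟩
  refine h2 ?_
  have hk : roundSamples s m j < 2 ^ b :=
    (Nat.le_mul_of_pos_left _ (by positivity)).trans_lt hfit'.budget
  have hout := (Nat.mul_le_mul_right n hgood.1.2).trans_lt hfit'.out
  have h4 : (τ σ').output = σ'.reg 6 * n / roundSamples s m j := by
    simp [hτ, Instr.eff, set_reg, BinOp.eval, Store.output, hready.zero, hready.seventeen, h13,
      Nat.mod_eq_of_lt hout, Nat.mod_eq_of_lt hk]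
  rw [h4]
  exact hgood.abs_sub_le_of_stop hn0 hj h3

theorem multiplicative_time (hn0 : 0 < n) (hb : 2 < 2 ^ b) (hn : n < 2 ^ b)
    (hx : ∀ i, x i < 2 ^ b) (fs : s < 2 ^ b) (hm : 1 ≤ m)
    (hfit : ∀ j, 1 ≤ j → 2 ^ j ≤ 2 * n → Fits b n s m j) {σ : Store} (h0 : σ.reg 0 = n)
    (h1 : σ.reg 1 = m) (h15 : σ.reg 15 = 0) (h17 : σ.reg 17 = 0) {J : ℕ} (hJ0 : 1 ≤ J)
    (hJ : 4 * n ≤ 2 ^ J * totalCost s x) :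
    timeFrom b x ([multiplicative s], σ) ≤
      ENNReal.ofReal (10 + timeFactor s m * (J ^ 5 * (2 * 2 ^ J))) := by
  obtain ⟨σ₁, run0, hσ₁, h16⟩ := multiplicative_setup (x := x) hb fs h0 h1 h15 h17
  have hrest := timeFrom_loop_le_of_small hn0 hb hn hx hm hfit hJ (J - 1) 0 (by omega) (Or.inl rfl)
    hσ₁ h16
  have h2 := run0 [.seq (.whilenz 16 (round s)) finish]
  rw [PMF.pure_map] at h2
  have h3 := h2.bind (T' := 1) (ν := fun _ => PMF.pure ([.whilenz 16 (round s), finish], σ₁))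
    fun c hc => by
      rw [PMF.mem_support_pure_iff] at hc
      subst hc
      exact .of_step rfl (.done _ 0)
  rw [PMF.pure_bind] at h3
  have h4 := Exec.of_step (c := ([multiplicative s], σ)) rfl h3
  refine h4.timeFrom_le.trans ?_
  rw [tsum_pure_mul]
  have hD := timeFactor_nonneg s m
  rw [ENNReal.ofReal_add (by norm_num) (by positivity)]
  refine add_le_add (by norm_num) (hrest.trans (ENNReal.ofReal_le_ofReal ?_))
  gcongr
  have : (0 : ℝ) ≤ 2 ^ (0 + 1) := by positivity
  linarith

/-- A bound for the numbers that occur, up to a power of the word range. -/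
def wordFactor (s : ℕ) : ℕ := 8192 * roundFactor s * (1 + s) + 2 ^ s

/-- Rounds end once `2 ^ j` reaches `n`, so `2 ^ j` and `j + 1` are at most `2 V`, and every number
is bounded by a constant times `V ^ 8`. -/
theorem fits_of_le {V : ℕ} (hnV : n < V) (hmV : m < V)
    (fit : ∀ a, a ≤ wordFactor s * V ^ 8 → a < 2 ^ b) (j : ℕ) (hp : 2 ^ j ≤ 2 * n) :
    Fits b n s m j := by
  have fit' (a : ℕ) (ha : a ≤ 8192 * roundFactor s * (1 + s) * V ^ 8) : a < 2 ^ b :=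
    fit a (ha.trans (Nat.mul_le_mul_right _ (Nat.le_add_right _ _)))
  have hj : j + 1 ≤ 2 * V := (Nat.lt_two_pow_self (n := j)).trans (by omega)
  have hp' : 2 ^ j ≤ 2 * V := by omega
  have hk : roundSamples s m j ≤ 16 * roundFactor s * V ^ 6 := by
    rw [roundSamples]
    calc roundFactor s * j * j * (j + 1) * 2 ^ j * (m + 1) * (m + 1)
        ≤ roundFactor s * (2 * V) * (2 * V) * (2 * V) * (2 * V) * V * V := by
          gcongr <;> omega
      _ = _ := by ring
  have hns : n + s ≤ (1 + s) * V := by nlinarith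
  constructor
  · refine fit' _ ?_
    rw [roundBudget]
    calc 128 * j * (j + 1) * roundSamples s m j
        ≤ 128 * (2 * V) * (2 * V) * (16 * roundFactor s * V ^ 6) := by gcongr; omega
      _ = 8192 * roundFactor s * 1 * V ^ 8 := by ring
      _ ≤ _ := by gcongr; omega
  · refine fit' _ ?_
    calc 2 * (roundSamples s m j * (n + s) * 2 ^ j)
        ≤ 2 * (16 * roundFactor s * V ^ 6 * ((1 + s) * V) * (2 * V)) := by gcongr
      _ = 64 * roundFactor s * (1 + s) * V ^ 8 := by ring
      _ ≤ _ := by gcongr; norm_num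
  · refine fit' _ ?_
    calc roundSamples s m j * (n + s) * n
        ≤ 16 * roundFactor s * V ^ 6 * ((1 + s) * V) * V := by gcongr
      _ = 16 * roundFactor s * (1 + s) * V ^ 8 := by ring
      _ ≤ _ := by gcongr; norm_num

/-- The program for multiplicative estimates, from any store that holds its input. -/
theorem multiplicative_spec {κ m' : ℕ} (hn0 : 1 ≤ n) (hm : 1 ≤ m)
    (hmV : m < 2 ^ (n.size + m'.size)) (hx : ∀ i, x i < 2 ^ s) (hκ : wordFactor s + 8 ≤ κ)
    {σ : Store} (h0 : σ.reg 0 = n) (h1 : σ.reg 1 = m) (h15 : σ.reg 15 = 0) (h17 : σ.reg 17 = 0) :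
    (∃ T μ, Runs (wordLength κ n m') x (multiplicative s) σ T μ ∧
      μ.toOuterMeasure {σ' | ¬|σ'.output - totalCost s x| ≤ 1 / (m + 1) * totalCost s x} ≤
        ENNReal.ofReal (1 / 64)) ∧
    ∀ J : ℕ, 1 ≤ J → 4 * n ≤ 2 ^ J * totalCost s x →
      timeFrom (wordLength κ n m') x ([multiplicative s], σ) ≤
        ENNReal.ofReal (10 + timeFactor s m * (J ^ 5 * (2 * 2 ^ J))) := by
  have hnV := lt_two_pow_size_add_left n m'
  have fit (a : ℕ) (ha : a ≤ wordFactor s * (2 ^ (n.size + m'.size)) ^ 8) :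
      a < 2 ^ wordLength κ n m' := lt_two_pow_wordLength hn0 hκ ha
  generalize 2 ^ (n.size + m'.size) = V at *
  generalize wordLength κ n m' = b at *
  have hV8 : 0 < V ^ 8 := Nat.pow_pos (by omega)
  have hVV : V ≤ V ^ 8 := Nat.le_self_pow (by norm_num) _
  have hw : 2 ^ s ≤ wordFactor s := Nat.le_add_left _ _
  have hw' : 8192 ≤ wordFactor s := by
    refine le_trans ?_ (Nat.le_add_right _ _)
    rw [mul_assoc]
    exact Nat.le_mul_of_pos_right _ (by unfold roundFactor; positivity)
  have fit1 (a : ℕ) (ha : a ≤ wordFactor s) : a < 2 ^ b :=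
    fit a (ha.trans (Nat.le_mul_of_pos_right _ hV8))
  have fn : n < 2 ^ b := fit n ((hnV.le.trans hVV).trans (Nat.le_mul_of_pos_left _ (by omega)))
  have fs : s < 2 ^ b := fit1 s (Nat.lt_two_pow_self.le.trans hw)
  have fx (i : Fin n) : x i < 2 ^ b := fit1 _ ((hx i).le.trans hw)
  have f2 : 2 < 2 ^ b := fit1 2 (by omega)
  have hfit (j : ℕ) (_ : 1 ≤ j) (hp : 2 ^ j ≤ 2 * n) : Fits b n s m j :=
    fits_of_le hnV hmV fit j hp
  exact ⟨multiplicative_estimate hn0 f2 fn fx fs hfit h0 h1 h15 h17,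
    fun J hJ0 hJ => multiplicative_time hn0 f2 fn fx fs hm hfit h0 h1 h15 h17 hJ0 hJ⟩

/-- A round that is certain to be accurate enough, expressed by the compressibility. -/
theorem exists_round (hn0 : 1 ≤ n) (s : ℕ) (x : Fin n → ℕ) :
    ∃ J : ℕ, 1 ≤ J ∧ 4 * n ≤ 2 ^ J * totalCost s x ∧
      (2 : ℝ) ^ J ≤ (20 + 4 * s) * (n / totalCost s x) ∧
      (J : ℝ) ≤ 10 * Real.log (2 + n / totalCost s x) := by
  have hn' : (0 : ℝ) < n := Nat.cast_pos.2 hn0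
  have hC : (1 : ℝ) ≤ totalCost s x := by exact_mod_cast totalCost_pos hn0 s x
  have hCn : (totalCost s x : ℝ) ≤ (1 + s) * n := by exact_mod_cast totalCost_le s x
  set y : ℝ := n / totalCost s x with hy
  have hy0 : 0 < y := by positivity
  have hy1 : 1 ≤ (1 + s) * y := by
    rw [hy, ← mul_div_assoc, le_div_iff₀ (by linarith), one_mul]
    exact hCn
  have hyC : y * totalCost s x = n := div_mul_cancel₀ _ (by linarith)
  have hM := Nat.le_ceil (4 * y)
  have hM' := Nat.ceil_lt_add_one (show 0 ≤ 4 * y by positivity)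
  have hM0 : 0 < ⌈4 * y⌉₊ := Nat.ceil_pos.2 (by positivity)
  -- `J = ⌈log₂ (⌈4 y⌉ + 1)⌉` makes `2 ^ J` at least `4 y` and at most `2 ⌈4 y⌉`.
  have hJ1 : ⌈4 * y⌉₊ + 1 ≤ 2 ^ Nat.clog 2 (⌈4 * y⌉₊ + 1) := Nat.le_pow_clog (by norm_num) _
  have hJ2 := Nat.pow_pred_clog_lt_self (b := 2) (x := ⌈4 * y⌉₊ + 1) (by norm_num) (by omega)
  obtain ⟨v, hv⟩ : ∃ v, Nat.clog 2 (⌈4 * y⌉₊ + 1) = v + 1 :=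
    ⟨_, (Nat.succ_pred (Nat.clog_pos (by norm_num) (by omega)).ne').symm⟩
  rw [hv] at hJ1
  rw [hv, Nat.pred_succ] at hJ2
  have hv1 : (4 * y : ℝ) ≤ 2 ^ (v + 1) := hM.trans (by exact_mod_cast (Nat.le_succ _).trans hJ1)
  have hv2 : (2 : ℝ) ^ (v + 1) ≤ 8 * y + 2 := by
    have : (2 : ℝ) ^ v ≤ ⌈4 * y⌉₊ := by exact_mod_cast Nat.lt_succ_iff.1 hJ2
    rw [pow_succ]
    linarith
  refine ⟨v + 1, by omega, ?_, ?_, ?_⟩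
  · have : (4 * n : ℝ) ≤ 2 ^ (v + 1) * totalCost s x := by
      rw [← hyC, ← mul_assoc]
      gcongr
    exact_mod_cast this
  -- Highly incompressible strings may have `y < 1`; the constant term of `8 y + 2` is absorbed by
  -- `1 ≤ (1 + s) y`.
  · have : (0 : ℝ) ≤ s * y := by positivity
    nlinarith
  · have := natCast_le_log_of_two_pow_le (u := v + 1) (a := 3) hy0.le (by linarith)
    refine this.trans ?_
    have : 0 ≤ Real.log (2 + y) := Real.log_nonneg (by linarith)
    norm_num
    nlinarith

end

/-- The additional `10` leaves room for a prologue before the program. -/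
theorem multiplicative_time_le_softBound {κ n s m m' : ℕ} {x : Fin n → ℕ} (hn0 : 1 ≤ n)
    (hm : 1 ≤ m) (hmV : m < 2 ^ (n.size + m'.size)) (hx : ∀ i, x i < 2 ^ s)
    (hκ : wordFactor s + 8 ≤ κ) {σ : Store} (h0 : σ.reg 0 = n) (h1 : σ.reg 1 = m)
    (h15 : σ.reg 15 = 0) (h17 : σ.reg 17 = 0) :
    timeFrom (wordLength κ n m') x ([multiplicative s], σ) + 10 ≤
      ENNReal.ofReal (softBound (timeFactor s m * (400000 * (20 + 4 * s))) 5
        (n / totalCost s x)) := by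
  obtain ⟨J, hJ1, hJ2, hJ3, hJ4⟩ := exists_round hn0 s x
  refine (add_le_add_left ((multiplicative_spec hn0 hm hmV hx hκ h0 h1 h15 h17).2 J hJ1 hJ2)
    _).trans ?_
  have hD : 30000 ≤ timeFactor s m := by
    have h2 : (1 : ℝ) ≤ roundFactor s := by
      exact_mod_cast (show 1 ≤ roundFactor s by unfold roundFactor; omega)
    have h3 : (1 : ℝ) ≤ (m + 1) ^ 2 := by
      have : (0 : ℝ) ≤ m := Nat.cast_nonneg _
      nlinarith
    rw [timeFactor]
    nlinarith
  rw [show (10 : ℝ≥0∞) = ENNReal.ofReal 10 by simp, ← ENNReal.ofReal_add (by positivity)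
    (by norm_num)]
  refine ENNReal.ofReal_le_ofReal ?_
  have hJ5 : (1 : ℝ) ≤ J ^ 5 := one_le_pow₀ (by exact_mod_cast hJ1)
  have hJ6 : (1 : ℝ) ≤ 2 ^ J := one_le_pow₀ (by norm_num)
  have hX : 1 ≤ (J : ℝ) ^ 5 * 2 ^ J := one_le_mul_of_one_le_of_one_le hJ5 hJ6
  have hJ7 : (J : ℝ) ^ 5 ≤ (10 * Real.log (2 + n / totalCost s x)) ^ 5 :=
    pow_le_pow_left₀ (by positivity) hJ4 5
  have hlog := (show (0 : ℝ) ≤ J ^ 5 by positivity).trans hJ7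
  rw [softBound]
  calc 10 + timeFactor s m * (J ^ 5 * (2 * 2 ^ J)) + 10
      ≤ timeFactor s m * (4 * (J ^ 5 * 2 ^ J)) := by nlinarith
    _ ≤ timeFactor s m * (4 * ((10 * Real.log (2 + n / totalCost s x)) ^ 5 *
          ((20 + 4 * s) * (n / totalCost s x)))) := by gcongr
    _ = _ := by ring

/-- The relative error `1 / (m + 1)` is exactly what the lower bound permits, as `1 - 1 / (m + 1) =
1 / (1 + 1 / m)`. -/
theorem isEstimate_of_abs_sub_le {n m : ℕ} {C v lam : ℝ} (hC : 0 ≤ C) (hm : 1 ≤ m)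
    (hlam : 1 + 1 / m ≤ lam) (h : |v - C| ≤ 1 / (m + 1) * C) : IsEstimate n lam 0 C v := by
  have hm' : (0 : ℝ) < m := Nat.cast_pos.2 hm
  rw [abs_le] at h
  have h1 : C / lam ≤ C / (1 + 1 / m) := by gcongr
  have h2 : C / (1 + 1 / m) = C - 1 / (m + 1) * C := by field_simp; ring
  have h3 : (1 / (m + 1) : ℝ) * C ≤ 1 / m * C := by gcongr; linarith
  have h4 : (1 + 1 / m) * C ≤ lam * C := by gcongr
  constructor <;> linarith [h.1, h.2]

theorem exists_multiplicative (A : Type*) [Fintype A] [DecidableEq A] :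
    ∃ (P : Prog) (κ : ℕ) (K : ℝ) (c d : ℕ), 0 < κ ∧
      ∀ (enc : A ≃ Fin (Fintype.card A)) (n : ℕ) (w : Fin n → A) (γ : ℝ),
        1 ≤ n → 0 < γ →
        Estimates P κ enc w ⌈1 / γ⌉₊ (1 + γ) 0 ∧
        expectedTime P κ (fun i => (enc (w i) : ℕ)) ⌈1 / γ⌉₊ ≤
          ENNReal.ofReal (softBound K c ((n : ℝ) / rleCost w * (1 + 1 / γ) ^ d)) := by
  set s := Nat.clog 2 (Fintype.card A) with hs
  refine ⟨multiplicative s, wordFactor s + 8,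
    120000 * roundFactor s * (400000 * (20 + 4 * s)), 5, 2, by omega, fun enc n w γ hn hγ => ?_⟩
  have hm : 1 ≤ ⌈1 / γ⌉₊ := Nat.ceil_pos.2 (by positivity)
  have hx (i : Fin n) : (enc (w i) : ℕ) < 2 ^ s := enc_lt enc (w i)
  obtain ⟨⟨T, μ, hrun, hμ⟩, -⟩ := multiplicative_spec (σ := startStore n ⌈1 / γ⌉₊)
    (m' := ⌈1 / γ⌉₊) hn hm (lt_two_pow_size_add_right _ _) hx le_rfl rfl rfl rfl rfl
  have htime := multiplicative_time_le_softBound (σ := startStore n ⌈1 / γ⌉₊)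
    (m' := ⌈1 / γ⌉₊) hn hm (lt_two_pow_size_add_right _ _) hx le_rfl rfl rfl rfl rfl
  refine ⟨estimates_of_runs hrun hμ (by norm_num) fun σ hσ => ?_, ?_⟩
  · rw [Set.mem_ofPred_eq, not_not, hs, totalCost_enc] at hσ
    exact isEstimate_of_abs_sub_le (Nat.cast_nonneg _) hm
      (by linarith [one_div_ceil_le hγ]) hσ
  · rw [expectedTime_eq_timeFrom]
    refine le_self_add.trans (htime.trans (ENNReal.ofReal_le_ofReal ?_))
    rw [hs, totalCost_enc, softBound, softBound, ← hs]
    have hy : 0 ≤ (n : ℝ) / rleCost w := by positivity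
    have hg : 1 ≤ (1 + 1 / γ) ^ 2 := one_le_pow₀ (by
      have : 0 < 1 / γ := by positivity
      linarith)
    -- The number of samples is quadratic in `m + 1`; this is where the exponent `d = 2` comes from.
    have hm1 : ((⌈1 / γ⌉₊ : ℝ) + 1) ^ 2 ≤ 4 * (1 + 1 / γ) ^ 2 := by
      have h1 := Nat.ceil_lt_add_one (show 0 ≤ 1 / γ by positivity)
      have h2 : 0 < 1 / γ := by positivity
      calc ((⌈1 / γ⌉₊ : ℝ) + 1) ^ 2 ≤ (2 * (1 + 1 / γ)) ^ 2 := by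
            gcongr
            linarith
        _ = _ := by ring
    have hlog : Real.log (2 + n / rleCost w) ≤
        Real.log (2 + n / rleCost w * (1 + 1 / γ) ^ 2) := by
      refine Real.log_le_log (by positivity) ?_
      nlinarith
    have hlog0 : 0 ≤ Real.log (2 + n / rleCost w) := Real.log_nonneg (by linarith)
    rw [timeFactor]
    calc 30000 * roundFactor s * ((⌈1 / γ⌉₊ : ℝ) + 1) ^ 2 * (400000 * (20 + 4 * s)) *
          (n / rleCost w) * Real.log (2 + n / rleCost w) ^ 5
        ≤ 30000 * roundFactor s * (4 * (1 + 1 / γ) ^ 2) * (400000 * (20 + 4 * s)) *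
          (n / rleCost w) * Real.log (2 + n / rleCost w * (1 + 1 / γ) ^ 2) ^ 5 := by gcongr
      _ = _ := by ring

/-- With no accuracy parameter given, the program sets `m = 1` itself, so the word length depends on
`n` only. The resulting factor is `2`. -/
theorem exists_fourfold (A : Type*) [Fintype A] [DecidableEq A] :
    ∃ (P : Prog) (κ : ℕ) (K : ℝ) (c : ℕ), 0 < κ ∧
      ∀ (enc : A ≃ Fin (Fintype.card A)) (n : ℕ) (w : Fin n → A),
        1 ≤ n →
        Estimates P κ enc w 0 4 0 ∧
        expectedTime P κ (fun i => (enc (w i) : ℕ)) 0 ≤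
          ENNReal.ofReal (softBound K c ((n : ℝ) / rleCost w)) := by
  set s := Nat.clog 2 (Fintype.card A) with hs
  refine ⟨.seq (block [.const 1 1]) (multiplicative s), wordFactor s + 8,
    timeFactor s 1 * (400000 * (20 + 4 * s)), 5, by omega, fun enc n w hn => ?_⟩
  have hx (i : Fin n) : (enc (w i) : ℕ) < 2 ^ s := enc_lt enc (w i)
  have hV : 1 < 2 ^ (n.size + Nat.size 0) := (hn.trans_lt (lt_two_pow_size_add_left n 0))
  have run0 := runs_block (b := wordLength (wordFactor s + 8) n 0)
    (x := fun i => (enc (w i) : ℕ)) [.const 1 1] (by simp) (by simp [Instr.IsDet])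
    (startStore n 0)
  set σ := [Instr.const 1 1].foldl
    (Instr.eff (wordLength (wordFactor s + 8) n 0) fun i => (enc (w i) : ℕ)) (startStore n 0)
    with hσ
  have h0 : σ.reg 0 = n := by simp [hσ, Instr.eff, set_reg, startStore]
  have h1 : σ.reg 1 = 1 := by
    have : 1 < 2 ^ wordLength (wordFactor s + 8) n 0 :=
      Nat.one_lt_two_pow (Nat.mul_pos (by omega) (Nat.add_pos_left (Nat.size_pos.2 hn) _)).ne'
    simp [hσ, Instr.eff, set_reg, Nat.mod_eq_of_lt this]
  have h15 : σ.reg 15 = 0 := by simp [hσ, Instr.eff, set_reg, startStore]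
  have h17 : σ.reg 17 = 0 := by simp [hσ, Instr.eff, set_reg, startStore]
  obtain ⟨⟨T, μ, hrun, hμ⟩, -⟩ := multiplicative_spec (m' := 0) hn le_rfl hV hx le_rfl h0 h1 h15 h17
  have htime := multiplicative_time_le_softBound (m' := 0) hn le_rfl hV hx le_rfl h0 h1 h15 h17
  refine ⟨estimates_of_runs (run0.seq_pure hrun) hμ (by norm_num) fun σ hσ => ?_, ?_⟩
  · rw [Set.mem_ofPred_eq, not_not, hs, totalCost_enc] at hσ
    exact isEstimate_of_abs_sub_le (Nat.cast_nonneg _) le_rfl (by norm_num) hσ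
  · rw [hs, totalCost_enc, ← hs] at htime
    rw [expectedTime_eq_timeFrom]
    refine le_trans ?_ htime
    have h2 := run0 [multiplicative s]
    rw [PMF.pure_map] at h2
    have h3 := (Exec.of_step (c := ([.seq (block [.const 1 1]) (multiplicative s)],
      startStore n 0)) rfl h2).timeFrom_le
    rw [tsum_pure_mul] at h3
    refine h3.trans ((add_comm _ _).le.trans ?_)
    gcongr
    norm_num

end RunLength

theorem mainTheorem7 {A : Type*} [Fintype A] [DecidableEq A] :
    -- additive approximation
    (∃ (P : RunLength.Prog) (κ : ℕ) (K : ℝ) (c : ℕ), 0 < κ ∧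
      ∀ (enc : A ≃ Fin (Fintype.card A)) (n : ℕ) (w : Fin n → A) (ε : ℝ),
        1 ≤ n → 0 < ε → ε < 1 →
        RunLength.Estimates P κ enc w ⌈1 / ε⌉₊ 1 ε ∧
        RunLength.HaltsWithin P κ (fun i => (enc (w i) : ℕ)) ⌈1 / ε⌉₊
          (RunLength.softBound K c (1 / ε ^ 3))) ∧
    -- combined approximation
    (∃ (P : RunLength.Prog) (κ : ℕ) (K : ℝ) (c : ℕ), 0 < κ ∧
      ∀ (enc : A ≃ Fin (Fintype.card A)) (n : ℕ) (w : Fin n → A) (ε : ℝ),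
        1 ≤ n → 0 < ε → ε < 1 →
        RunLength.Estimates P κ enc w ⌈1 / ε⌉₊ 3 ε ∧
        RunLength.HaltsWithin P κ (fun i => (enc (w i) : ℕ)) ⌈1 / ε⌉₊
          (RunLength.softBound K c (1 / ε))) ∧
    -- multiplicative approximation within a factor of four
    (∃ (P : RunLength.Prog) (κ : ℕ) (K : ℝ) (c : ℕ), 0 < κ ∧
      ∀ (enc : A ≃ Fin (Fintype.card A)) (n : ℕ) (w : Fin n → A),
        1 ≤ n →
        RunLength.Estimates P κ enc w 0 4 0 ∧
        RunLength.expectedTime P κ (fun i => (enc (w i) : ℕ)) 0 ≤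
          ENNReal.ofReal (RunLength.softBound K c ((n : ℝ) / RunLength.rleCost w))) ∧
    -- multiplicative approximation within a factor arbitrarily close to one
    (∃ (P : RunLength.Prog) (κ : ℕ) (K : ℝ) (c d : ℕ), 0 < κ ∧
      ∀ (enc : A ≃ Fin (Fintype.card A)) (n : ℕ) (w : Fin n → A) (γ : ℝ),
        1 ≤ n → 0 < γ →
        RunLength.Estimates P κ enc w ⌈1 / γ⌉₊ (1 + γ) 0 ∧
        RunLength.expectedTime P κ (fun i => (enc (w i) : ℕ)) ⌈1 / γ⌉₊ ≤
          ENNReal.ofReal (RunLength.softBound K c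
            ((n : ℝ) / RunLength.rleCost w * (1 + 1 / γ) ^ d))) :=
  ⟨RunLength.exists_additive A, RunLength.exists_combined A, RunLength.exists_fourfold A,
    RunLength.exists_multiplicative A⟩
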